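/- **Model.** A network has layers $k\in\{0,\dots,K\}$ with altitudes $h_k\ge 0$ ($h_0=0$), transmission powers $P_k>0$, association biases $B_k>0$ and transmitter densities $\lambda_k\ge 0$. The horizontal positions of the $k$-layer transmitters form a homogeneous Poisson point process in $\mathbb R^2$ of density $\lambda_k$, independently over $k$. Fix a layer $i$ with $h_i>0$ and an $i$-layer receiver above the origin. A $k$-layer transmitter at horizontal position $z$ has link distance $x=\sqrt{|z|^2+(h_i-h_k)^2}$; given the positions, its link is, independently of all others, line-of-sight (L) with probability $\rho_{ik}(x)$ and non-line-of-sight (N) otherwise. Here the $\rho_{ik}$ are measurable functions with values in $[0,1]$, and in the same layer $$\rho_{ii}(x)=\Bigl(1-e^{-h_i^2/(2\xi^2)}\Bigr)^{x\sqrt{\nu\mu}}=e^{-\eta x}\quad (x\ge 0),\qquad \eta=-\sqrt{\mu\nu}\,\ln\Bigl(1-e^{-h_i^2/(2\xi^2)}\Bigr),\qquad \mu,\nu,\xi>0 .$$ Environment $c\in\{\mathrm L,\mathrm N\}$ has pathloss exponent $\alpha^{(c)}\ge 2$. The gain $G$ of a link in environment $c$ is Gamma distributed with shape $m^{(c)}$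 and scale $1/m^{(c)}$, where $m^{(\mathrm L)}=m^{(\mathrm N)}=1$ (so $G\sim\exp(1)$); the gains are independent of each other and of everything else. The receiver is associated with the transmitter, among those of all layers, that maximizes $B_k x^{-1}$ (nearest-distance criterion) or $B_k x^{-\alpha^{(c)}}$ (strongest-power criterion), where $k$, $x$, $c$ are the layer, the link distance and the environment of that transmitter. Let $\varepsilon_{ij}^{(c)}(y)$ be the event that the associated transmitter lies in layer $j$ and that its link (the main link) has environment $c$ and distance $y>0$. For $c_{\mathrm o}\in\{\mathrm L,\mathrm N\}$ let $$I_{ii}^{(c_{\mathrm o})}=\sum P_i\,G\,x^{-\alpha^{(c_{\mathrm o})}}$$ be the interference from the same layer, the sum being over all $i$-layer transmitters whose link has environment $c_{\mathrm o}$, except the associated transmitter. Put $\chi=yB_i/B_j$ for the nearest-distance criterion and $\chi=\bigl(y^{\alpha^{(c)}}B_i/B_j\bigr)^{1/\alpha^{(c_{\mathrm o})}}$ for the strongest-power criterion. Let $\Gamma(a,z)=\int_z^\infty t^{a-1}e^{-t}\,dt$ denote the upper incomplete gamma function, and let $\mathcal L_{I\mid\varepsilon}(s)$ denote $\int e^{-sx}\,dQ(x)$,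 where $Q$ is the regular conditional law of $I$ given the main link (its layer, environment and distance). **Claim.** For either criterion: 1. $I_{ii}^{(\mathrm L)}$ converges almost surely. For almost every main link $(j,c,y)$ and all $s\ge0$ with $sP_i\chi^{-\alpha^{(\mathrm L)}}<1$, the following series converges and $$\mathcal L_{I_{ii}^{(\mathrm L)}\mid\varepsilon_{ij}^{(c)}(y)}(s)=\exp\Bigl[2\pi\lambda_i\sum_{n=1}^\infty(-sP_i)^n\,\eta^{n\alpha^{(\mathrm L)}-2}\,\Gamma\bigl(2-n\alpha^{(\mathrm L)},\eta\chi\bigr)\Bigr].$$ 2. If $\alpha^{(\mathrm N)}>2$, then $I_{ii}^{(\mathrm N)}$ converges almost surely. For almost every main link $(j,c,y)$ and all $s\ge0$ with $sP_i\chi^{-\alpha^{(\mathrm N)}}<1$, the following series converges and $$\mathcal L_{I_{ii}^{(\mathrm N)}\mid\varepsilon_{ij}^{(c)}(y)}(s)=\exp\Bigl[2\pi\lambda_i\sum_{n=1}^\infty(-sP_i)^n\Bigl\{\frac{\chi^{2-n\alpha^{(\mathrm N)}}}{n\alpha^{(\mathrm N)}-2}-\eta^{n\alpha^{(\mathrm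 N)}-2}\,\Gamma\bigl(2-n\alpha^{(\mathrm N)},\eta\chi\bigr)\Bigr\}\Bigr].$$ -/

import Mathlib

open MeasureTheory ProbabilityTheory
open scoped ENNReal NNReal

noncomputable section

namespace MAN

/-- The channel environment of a link: line of sight (`L`) or non line of sight (`N`). -/
inductive Channel where
  | L : Channel
  | N : Channel

instance : MeasurableSpace Channel := ⊤

/-- The association criterion: nearest distance or strongest (biased average) power. -/
inductive Criterion where
  | nearest : Criterion
  | strongest : Criterion

/-- The horizontal plane, with its Euclidean norm and Lebesgue measure. -/
abbrev Plane : Type := EuclideanSpace ℝ (Fin 2)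

/-- The upper incomplete gamma function `Γ(x, y) = ∫_y^∞ t^(x-1) e^(-t) dt` (for `y > 0` the
integral converges for every real `x`). -/
def upperGamma (x y : ℝ) : ℝ := ∫ t in Set.Ioi y, t ^ (x - 1) * Real.exp (-t)

/-- The deterministic parameters of a multi-layer aerial network with layers `0, …, K`. -/
structure Params (K : ℕ) where
  /-- altitude of each layer -/
  h : Fin (K + 1) → ℝ
  /-- transmission power of each layer -/
  P : Fin (K + 1) → ℝ
  /-- association bias of each layer -/
  B : Fin (K + 1) → ℝ
  /-- density of the transmitters of each layer -/
  lam : Fin (K + 1) → ℝ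
  /-- pathloss exponent of each channel environment -/
  alpha : Channel → ℝ
  /-- Nakagami parameter of each channel environment -/
  m : Channel → ℝ
  /-- `rho i k x`: probability that a link of length `x` from a `k`-layer transmitter to an
  `i`-layer receiver is line of sight -/
  rho : Fin (K + 1) → Fin (K + 1) → ℝ → ℝ
  h_zero : h 0 = 0
  h_nonneg : ∀ k, 0 ≤ h k
  P_pos : ∀ k, 0 < P k
  B_pos : ∀ k, 0 < B k
  lam_nonneg : ∀ k, 0 ≤ lam k
  two_le_alpha : ∀ c, 2 ≤ alpha c
  one_le_m : ∀ c, 1 ≤ m c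
  rho_measurable : ∀ i k, Measurable (rho i k)
  rho_mem : ∀ i k x, rho i k x ∈ Set.Icc (0 : ℝ) 1

/-- The number of points in `A` of the point process with points `X 0, X 1, …, X (N - 1)`
(infinitely many points if `N = ∞`). -/
def pointCount {Ω E : Type*} (N : Ω → ℕ∞) (X : ℕ → Ω → E) (A : Set E) (ω : Ω) : ℕ∞ :=
  Set.encard {n : ℕ | (n : ℕ∞) < N ω ∧ X n ω ∈ A}

/-- The point process with points `X 0, …, X (N - 1)` is a Poisson point process with intensity
measure `Lam`. -/
structure IsPoissonPointProcess {Ω E : Type*} [MeasurableSpace Ω] [MeasurableSpace E]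
    (μ : Measure Ω) (Lam : Measure E) (N : Ω → ℕ∞) (X : ℕ → Ω → E) : Prop where
  measurable_num : Measurable N
  measurable_point : ∀ n, Measurable (X n)
  count_law : ∀ A : Set E, MeasurableSet A → Lam A ≠ ∞ →
    μ.map (pointCount N X A) = (poissonMeasure (Lam A).toNNReal).map (fun n : ℕ => (n : ℕ∞))
  count_indep : ∀ (n : ℕ) (A : Fin n → Set E), (∀ l, MeasurableSet (A l)) →
    Pairwise (fun l l' => Disjoint (A l) (A l')) →
    iIndepFun (fun l => pointCount N X (A l)) μ

/-- The transmitters seen by a receiver, on a probability space `(Ω, μ)`. A transmitter is named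
by its layer and its number within the layer. -/
structure Network {K : ℕ} (p : Params K) {Ω : Type*} [MeasurableSpace Ω] (μ : Measure Ω) where
  /-- number of transmitters of each layer -/
  num : Fin (K + 1) → Ω → ℕ∞
  /-- horizontal positions, relative to the receiver, of the transmitters of each layer -/
  loc : Fin (K + 1) → ℕ → Ω → Plane
  /-- uniform variables deciding whether the links are line of sight -/
  unif : Fin (K + 1) × ℕ → Ω → ℝ
  /-- `gain (c, v)`: channel gain of the link from `v` if its environment is `c` -/
  gain : Channel × (Fin (K + 1) × ℕ) → Ω → ℝ
  poisson : ∀ k, IsPoissonPointProcess μ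
    (ENNReal.ofReal (p.lam k) • (volume : Measure Plane)) (num k) (loc k)
  unif_measurable : ∀ v, Measurable (unif v)
  unif_law : ∀ v, μ.map (unif v) = (volume : Measure ℝ).restrict (Set.Icc 0 1)
  gain_measurable : ∀ w, Measurable (gain w)
  /-- Gamma distribution of shape `m` and scale `1 / m` (that is, rate `m`) -/
  gain_law : ∀ w, μ.map (gain w) = gammaMeasure (p.m w.1) (p.m w.1)
  /-- the layers are independent -/
  indep_layers : iIndepFun (fun k ω => (num k ω, fun n => loc k n ω)) μ
  indep_unif : iIndepFun unif μ
  indep_gain : iIndepFun gain μ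
  /-- the line-of-sight variables and the gains are independent of each other, and jointly
  independent of the positions -/
  indep_unif_gain : IndepFun (fun ω v => unif v ω) (fun ω w => gain w ω) μ
  indep_loc_marks : IndepFun (fun ω k => (num k ω, fun n => loc k n ω))
    (fun ω => ((fun v => unif v ω), (fun w => gain w ω))) μ

namespace Network

variable {K : ℕ} {p : Params K} {Ω : Type*} [MeasurableSpace Ω] {μ : Measure Ω}

/-- `v` is one of the transmitters of the network. -/
def Active (net : Network p μ) (v : Fin (K + 1) × ℕ) (ω : Ω) : Prop :=
  (v.2 : ℕ∞) < net.num v.1 ω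

/-- Length of the link from the transmitter `v` to an `i`-layer receiver. -/
def linkDist (net : Network p μ) (i : Fin (K + 1)) (v : Fin (K + 1) × ℕ) (ω : Ω) : ℝ :=
  Real.sqrt (‖net.loc v.1 v.2 ω‖ ^ 2 + (p.h i - p.h v.1) ^ 2)

open Classical in
/-- Environment of the link from `v` to an `i`-layer receiver: given the positions, it is line of
sight with probability `rho i k x`, `k` the layer of `v` and `x` the length of the link. -/
def channel (net : Network p μ) (i : Fin (K + 1)) (v : Fin (K + 1) × ℕ) (ω : Ω) : Channel :=
  if net.unif v ω ≤ p.rho i v.1 (net.linkDist i v ω) then Channel.L else Channel.N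

/-- The quantity that the associated transmitter maximizes: `B_k x⁻¹` or `B_k x^(-α)`. -/
def metric (net : Network p μ) (a : Criterion) (i : Fin (K + 1)) (v : Fin (K + 1) × ℕ)
    (ω : Ω) : ℝ :=
  match a with
  | Criterion.nearest => p.B v.1 * (net.linkDist i v ω)⁻¹
  | Criterion.strongest =>
      p.B v.1 * net.linkDist i v ω ^ (-p.alpha (net.channel i v ω))

/-- The `i`-layer receiver is associated with the transmitter `v`, the (almost surely unique)
maximizer of the metric among all transmitters of all layers. -/
def IsAssociated (net : Network p μ) (a : Criterion) (i : Fin (K + 1)) (v : Fin (K + 1) × ℕ)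
    (ω : Ω) : Prop :=
  net.Active v ω ∧ ∀ w, net.Active w ω → w ≠ v → net.metric a i w ω < net.metric a i v ω

open Classical in
/-- The main link: the layer of the associated transmitter, the environment of its link, and the
length of its link. (The value `0` of the length is used when there is no associated transmitter;
an actual main link has positive length almost surely.) -/
def mainLink (net : Network p μ) (a : Criterion) (i : Fin (K + 1)) (ω : Ω) :
    Fin (K + 1) × Channel × ℝ :=
  if hv : ∃ v, net.IsAssociated a i v ω then
    (hv.choose.1, net.channel i hv.choose ω, net.linkDist i hv.choose ω)
  else (i, Channel.N, 0)

open Classical in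
/-- Contribution of the transmitter `v` to the interference at an `i`-layer receiver from the
`k`-layer transmitters in the environment `co`; the associated transmitter does not interfere. -/
def interferenceTerm (net : Network p μ) (a : Criterion) (i k : Fin (K + 1)) (co : Channel)
    (ω : Ω) (v : Fin (K + 1) × ℕ) : ℝ :=
  if net.Active v ω ∧ v.1 = k ∧ net.channel i v ω = co ∧ ¬ net.IsAssociated a i v ω then
    p.P k * net.gain (co, v) ω * net.linkDist i v ω ^ (-p.alpha co)
  else 0

/-- The interference at an `i`-layer receiver from the `k`-layer transmitters in the environment
`co`. -/
def interference (net : Network p μ) (a : Criterion) (i k : Fin (K + 1)) (co : Channel)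
    (ω : Ω) : ℝ :=
  ∑' v, net.interferenceTerm a i k co ω v

theorem measurableSet_active (net : Network p μ) (v : Fin (K + 1) × ℕ) :
    MeasurableSet {ω | net.Active v ω} :=
  (net.poisson v.1).measurable_num (MeasurableSet.of_discrete (s := Set.Ioi (v.2 : ℕ∞)))

theorem measurable_linkDist (net : Network p μ) (i : Fin (K + 1)) (v : Fin (K + 1) × ℕ) :
    Measurable (net.linkDist i v) := by
  have := (net.poisson v.1).measurable_point v.2
  unfold linkDist
  fun_prop

theorem measurable_channel (net : Network p μ) (i : Fin (K + 1)) (v : Fin (K + 1) × ℕ) :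
    Measurable (net.channel i v) := by
  unfold channel
  exact Measurable.ite (measurableSet_le (net.unif_measurable v)
    ((p.rho_measurable i v.1).comp (net.measurable_linkDist i v))) measurable_const measurable_const

theorem measurable_metric (net : Network p μ) (a : Criterion) (i : Fin (K + 1))
    (v : Fin (K + 1) × ℕ) : Measurable (net.metric a i v) := by
  have h1 := net.measurable_linkDist i v
  have h2 : Measurable fun ω => p.alpha (net.channel i v ω) :=
    measurable_from_top.comp (net.measurable_channel i v)
  cases a
  · exact measurable_const.mul h1.inv
  · exact measurable_const.mul (h1.pow h2.neg)

theorem measurableSet_isAssociated (net : Network p μ) (a : Criterion) (i : Fin (K + 1))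
    (v : Fin (K + 1) × ℕ) : MeasurableSet {ω | net.IsAssociated a i v ω} := by
  have : {ω | net.IsAssociated a i v ω} = {ω | net.Active v ω} ∩
      ⋂ w, {ω | net.Active w ω → w ≠ v → net.metric a i w ω < net.metric a i v ω} := by
    ext ω; simp [IsAssociated]
  rw [this]
  refine (net.measurableSet_active v).inter (MeasurableSet.iInter fun w => ?_)
  by_cases hw : w = v
  · simp [hw]
  · have : {ω | net.Active w ω → w ≠ v → net.metric a i w ω < net.metric a i v ω} =
        {ω | net.Active w ω}ᶜ ∪ {ω | net.metric a i w ω < net.metric a i v ω} := by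
      ext ω; simp [hw, imp_iff_not_or]
    rw [this]
    exact (net.measurableSet_active w).compl.union
      (measurableSet_lt (net.measurable_metric a i w) (net.measurable_metric a i v))

theorem measurable_interference (net : Network p μ) (a : Criterion) (i k : Fin (K + 1))
    (co : Channel) : Measurable (net.interference a i k co) := by
  unfold interference
  refine Measurable.tsum (ι := Fin (K + 1) × ℕ) fun v => ?_
  have h1 := net.measurable_linkDist i v
  have h2 := net.gain_measurable (co, v)
  unfold interferenceTerm
  refine Measurable.ite ?_ (by fun_prop) measurable_const
  exact (net.measurableSet_active v).inter ((MeasurableSet.const _).inter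
    ((net.measurable_channel i v (MeasurableSet.of_discrete (s := {co}))).inter
      (net.measurableSet_isAssociated a i v).compl))

theorem IsAssociated.unique {net : Network p μ} {a : Criterion} {i : Fin (K + 1)}
    {v w : Fin (K + 1) × ℕ} {ω : Ω} (hv : net.IsAssociated a i v ω)
    (hw : net.IsAssociated a i w ω) : v = w := by
  by_contra h
  exact lt_asymm (hv.2 w hw.1 (Ne.symm h)) (hw.2 v hv.1 h)

theorem measurable_mainLink (net : Network p μ) (a : Criterion) (i : Fin (K + 1)) :
    Measurable (net.mainLink a i) := by
  intro S hS
  have hv : ∀ v, MeasurableSet {ω | (v.1, net.channel i v ω, net.linkDist i v ω) ∈ S} :=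
    fun v => (measurable_const.prodMk ((net.measurable_channel i v).prodMk
      (net.measurable_linkDist i v))) hS
  have hA := net.measurableSet_isAssociated a i
  have : net.mainLink a i ⁻¹' S = (⋃ v, {ω | net.IsAssociated a i v ω} ∩
      {ω | (v.1, net.channel i v ω, net.linkDist i v ω) ∈ S}) ∪
      ((⋃ v, {ω | net.IsAssociated a i v ω})ᶜ ∩ {_ω | (i, Channel.N, (0 : ℝ)) ∈ S}) := by
    ext ω
    by_cases h : ∃ v, net.IsAssociated a i v ω
    · have hu : ∀ v, net.IsAssociated a i v ω ↔ v = h.choose :=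
        fun v => ⟨fun h' => h'.unique h.choose_spec, fun h' => h' ▸ h.choose_spec⟩
      generalize hw : h.choose = w at hu
      simp [mainLink, hu]
    · have h' : ∀ v, ¬ net.IsAssociated a i v ω := not_exists.1 h
      simp [mainLink, h']
  rw [this]
  exact (MeasurableSet.iUnion fun v => (hA v).inter (hv v)).union
    ((MeasurableSet.iUnion hA).compl.inter (MeasurableSet.const _))

/-- The Laplace transform at `s` of the interference from the `k`-layer transmitters in the
environment `co`, under its conditional law given that the main link of the `i`-layer receiver is
`e = (j, c, y)`, that is, given that it comes from layer `j` in the environment `c` and has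
length `y`. -/
def condLaplace [IsFiniteMeasure μ] (net : Network p μ) (a : Criterion) (i k : Fin (K + 1))
    (co : Channel) (e : Fin (K + 1) × Channel × ℝ) (s : ℝ) : ℝ :=
  ∫ x, Real.exp (-(s * x))
    ∂(condDistrib (net.interference a i k co) (net.mainLink a i) μ e)

end Network

/-- The distance below which no `k`-layer transmitter in the environment `co` can interfere when
the receiver is associated, by criterion `a`, through the main link `e = (j, c, y)`. -/
def exclusionDist {K : ℕ} (p : Params K) (a : Criterion) (k : Fin (K + 1)) (co : Channel)
    (e : Fin (K + 1) × Channel × ℝ) : ℝ :=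
  match a with
  | Criterion.nearest => e.2.2 * p.B k / p.B e.1
  | Criterion.strongest =>
      (e.2.2 ^ p.alpha e.2.1 * p.B k / p.B e.1) ^ (1 / p.alpha co)

/-- The decay rate `η` of the line-of-sight probability `e^(-ηx)` between two nodes of altitude
`h`: `mu` is the ratio of the area covered by buildings, `nu` the number of buildings per unit
area, `xi` their average altitude. -/
def eta (mu nu xi h : ℝ) : ℝ :=
  -Real.sqrt (mu * nu) * Real.log (1 - Real.exp (-(h ^ 2 / (2 * xi ^ 2))))

/-- The `n`-th term of the series for line-of-sight interference (`w = s P`). -/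
def losTerm (w alpha η χ : ℝ) (n : ℕ) : ℝ :=
  (-w) ^ n * (η ^ ((n : ℝ) * alpha - 2) * upperGamma (2 - (n : ℝ) * alpha) (η * χ))

/-- The `n`-th term of the series for non-line-of-sight interference (`w = s P`). -/
def nlosTerm (w alpha η χ : ℝ) (n : ℕ) : ℝ :=
  (-w) ^ n * (χ ^ (2 - (n : ℝ) * alpha) / ((n : ℝ) * alpha - 2)
    - η ^ ((n : ℝ) * alpha - 2) * upperGamma (2 - (n : ℝ) * alpha) (η * χ))

end MAN

end

/-! ### The exponential `e^(-a)` on `[0, ∞]`. -/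

noncomputable section

namespace MAN

open Filter Topology

/-! Fix a candidate for the main link and charge every other transmitter `s` times its interference,
or `∞` if its metric is at least that of the candidate. Since `e^(-∞) = 0`, the exponential of minus
the total charge is the indicator that the candidate is associated, times `e^(-sI)`. So for a test
function `ψ` of the main link, `E[ψ e^(-sI)]` is a sum over all candidates
(`mainLink_mul_expNeg_eq_tsum`). Averaging over the marks, then applying Mecke's formula to the
candidate and the Laplace functional to the remaining Poisson points, gives an integral over the
candidate's position with the factor `exp(-∑ k, λ_k ∫ (1 - E e^(-charge)))`
(`lintegral_mainLink_mul_expNeg`).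

The decisive observation is that `1 - E e^(-charge)` at `s` equals its value at `s = 0` plus a loss
that vanishes in the exclusion region, and that only the receiver's layer is affected
(`sum_lintegral_one_sub_expNeg_avgCost`). The factor at `s` is therefore the factor at `0` times
`e^(-D)`, where `D` depends on the main link through its metric alone. Reading the formula backwards
at `s = 0`, with `ψ e^(-D)` in place of `ψ`, yields `E[ψ e^(-sI)] = E[ψ e^(-D)]`; the law of the
main link is never computed. As `ψ` is arbitrary, the conditional Laplace transform is `e^(-D)`
(`lintegral_condDistrib_eq`), first for countably many `s` and then for all by continuity
(`ae_condLaplace_eq`).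

In polar coordinates `D = 2πλ ∫_χ^∞ r q(r) (1 - 1/(1 + sP r^(-α))) dr`, with `q` the probability of
the environment at distance `r` (`lintegral_avgLoss`). If `sP χ^(-α) < 1`, the geometric series can
be integrated term by term (`hasSum_moments`), and the moments of `e^(-ηr)` on `(χ, ∞)` are
incomplete gamma functions.

Almost sure convergence is separate: finitely many transmitters are near, and the far ones have
finite mean interference by Campbell's formula (`ae_summable_interferenceTerm`). -/

/-- The function `e^(-a)` on `[0, ∞]`, with `e^(-∞) = 0`. -/
def expNeg (a : ℝ≥0∞) : ℝ≥0∞ := EReal.exp (-(a : EReal))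

/-- The inverse of `expNeg` on `[0, 1]`. -/
def negLog (b : ℝ≥0∞) : ℝ≥0∞ := (-(ENNReal.log b)).toENNReal

@[simp] theorem expNeg_zero : expNeg 0 = 1 := by simp [expNeg]

@[simp] theorem expNeg_top : expNeg ∞ = 0 := by simp [expNeg]

theorem expNeg_add (a b : ℝ≥0∞) : expNeg (a + b) = expNeg a * expNeg b := by
  unfold expNeg
  rw [← EReal.exp_add, EReal.coe_ennreal_add, EReal.neg_add (by simp) (by simp), sub_eq_add_neg]

theorem continuous_expNeg : Continuous expNeg :=
  ENNReal.continuous_exp.comp (continuous_neg.comp continuous_coe_ennreal_ereal)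

@[fun_prop]
theorem measurable_expNeg : Measurable expNeg := continuous_expNeg.measurable

@[fun_prop]
theorem measurable_negLog : Measurable negLog := by
  unfold negLog
  fun_prop

theorem expNeg_antitone : Antitone expNeg := fun a b h => by
  unfold expNeg
  simpa using h

theorem expNeg_le_one (a : ℝ≥0∞) : expNeg a ≤ 1 := by
  simpa using expNeg_antitone (zero_le (a := a))

theorem expNeg_ne_top (a : ℝ≥0∞) : expNeg a ≠ ∞ := ((expNeg_le_one a).trans_lt (by simp)).ne

/-- For `b ≤ 1` the logarithm is nonpositive, so the truncation in `toENNReal` loses nothing. This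
turns products of numbers in `[0, 1]`, infinite ones included, into sums in `[0, ∞]`. -/
theorem expNeg_negLog {b : ℝ≥0∞} (hb : b ≤ 1) : expNeg (negLog b) = b := by
  unfold expNeg negLog
  rw [EReal.coe_toENNReal (by simpa using hb), neg_neg, ENNReal.exp_log]

theorem expNeg_ofReal {x : ℝ} (hx : 0 ≤ x) :
    expNeg (ENNReal.ofReal x) = ENNReal.ofReal (Real.exp (-x)) := by
  unfold expNeg
  rw [EReal.coe_ennreal_ofReal, max_eq_left hx, ← EReal.coe_neg, EReal.exp_coe]

theorem expNeg_finsetSum {ι : Type*} (T : Finset ι) (f : ι → ℝ≥0∞) :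
    expNeg (∑ i ∈ T, f i) = ∏ i ∈ T, expNeg (f i) := by
  classical
  induction T using Finset.induction_on with
  | empty => simp
  | insert a T ha ih => rw [Finset.sum_insert ha, Finset.prod_insert ha, expNeg_add, ih]

theorem expNeg_natCast_mul (n : ℕ) (c : ℝ≥0∞) : expNeg (n * c) = expNeg c ^ n := by
  have := expNeg_finsetSum (Finset.range n) fun _ => c
  simpa using this

theorem tendsto_expNeg_finsetSum {ι : Type*} (f : ι → ℝ≥0∞) :
    Tendsto (fun T : Finset ι => expNeg (∑ i ∈ T, f i)) atTop (𝓝 (expNeg (∑' i, f i))) :=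
  (continuous_expNeg.tendsto _).comp ENNReal.summable.hasSum

set_option linter.unusedSectionVars false

/-! ### Poisson processes as random counting measures; the Laplace functional. -/

section PointProcess

variable {Ω E : Type*} [MeasurableSpace Ω] [MeasurableSpace E] {μ : Measure Ω} {Lam : Measure E}
  {N : Ω → ℕ∞} {X : ℕ → Ω → E}

open Classical in
/-- The counting measure of the point process with points `X 0, …, X (N - 1)`. -/
def config (N : Ω → ℕ∞) (X : ℕ → Ω → E) (ω : Ω) : Measure E :=
  Measure.sum fun n : ℕ => if (n : ℕ∞) < N ω then Measure.dirac (X n ω) else 0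

open Classical in
/-- The counting measure of the point process with the point of number `n` removed. -/
def configErase (N : Ω → ℕ∞) (X : ℕ → Ω → E) (n : ℕ) (ω : Ω) : Measure E :=
  Measure.sum fun m : ℕ => if (m : ℕ∞) < N ω ∧ m ≠ n then Measure.dirac (X m ω) else 0

open Classical in
theorem lintegral_config {f : E → ℝ≥0∞} (hf : Measurable f) (ω : Ω) :
    ∫⁻ x, f x ∂(config N X ω) = ∑' n : ℕ, if (n : ℕ∞) < N ω then f (X n ω) else 0 := by
  rw [config, lintegral_sum_measure]
  refine tsum_congr fun n => ?_
  split_ifs <;> simp [lintegral_dirac' _ hf]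

open Classical in
theorem lintegral_configErase {f : E → ℝ≥0∞} (hf : Measurable f) (n : ℕ) (ω : Ω) :
    ∫⁻ x, f x ∂(configErase N X n ω) =
      ∑' m : ℕ, if (m : ℕ∞) < N ω ∧ m ≠ n then f (X m ω) else 0 := by
  rw [configErase, lintegral_sum_measure]
  refine tsum_congr fun n => ?_
  split_ifs <;> simp [lintegral_dirac' _ hf]

theorem config_apply {A : Set E} (hA : MeasurableSet A) (ω : Ω) :
    config N X ω A = (pointCount N X A ω : ℝ≥0∞) := by
  classical
  rw [← lintegral_indicator_one hA, lintegral_config (measurable_one.indicator hA), pointCount,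
    ← ENNReal.tsum_set_one, tsum_subtype {n : ℕ | (n : ℕ∞) < N ω ∧ X n ω ∈ A} fun _ => (1 : ℝ≥0∞)]
  refine tsum_congr fun n => ?_
  by_cases h1 : (n : ℕ∞) < N ω <;> by_cases h2 : X n ω ∈ A <;> simp [h1, h2]

/-- A point is removed by its index and not by its position, so another point at the same place
survives; the identity needs no simplicity of the process. -/
theorem config_eq_configErase_add {n : ℕ} {ω : Ω} (h : (n : ℕ∞) < N ω) :
    config N X ω = configErase N X n ω + Measure.dirac (X n ω) := by
  classical
  ext A hA
  have hm : Measurable (A.indicator (1 : E → ℝ≥0∞)) := measurable_one.indicator hA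
  rw [Measure.add_apply, ← lintegral_indicator_one hA, ← lintegral_indicator_one hA,
    ← lintegral_indicator_one hA, lintegral_config hm, lintegral_configErase hm,
    lintegral_dirac' _ hm, ENNReal.tsum_eq_add_tsum_ite n, if_pos h, add_comm]
  congr 1
  refine tsum_congr fun m => ?_
  by_cases h1 : (m : ℕ∞) < N ω <;> by_cases h2 : m = n <;> simp [h1, h2]

theorem measurableSet_lt_num (hN : Measurable N) (n : ℕ) : MeasurableSet {ω | (n : ℕ∞) < N ω} :=
  hN (MeasurableSet.of_discrete (s := Set.Ioi (n : ℕ∞)))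

theorem measurable_config (hN : Measurable N) (hX : ∀ n, Measurable (X n)) :
    Measurable (config N X) := by
  classical
  refine Measure.measurable_of_measurable_coe _ fun A hA => ?_
  have hm : Measurable (A.indicator (1 : E → ℝ≥0∞)) := measurable_one.indicator hA
  simp_rw [← lintegral_indicator_one hA, lintegral_config hm]
  exact Measurable.tsum fun n =>
    Measurable.ite (measurableSet_lt_num hN n) (hm.comp (hX n)) measurable_const

theorem measurable_configErase (hN : Measurable N) (hX : ∀ n, Measurable (X n)) (n : ℕ) :
    Measurable (configErase N X n) := by
  classical
  refine Measure.measurable_of_measurable_coe _ fun A hA => ?_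
  have hm : Measurable (A.indicator (1 : E → ℝ≥0∞)) := measurable_one.indicator hA
  simp_rw [← lintegral_indicator_one hA, lintegral_configErase hm]
  exact Measurable.tsum fun m =>
    Measurable.ite ((measurableSet_lt_num hN m).inter (MeasurableSet.const _))
      (hm.comp (hX m)) measurable_const

namespace IsPoissonPointProcess

variable (h : IsPoissonPointProcess μ Lam N X)
include h

theorem measurable_config : Measurable (config N X) :=
  MAN.measurable_config h.measurable_num h.measurable_point

theorem measurable_config_apply {A : Set E} (hA : MeasurableSet A) :
    Measurable fun ω => config N X ω A :=
  (Measure.measurable_coe hA).comp h.measurable_config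

theorem measurable_pointCount {A : Set E} (hA : MeasurableSet A) :
    Measurable (pointCount N X A) := by
  refine measurable_to_countable' fun k => ?_
  have : pointCount N X A ⁻¹' {k} = (fun ω => config N X ω A) ⁻¹' {(k : ℝ≥0∞)} := by
    ext ω
    simp [config_apply hA]
  rw [this]
  exact h.measurable_config_apply hA (measurableSet_singleton _)

/-- A function of the number of points in a set of finite intensity has the expectation given by
the Poisson distribution. -/
theorem lintegral_config_apply {A : Set E} (hA : MeasurableSet A) (hLam : Lam A ≠ ∞)
    (f : ℝ≥0∞ → ℝ≥0∞) :
    ∫⁻ ω, f (config N X ω A) ∂μ =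
      ∑' n : ℕ, f n * ENNReal.ofReal (Real.exp (-(Lam A).toReal) * (Lam A).toReal ^ n /
        n.factorial) := by
  have h1 : ∫⁻ ω, f (config N X ω A) ∂μ = ∫⁻ k : ℕ∞, f k ∂(μ.map (pointCount N X A)) := by
    rw [lintegral_map Measurable.of_discrete (h.measurable_pointCount hA)]
    simp_rw [config_apply hA]
  rw [h1, h.count_law A hA hLam, lintegral_map Measurable.of_discrete Measurable.of_discrete,
    lintegral_countable']
  simp_rw [poissonMeasure_singleton]
  rfl

/-- The Poisson distribution puts no mass outside the natural numbers. -/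
theorem ae_config_ne_top {A : Set E} (hA : MeasurableSet A) (hLam : Lam A ≠ ∞) :
    ∀ᵐ ω ∂μ, ∃ n : ℕ, config N X ω A = n := by
  have h2 : Measurable (Set.indicator (Set.range fun n : ℕ => (n : ℝ≥0∞))ᶜ
      (1 : ℝ≥0∞ → ℝ≥0∞)) :=
    measurable_one.indicator (Set.countable_range _).measurableSet.compl
  have h1 := h.lintegral_config_apply hA hLam (Set.indicator (Set.range fun n : ℕ => (n : ℝ≥0∞))ᶜ 1)
  have h3 : ∑' n : ℕ, Set.indicator (Set.range fun n : ℕ => (n : ℝ≥0∞))ᶜ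
      (1 : ℝ≥0∞ → ℝ≥0∞) n * ENNReal.ofReal (Real.exp (-(Lam A).toReal) * (Lam A).toReal ^ n /
        n.factorial) = 0 := by
    simp
  have h4 : Measurable fun ω => Set.indicator (Set.range fun n : ℕ => (n : ℝ≥0∞))ᶜ
      (1 : ℝ≥0∞ → ℝ≥0∞) (config N X ω A) := h2.comp (h.measurable_config_apply hA)
  rw [h3, lintegral_eq_zero_iff h4] at h1
  filter_upwards [h1] with ω hω
  by_contra hc
  push Not at hc
  have : config N X ω A ∈ (Set.range fun n : ℕ => (n : ℝ≥0∞))ᶜ := by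
    rintro ⟨n, hn⟩
    exact hc n hn.symm
  simp [this] at hω

theorem measure_config_apply_eq {A : Set E} (hA : MeasurableSet A) (hLam : Lam A ≠ ∞) (n : ℕ) :
    μ {ω | config N X ω A = n} =
      ENNReal.ofReal (Real.exp (-(Lam A).toReal) * (Lam A).toReal ^ n / n.factorial) := by
  have h1 := h.lintegral_config_apply hA hLam (Set.indicator {(n : ℝ≥0∞)} 1)
  rw [tsum_eq_single n (fun m hm => by simp [hm])] at h1
  simp only [Set.mem_singleton_iff, Set.indicator_of_mem, Pi.one_apply, one_mul] at h1
  rw [← h1, ← lintegral_indicator_one]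
  · rfl
  · exact h.measurable_config_apply hA (measurableSet_singleton _)

theorem iIndepFun_config_apply {I : Type*} [Finite I] {Q : I → Set E}
    (hQ : ∀ l, MeasurableSet (Q l)) (hd : Pairwise fun l l' => Disjoint (Q l) (Q l')) :
    iIndepFun (fun l ω => config N X ω (Q l)) μ := by
  obtain ⟨n, ⟨e⟩⟩ := Finite.exists_equiv_fin I
  have h1 := h.count_indep n (fun l => Q (e.symm l)) (fun l => hQ _)
    (fun l l' hl => hd (e.symm.injective.ne hl))
  have h2 := (h1.comp (fun _ k => (k : ℝ≥0∞)) fun _ => Measurable.of_discrete).precomp e.injective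
  convert h2 using 3 with l ω
  simp [config_apply (hQ l)]

/-- This is the generating function `∑ g^n e^(-l) l^n / n! = e^(-(1 - g) l)` of the Poisson
distribution at `g = e^(-c)`, and the Laplace functional for a multiple of an indicator. -/
theorem lintegral_expNeg_mul_config_apply {A : Set E} (hA : MeasurableSet A) (hLam : Lam A ≠ ∞)
    (c : ℝ≥0∞) :
    ∫⁻ ω, expNeg (c * config N X ω A) ∂μ = expNeg ((1 - expNeg c) * Lam A) := by
  rw [h.lintegral_config_apply hA hLam (fun x => expNeg (c * x))]
  obtain ⟨g, hg⟩ : ∃ g : ℝ, g = (expNeg c).toReal := ⟨_, rfl⟩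
  have hg0 : 0 ≤ g := hg ▸ ENNReal.toReal_nonneg
  have hg1 : g ≤ 1 := hg ▸ ENNReal.toReal_le_of_le_ofReal (by simp) (by simpa using expNeg_le_one c)
  have hgc : expNeg c = ENNReal.ofReal g := by rw [hg, ENNReal.ofReal_toReal (expNeg_ne_top c)]
  have hL : Lam A = ENNReal.ofReal (Lam A).toReal := by rw [ENNReal.ofReal_toReal hLam]
  set l := (Lam A).toReal with hl
  have hl0 : 0 ≤ l := ENNReal.toReal_nonneg
  have hs : HasSum (fun n : ℕ => g ^ n * (Real.exp (-l) * l ^ n / n.factorial))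
      (Real.exp (-((1 - g) * l))) := by
    have this := (NormedSpace.expSeries_div_hasSum_exp (g * l)).mul_left (Real.exp (-l))
    rw [← Real.exp_eq_exp_ℝ, ← Real.exp_add] at this
    have e1 : -((1 - g) * l) = -l + g * l := by ring
    have e2 : (fun n : ℕ => g ^ n * (Real.exp (-l) * l ^ n / n.factorial)) =
        fun n : ℕ => Real.exp (-l) * ((g * l) ^ n / n.factorial) := by
      funext n
      rw [mul_pow]
      ring
    rwa [e1, e2]
  rw [hgc, hL, ← ENNReal.ofReal_one, ← ENNReal.ofReal_sub _ hg0, ← ENNReal.ofReal_mul (by linarith),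
    expNeg_ofReal (mul_nonneg (by linarith) hl0), ← hs.tsum_eq,
    ENNReal.ofReal_tsum_of_nonneg (fun n => by positivity) hs.summable]
  refine tsum_congr fun n => ?_
  rw [mul_comm c, expNeg_natCast_mul, hgc, ENNReal.ofReal_mul (by positivity),
    ENNReal.ofReal_pow hg0]

/-- The Laplace functional of a Poisson point process, for simple functions supported in a set of
finite intensity. -/
theorem lintegral_expNeg_simpleFunc [IsProbabilityMeasure μ] (f : SimpleFunc E ℝ≥0∞)
    (hf : ∀ c, c ≠ 0 → Lam (f ⁻¹' {c}) ≠ ∞) :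
    ∫⁻ ω, expNeg (∫⁻ x, f x ∂(config N X ω)) ∂μ = expNeg (∫⁻ x, (1 - expNeg (f x)) ∂Lam) := by
  have h0 : ∀ (ν : Measure E) (g : ℝ≥0∞ → ℝ≥0∞), ∫⁻ x, g (f x) ∂ν =
      ∑ c : f.range, g c * ν (f ⁻¹' {(c : ℝ≥0∞)}) := by
    intro ν g
    rw [Finset.sum_coe_sort f.range fun c => g c * ν (f ⁻¹' {c}), ← SimpleFunc.map_lintegral,
      ← SimpleFunc.lintegral_eq_lintegral]
    rfl
  simp_rw [h0 _ fun c => c, expNeg_finsetSum]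
  rw [h0 Lam fun c => 1 - expNeg c, expNeg_finsetSum]
  have hmeas : ∀ c, MeasurableSet (f ⁻¹' {c}) := fun c => f.measurableSet_preimage _
  -- Distinct level sets are disjoint, so their counts are independent and the expectation factors
  -- over the values of `f`.
  have hind := h.iIndepFun_config_apply (I := f.range) (Q := fun c => f ⁻¹' {(c : ℝ≥0∞)})
    (fun c => hmeas _) (fun c c' hcc => by
      refine Disjoint.preimage _ ?_
      exact Set.disjoint_singleton.2 fun hc => hcc (Subtype.ext hc))
  have hind2 := hind.comp (fun c x => expNeg (c * x)) (fun c => by fun_prop)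
  rw [lintegral_prod_eq_prod_lintegral_of_indepFun Finset.univ
    (fun (c : f.range) ω => expNeg (c * config N X ω (f ⁻¹' {(c : ℝ≥0∞)}))) hind2
    (fun c => measurable_expNeg.comp ((h.measurable_config_apply (hmeas c)).const_mul _))]
  refine Finset.prod_congr rfl fun c _ => ?_
  -- The level set of `0` may have infinite intensity, but it contributes the factor `1` on both
  -- sides.
  by_cases hc : (c : ℝ≥0∞) = 0
  · simp [hc]
  · exact h.lintegral_expNeg_mul_config_apply (hmeas c) (hf _ hc) _

/-- The Laplace functional of a Poisson point process. -/
theorem lintegral_expNeg [IsProbabilityMeasure μ] [SigmaFinite Lam] {f : E → ℝ≥0∞}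
    (hf : Measurable f) :
    ∫⁻ ω, expNeg (∫⁻ x, f x ∂(config N X ω)) ∂μ = expNeg (∫⁻ x, (1 - expNeg (f x)) ∂Lam) := by
  set S := spanningSets Lam
  have hS : ∀ n, MeasurableSet (S n) := measurableSet_spanningSets Lam
  -- The restriction to a spanning set gives every nonzero level set finite intensity, while the
  -- approximation stays monotone.
  set F : ℕ → SimpleFunc E ℝ≥0∞ := fun n => (SimpleFunc.eapprox f n).restrict (S n)
  have hF : ∀ n x, F n x = (S n).indicator (SimpleFunc.eapprox f n) x := fun n x => by
    simp [F, SimpleFunc.restrict_apply, hS]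
  have hmono : ∀ x, Monotone fun n => F n x := by
    intro x m n hmn
    simp only [hF]
    refine (Set.indicator_le_indicator_of_subset (monotone_spanningSets Lam hmn)
      (fun _ => zero_le) x).trans (Set.indicator_le_indicator ?_)
    exact SimpleFunc.monotone_eapprox f hmn x
  have hlim : ∀ x, Tendsto (fun n => F n x) atTop (𝓝 (f x)) := by
    intro x
    have h1 : Tendsto (fun n => SimpleFunc.eapprox f n x) atTop (𝓝 (f x)) := by
      rw [← SimpleFunc.iSup_eapprox_apply hf x]
      exact tendsto_atTop_iSup fun m n hmn => SimpleFunc.monotone_eapprox f hmn x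
    refine h1.congr' ?_
    filter_upwards [eventually_ge_atTop (spanningSetsIndex Lam x)] with n hn
    rw [hF, Set.indicator_of_mem (mem_spanningSets_of_index_le Lam x hn)]
  have hfin : ∀ n c, c ≠ 0 → Lam (F n ⁻¹' {c}) ≠ ∞ := by
    intro n c hc
    refine ((measure_mono ?_).trans_lt (measure_spanningSets_lt_top Lam n)).ne
    intro x hx
    by_contra hxS
    rw [Set.mem_preimage, Set.mem_singleton_iff, hF, Set.indicator_of_notMem hxS] at hx
    exact hc hx.symm
  have hL : Tendsto (fun n => ∫⁻ ω, expNeg (∫⁻ x, F n x ∂(config N X ω)) ∂μ) atTop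
      (𝓝 (∫⁻ ω, expNeg (∫⁻ x, f x ∂(config N X ω)) ∂μ)) := by
    refine tendsto_lintegral_of_dominated_convergence (fun _ => 1) (fun n => ?_)
      (fun n => ae_of_all _ fun ω => expNeg_le_one _) (by simp) (ae_of_all _ fun ω => ?_)
    · exact measurable_expNeg.comp
        ((Measure.measurable_lintegral (F n).measurable).comp h.measurable_config)
    · exact (continuous_expNeg.tendsto _).comp (lintegral_tendsto_of_tendsto_of_monotone
        (fun n => (F n).measurable.aemeasurable) (ae_of_all _ hmono) (ae_of_all _ hlim))
  refine tendsto_nhds_unique hL ?_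
  simp_rw [fun n => h.lintegral_expNeg_simpleFunc (F n) (hfin n)]
  refine (continuous_expNeg.tendsto _).comp (lintegral_tendsto_of_tendsto_of_monotone
    (fun n => ?_) (ae_of_all _ fun x m n hmn => ?_) (ae_of_all _ fun x => ?_))
  · exact (measurable_const.sub (measurable_expNeg.comp (F n).measurable)).aemeasurable
  · exact tsub_le_tsub_left (expNeg_antitone (hmono x hmn)) 1
  · exact ENNReal.Tendsto.sub tendsto_const_nhds
      ((continuous_expNeg.tendsto _).comp (hlim x)) (Or.inl (by simp))

end IsPoissonPointProcess

end PointProcess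

/-! ### Mecke's formula. -/

section Mecke

variable {Ω E : Type*} [MeasurableSpace Ω] [MeasurableSpace E] {μ : Measure Ω} {Lam : Measure E}
  {N : Ω → ℕ∞} {X : ℕ → Ω → E}

/-- The weight `e^(-l) l^n / n!` of the Poisson distribution. -/
def poissonWeight (l : ℝ) (n : ℕ) : ℝ≥0∞ :=
  ENNReal.ofReal (Real.exp (-l) * l ^ n / n.factorial)

/-- Because `(n + 1)! = (n + 1) n!`. This recursion is Mecke's formula for a single cell; the
general formula is reduced to it. -/
theorem succ_mul_poissonWeight {l : ℝ} (hl : 0 ≤ l) (n : ℕ) :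
    ((n : ℝ≥0∞) + 1) * poissonWeight l (n + 1) = ENNReal.ofReal l * poissonWeight l n := by
  unfold poissonWeight
  have h1 : (n : ℝ≥0∞) + 1 = ENNReal.ofReal ((n : ℝ) + 1) := by
    rw [ENNReal.ofReal_add (by positivity) zero_le_one]
    simp
  rw [h1, ← ENNReal.ofReal_mul (by positivity), ← ENNReal.ofReal_mul hl]
  congr 1
  rw [Nat.factorial_succ, pow_succ]
  push_cast
  field_simp

open Classical in
/-- Multiplying by a coordinate amounts to shifting it, for a product of Poisson weights. -/
theorem tsum_coord_mul_prod_poissonWeight {I : Type*} [Fintype I] (l : I → ℝ)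
    (hl : ∀ σ, 0 ≤ l σ) (τ : I) (φ : (I → ℝ≥0∞) → ℝ≥0∞) :
    ∑' k : I → ℕ, (k τ * φ (fun σ => k σ - if σ = τ then 1 else 0)) *
        ∏ σ, poissonWeight (l σ) (k σ) =
      ENNReal.ofReal (l τ) * ∑' k : I → ℕ, φ (fun σ => k σ) * ∏ σ, poissonWeight (l σ) (k σ) := by
  set g : (I → ℕ) → (I → ℕ) := fun k σ => k σ + if σ = τ then 1 else 0 with hg
  have hinj : Function.Injective g := by
    intro k k' hk
    funext σ
    have := congrFun hk σ
    simpa [hg] using this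
  rw [← hinj.tsum_eq, ← ENNReal.tsum_mul_left]
  · refine tsum_congr fun k => ?_
    have h1 : ∀ σ, ((g k σ : ℕ) : ℝ≥0∞) - (if σ = τ then 1 else 0) = k σ := by
      intro σ
      by_cases hσ : σ = τ <;> simp [hg, hσ]
    have h2 : ∏ σ ∈ Finset.univ.erase τ, poissonWeight (l σ) (g k σ) =
        ∏ σ ∈ Finset.univ.erase τ, poissonWeight (l σ) (k σ) :=
      Finset.prod_congr rfl fun σ hσ => by simp [hg, Finset.ne_of_mem_erase hσ]
    simp only [h1]
    rw [← Finset.mul_prod_erase _ _ (Finset.mem_univ τ), h2,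
      ← Finset.mul_prod_erase Finset.univ (fun σ => poissonWeight (l σ) (k σ)) (Finset.mem_univ τ)]
    have h3 := succ_mul_poissonWeight (hl τ) (k τ)
    have h4 : g k τ = k τ + 1 := by simp [hg]
    rw [h4]
    push_cast
    calc _ = (((k τ : ℝ≥0∞) + 1) * poissonWeight (l τ) (k τ + 1)) * φ (fun σ => (k σ : ℝ≥0∞)) *
          ∏ σ ∈ Finset.univ.erase τ, poissonWeight (l σ) (k σ) := by ring
      _ = _ := by rw [h3]; ring
  -- Vectors that are not shifts have `k τ = 0`, and the factor `k τ` removes them from the sum.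
  · intro k hk
    have hkτ : k τ ≠ 0 := by
      intro h0
      simp [h0] at hk
    refine ⟨fun σ => k σ - if σ = τ then 1 else 0, ?_⟩
    funext σ
    by_cases hσ : σ = τ
    · subst hσ
      simp [hg]
      omega
    · simp [hg, hσ]

open Classical in
/-- The identity kernel on measures, made s-finite by discarding the measures that are infinite on
one of the sets `spanningSets Lam n`. -/
def locFiniteKernel (Lam : Measure E) [SigmaFinite Lam] : Kernel (Measure E) E where
  toFun η := if ∀ n, η (spanningSets Lam n) < ∞ then η else 0
  measurable' := by
    refine Measurable.ite ?_ measurable_id measurable_const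
    rw [Set.ofPred_forall]
    exact MeasurableSet.iInter fun n =>
      Measure.measurable_coe (measurableSet_spanningSets Lam n) measurableSet_Iio

open Classical in
theorem locFiniteKernel_apply (Lam : Measure E) [SigmaFinite Lam] {η : Measure E}
    (hη : ∀ n, η (spanningSets Lam n) < ∞) : locFiniteKernel Lam η = η :=
  if_pos hη

/-- Cut `E` into the disjoint pieces `D n` of the spanning sets, and the measures `η` according to
the integer part `r` of `η (D n)`. On the part `(n, r)` the mass is at most `r + 1`, so each part is
a finite kernel, and for given `η` and `n` exactly one `r` contributes. S-finiteness is what makes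
`(x, η) ↦ ∫ v x y dη(y)` jointly measurable in `mecke_expNeg`. -/
instance isSFiniteKernel_locFiniteKernel (Lam : Measure E) [SigmaFinite Lam] :
    IsSFiniteKernel (locFiniteKernel Lam) := by
  classical
  set D : ℕ → Set E := disjointed (spanningSets Lam)
  have hDm : ∀ n, MeasurableSet (D n) := MeasurableSet.disjointed (measurableSet_spanningSets Lam)
  set G : ℕ × ℕ → Set (Measure E) := fun q =>
    {η | locFiniteKernel Lam η (D q.1) ∈ Set.Ico (q.2 : ℝ≥0∞) (q.2 + 1)}
  have hGm : ∀ q, MeasurableSet (G q) := fun q =>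
    (locFiniteKernel Lam).measurable_coe (hDm q.1) measurableSet_Ico
  set κ : ℕ × ℕ → Kernel (Measure E) E := fun q =>
    Kernel.piecewise (hGm q) ((locFiniteKernel Lam).restrict (hDm q.1)) 0
  have hfin : ∀ q, IsFiniteKernel (κ q) := by
    intro q
    refine ⟨q.2 + 1, by simp, fun η => ?_⟩
    simp only [κ, Kernel.piecewise_apply]
    split_ifs with hη
    · rw [Kernel.restrict_apply, Measure.restrict_apply_univ]
      exact hη.2.le
    · simp
  have hsum : Kernel.sum κ = locFiniteKernel Lam := by
    ext η A hA
    rw [Kernel.sum_apply' _ _ hA, ENNReal.tsum_prod (f := fun n r => κ (n, r) η A)]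
    have h1 : ∀ n r, κ (n, r) η A =
        if η ∈ G (n, r) then locFiniteKernel Lam η (A ∩ D n) else 0 := by
      intro n r
      simp only [κ, Kernel.piecewise_apply]
      split_ifs with hη
      · rw [Kernel.restrict_apply, Measure.restrict_apply hA]
      · simp
    have hlt : ∀ n, locFiniteKernel Lam η (D n) ≠ ∞ := by
      intro n
      by_cases hη : ∀ n, η (spanningSets Lam n) < ∞
      · rw [locFiniteKernel_apply Lam hη]
        exact ((measure_mono (disjointed_le _ n)).trans_lt (hη n)).ne
      · have : locFiniteKernel Lam η = 0 := if_neg hη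
        simp [this]
    have h2 : ∀ n, ∑' r, κ (n, r) η A = locFiniteKernel Lam η (A ∩ D n) := by
      intro n
      simp_rw [h1]
      set a := locFiniteKernel Lam η (D n) with ha
      rw [tsum_eq_single ⌊a.toReal⌋₊]
      · rw [if_pos]
        refine ⟨?_, ?_⟩
        · change (⌊a.toReal⌋₊ : ℝ≥0∞) ≤ a
          rw [← ENNReal.ofReal_natCast]
          exact ENNReal.ofReal_le_of_le_toReal (Nat.floor_le ENNReal.toReal_nonneg)
        · have : ((⌊a.toReal⌋₊ : ℝ≥0∞) + 1) = ENNReal.ofReal (⌊a.toReal⌋₊ + 1) := by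
            rw [ENNReal.ofReal_add (by positivity) zero_le_one]
            simp
          change a < (⌊a.toReal⌋₊ : ℝ≥0∞) + 1
          rw [this, ENNReal.lt_ofReal_iff_toReal_lt (hlt n)]
          exact Nat.lt_floor_add_one _
      · intro r hr
        rw [if_neg]
        rintro ⟨hr1, hr2⟩
        refine hr ?_
        simp only [← ha] at hr1 hr2
        symm
        rw [Nat.floor_eq_iff ENNReal.toReal_nonneg]
        refine ⟨?_, ?_⟩
        · have := ENNReal.toReal_mono (hlt n) hr1
          simpa using this
        · have := ENNReal.toReal_strict_mono (by simp) hr2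
          rwa [ENNReal.toReal_add (by simp) (by simp), ENNReal.toReal_natCast,
            ENNReal.toReal_one] at this
    simp_rw [h2]
    rw [← measure_iUnion, ← Set.inter_iUnion, iUnion_disjointed, iUnion_spanningSets,
      Set.inter_univ]
    · exact fun n n' hn => (disjoint_disjointed _ hn).mono Set.inter_subset_right
        Set.inter_subset_right
    · exact fun n => hA.inter (hDm n)
  rw [← hsum]
  exact Kernel.isSFiniteKernel_sum

namespace IsPoissonPointProcess

variable (h : IsPoissonPointProcess μ Lam N X)
include h

/-- Almost surely all counts are natural numbers, so the expectation is a sum over vectors of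
counts, whose probabilities factor because the cells are disjoint. -/
theorem lintegral_config_family {I : Type*} [Fintype I] {Q : I → Set E}
    (hQ : ∀ l, MeasurableSet (Q l)) (hd : Pairwise fun l l' => Disjoint (Q l) (Q l'))
    (hLam : ∀ l, Lam (Q l) ≠ ∞) (φ : (I → ℝ≥0∞) → ℝ≥0∞) :
    ∫⁻ ω, φ (fun σ => config N X ω (Q σ)) ∂μ =
      ∑' k : I → ℕ, φ (fun σ => k σ) * ∏ σ, poissonWeight (Lam (Q σ)).toReal (k σ) := by
  classical
  have hm : ∀ k : I → ℕ, MeasurableSet {ω | ∀ σ, config N X ω (Q σ) = k σ} := by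
    intro k
    rw [Set.ofPred_forall]
    exact MeasurableSet.iInter fun σ =>
      h.measurable_config_apply (hQ σ) (measurableSet_singleton _)
  have h1 : ∀ᵐ ω ∂μ, φ (fun σ => config N X ω (Q σ)) =
      ∑' k : I → ℕ, φ (fun σ => k σ) *
        Set.indicator {ω | ∀ σ, config N X ω (Q σ) = k σ} 1 ω := by
    filter_upwards [ae_all_iff.2 fun σ => h.ae_config_ne_top (hQ σ) (hLam σ)] with ω hω
    choose k hk using hω
    rw [tsum_eq_single k]
    · simp [hk]
    · intro k' hk'
      have : ¬ ∀ σ, config N X ω (Q σ) = k' σ := by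
        intro hc
        refine hk' (funext fun σ => ?_)
        have := (hk σ).symm.trans (hc σ)
        exact_mod_cast this.symm
      simp [this]
  rw [lintegral_congr_ae h1, lintegral_tsum fun k =>
    ((measurable_one.indicator (hm k)).const_mul _).aemeasurable]
  refine tsum_congr fun k => ?_
  rw [lintegral_const_mul _ (measurable_one.indicator (hm k)), lintegral_indicator_one (hm k)]
  congr 1
  have h2 := (h.iIndepFun_config_apply hQ hd).measure_inter_preimage_eq_mul Finset.univ
    (sets := fun σ => {(k σ : ℝ≥0∞)}) fun σ _ => measurableSet_singleton _
  have h3 : {ω | ∀ σ, config N X ω (Q σ) = k σ} =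
      ⋂ σ ∈ Finset.univ, (fun ω => config N X ω (Q σ)) ⁻¹' {(k σ : ℝ≥0∞)} := by
    ext ω
    simp
  rw [h3, h2]
  exact Finset.prod_congr rfl fun σ _ => h.measure_config_apply_eq (hQ σ) (hLam σ) (k σ)

open Classical in
-- Deleting a point of cell `τ` lowers the count of that cell by one and, the cells being disjoint,
-- changes no other. The sum over points is therefore the count of `τ` times `φ` at the lowered
-- counts, to which the Poisson shift `tsum_coord_mul_prod_poissonWeight` applies.
theorem mecke_disjoint {I : Type*} [Fintype I] {Q : I → Set E}
    (hQ : ∀ l, MeasurableSet (Q l)) (hd : Pairwise fun l l' => Disjoint (Q l) (Q l'))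
    (hLam : ∀ l, Lam (Q l) ≠ ∞) (φ : (I → ℝ≥0∞) → ℝ≥0∞) (τ : I) :
    ∫⁻ ω, ∑' n : ℕ, (if (n : ℕ∞) < N ω then Measure.dirac (X n ω) (Q τ) *
        φ (fun σ => configErase N X n ω (Q σ)) else 0) ∂μ =
      Lam (Q τ) * ∫⁻ ω, φ (fun σ => config N X ω (Q σ)) ∂μ := by
  have h1 : ∀ ω, ∑' n : ℕ, (if (n : ℕ∞) < N ω then Measure.dirac (X n ω) (Q τ) *
        φ (fun σ => configErase N X n ω (Q σ)) else 0) =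
      config N X ω (Q τ) * φ (fun σ => config N X ω (Q σ) - if σ = τ then 1 else 0) := by
    intro ω
    rw [← lintegral_indicator_one (hQ τ), lintegral_config (measurable_one.indicator (hQ τ)),
      ← ENNReal.tsum_mul_right]
    refine tsum_congr fun n => ?_
    split_ifs with hn
    · rw [Measure.dirac_apply' _ (hQ τ)]
      by_cases hτ : X n ω ∈ Q τ
      · congr 2
        funext σ
        rw [config_eq_configErase_add hn, Measure.add_apply, Measure.dirac_apply' _ (hQ σ)]
        by_cases hσ : σ = τ
        · subst hσ
          simp [hτ]
        · have : X n ω ∉ Q σ := fun hc => Set.disjoint_left.1 (hd hσ) hc hτ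
          simp [hσ, this]
      · simp [hτ]
    · simp
  simp_rw [h1]
  rw [h.lintegral_config_family hQ hd hLam fun c => c τ * φ fun σ => c σ - if σ = τ then 1 else 0,
    h.lintegral_config_family hQ hd hLam φ,
    tsum_coord_mul_prod_poissonWeight _ (fun σ => ENNReal.toReal_nonneg),
    ENNReal.ofReal_toReal (hLam τ)]

open Classical in
-- Overlapping sets are cut into atoms: for `σ ⊆ t`, the points that lie in exactly the members of
-- `σ`. Only nonempty `σ` are kept; their atoms have finite intensity, being contained in a member
-- of `t`, and every member of `t` is a union of them.
theorem mecke_cylinder (t : Finset (Set E)) (ht : ∀ B ∈ t, MeasurableSet B ∧ Lam B ≠ ∞)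
    (S : Set E → Set ℝ≥0∞) (hS : ∀ B ∈ t, MeasurableSet (S B)) {A : Set E} (hA : A ∈ t) :
    ∫⁻ ω, ∑' n : ℕ, (if (n : ℕ∞) < N ω then Measure.dirac (X n ω) A *
        (if ∀ B ∈ t, configErase N X n ω B ∈ S B then 1 else 0) else 0) ∂μ =
      Lam A * ∫⁻ ω, (if ∀ B ∈ t, config N X ω B ∈ S B then 1 else 0) ∂μ := by
  set I := {σ : Finset (Set E) // σ ∈ t.powerset.erase ∅}
  set Q : I → Set E := fun σ => {x | t.filter (x ∈ ·) = σ.1} with hQdef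
  have hIt : ∀ σ : I, σ.1 ⊆ t := fun σ => Finset.mem_powerset.1 (Finset.mem_of_mem_erase σ.2)
  have hQ : ∀ σ, MeasurableSet (Q σ) := by
    intro σ
    have : Q σ = ⋂ B ∈ t, if B ∈ σ.1 then B else Bᶜ := by
      ext x
      simp only [hQdef, Set.mem_ofPred_eq, Set.mem_iInter, Finset.ext_iff, Finset.mem_filter]
      refine ⟨fun hx B hB => ?_, fun hx B => ?_⟩
      · split_ifs with hBσ
        · exact ((hx B).2 hBσ).2
        · exact fun hc => hBσ ((hx B).1 ⟨hB, hc⟩)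
      · refine ⟨fun hB => ?_, fun hB => ⟨hIt σ hB, ?_⟩⟩
        · by_contra hc
          have := hx B hB.1
          rw [if_neg hc] at this
          exact this hB.2
        · have := hx B (hIt σ hB)
          rwa [if_pos hB] at this
    rw [this]
    refine Finset.measurableSet_biInter _ fun B hB => ?_
    split_ifs
    · exact (ht B hB).1
    · exact (ht B hB).1.compl
  have hd : Pairwise fun l l' => Disjoint (Q l) (Q l') := by
    intro σ σ' hσ
    refine Set.disjoint_left.2 fun x hx hx' => hσ (Subtype.ext ?_)
    exact hx.symm.trans hx'
  have hLam : ∀ σ, Lam (Q σ) ≠ ∞ := by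
    intro σ
    obtain ⟨B, hB⟩ := Finset.nonempty_iff_ne_empty.2 (Finset.ne_of_mem_erase σ.2)
    refine ((measure_mono ?_).trans_lt (ht B (hIt σ hB)).2.lt_top).ne
    intro x hx
    have hx' : t.filter (x ∈ ·) = σ.1 := hx
    rw [← hx'] at hB
    exact (Finset.mem_filter.1 hB).2
  have hsplit : ∀ (ν : Measure E), ∀ B ∈ t, ν B = ∑ σ : I, if B ∈ σ.1 then ν (Q σ) else 0 := by
    intro ν B hB
    rw [← Finset.sum_filter, ← measure_biUnion_finset (fun σ _ σ' _ hσ => hd hσ) fun σ _ => hQ σ]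
    congr 1
    ext x
    simp only [Finset.mem_filter, Finset.mem_univ, true_and, Set.mem_iUnion, exists_prop]
    refine ⟨fun hx => ?_, fun ⟨σ, hσ, hx⟩ => ?_⟩
    · have hBm : B ∈ t.filter (x ∈ ·) := Finset.mem_filter.2 ⟨hB, hx⟩
      exact ⟨⟨t.filter (x ∈ ·), Finset.mem_erase.2 ⟨Finset.ne_empty_of_mem hBm,
        Finset.mem_powerset.2 (Finset.filter_subset _ _)⟩⟩, hBm, rfl⟩
    · have hx' : t.filter (x ∈ ·) = σ.1 := hx
      rw [← hx'] at hσ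
      exact (Finset.mem_filter.1 hσ).2
  set φ : (I → ℝ≥0∞) → ℝ≥0∞ := fun c =>
    if ∀ B ∈ t, (∑ σ : I, if B ∈ σ.1 then c σ else 0) ∈ S B then 1 else 0 with hφ
  have hφν : ∀ ν : Measure E, (if ∀ B ∈ t, ν B ∈ S B then (1 : ℝ≥0∞) else 0) =
      φ fun σ => ν (Q σ) := by
    intro ν
    simp only [hφ]
    congr 1
    refine propext (forall₂_congr fun B hB => ?_)
    rw [hsplit ν B hB]
  have hmeas : ∀ σ, Measurable fun ω => ∑' n : ℕ, (if (n : ℕ∞) < N ω then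
      Measure.dirac (X n ω) (Q σ) * φ (fun σ => configErase N X n ω (Q σ)) else 0) := by
    intro σ
    simp_rw [← hφν]
    refine Measurable.tsum fun n => Measurable.ite (measurableSet_lt_num h.measurable_num n)
      (Measurable.mul ?_ (Measurable.ite ?_ measurable_const measurable_const)) measurable_const
    · exact (Measure.measurable_coe (hQ σ)).comp
        (Measure.measurable_dirac.comp (h.measurable_point n))
    · have : {ω | ∀ B ∈ t, configErase N X n ω B ∈ S B} =
          ⋂ B ∈ t, (fun ω => configErase N X n ω B) ⁻¹' S B := by
        ext ω
        simp
      rw [this]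
      exact Finset.measurableSet_biInter _ fun B hB => ((Measure.measurable_coe (ht B hB).1).comp
        (measurable_configErase h.measurable_num h.measurable_point n)) (hS B hB)
  simp_rw [hφν]
  have h1 : ∀ ω, ∑' n : ℕ, (if (n : ℕ∞) < N ω then Measure.dirac (X n ω) A *
        φ (fun σ => configErase N X n ω (Q σ)) else 0) =
      ∑ σ : I, if A ∈ σ.1 then ∑' n : ℕ, (if (n : ℕ∞) < N ω then Measure.dirac (X n ω) (Q σ) *
        φ (fun σ => configErase N X n ω (Q σ)) else 0) else 0 := by
    intro ω
    rw [← Finset.sum_filter, ← Summable.tsum_finsetSum fun _ _ => ENNReal.summable]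
    refine tsum_congr fun n => ?_
    split_ifs with hn
    · rw [hsplit _ A hA, ← Finset.sum_filter, Finset.sum_mul]
    · simp
  simp_rw [h1, ← Finset.sum_filter]
  rw [lintegral_finsetSum _ fun σ _ => hmeas σ, hsplit Lam A hA, ← Finset.sum_filter,
    Finset.sum_mul]
  exact Finset.sum_congr rfl fun σ _ => h.mecke_disjoint hQ hd hLam φ σ

theorem ae_config_spanningSets_lt_top [SigmaFinite Lam] :
    ∀ᵐ ω ∂μ, ∀ n, config N X ω (spanningSets Lam n) < ∞ := by
  refine ae_all_iff.2 fun n => ?_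
  filter_upwards [h.ae_config_ne_top (measurableSet_spanningSets Lam n)
    (measure_spanningSets_lt_top Lam n).ne] with ω ⟨k, hk⟩
  simp [hk]

open Classical in
/-- **Mecke's formula**, with the reduced Palm process. -/
theorem mecke [IsProbabilityMeasure μ] [SigmaFinite Lam] {f : E × Measure E → ℝ≥0∞}
    (hf : Measurable f) :
    ∫⁻ ω, ∑' n : ℕ, (if (n : ℕ∞) < N ω then f (X n ω, configErase N X n ω) else 0) ∂μ =
      ∫⁻ x, ∫⁻ ω, f (x, config N X ω) ∂μ ∂Lam := by
  have hpair : ∀ n, Measurable fun ω => (X n ω, configErase N X n ω) := fun n =>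
    (h.measurable_point n).prodMk (measurable_configErase h.measurable_num h.measurable_point n)
  have hlt := measurableSet_lt_num h.measurable_num
  -- The reduced Campbell measure of pairs (point, remaining points). Mecke's formula says that it
  -- is the product of `Lam` and the law of the process, so agreement on rectangles over generating
  -- π-systems suffices.
  set ν : Measure (E × Measure E) := Measure.sum fun n : ℕ =>
    (μ.restrict {ω | (n : ℕ∞) < N ω}).map fun ω => (X n ω, configErase N X n ω) with hν
  have hνf : ∀ g : E × Measure E → ℝ≥0∞, Measurable g → ∫⁻ y, g y ∂ν =
      ∫⁻ ω, ∑' n : ℕ, (if (n : ℕ∞) < N ω then g (X n ω, configErase N X n ω) else 0) ∂μ := by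
    intro g hg
    have hgm : ∀ n : ℕ, Measurable fun ω =>
        if (n : ℕ∞) < N ω then g (X n ω, configErase N X n ω) else 0 := fun n =>
      Measurable.ite (hlt n) (hg.comp (hpair n)) measurable_const
    rw [hν, lintegral_sum_measure, lintegral_tsum fun n => (hgm n).aemeasurable]
    refine tsum_congr fun n => ?_
    rw [lintegral_map hg (hpair n), ← lintegral_indicator (hlt n)]
    refine lintegral_congr fun ω => ?_
    by_cases hn : (n : ℕ∞) < N ω <;> simp [hn]
  have : IsProbabilityMeasure (μ.map (config N X)) :=
    Measure.isProbabilityMeasure_map h.measurable_config.aemeasurable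
  set ι := {B : Set E // MeasurableSet B ∧ Lam B ≠ ∞}
  set C : Set (Set E) := {B | MeasurableSet B ∧ Lam B ≠ ∞} with hCdef
  set m : ι → MeasurableSpace (Measure E) := fun B =>
    MeasurableSpace.comap (fun η : Measure E => η B.1) inferInstance with hm
  -- The events determined by finitely many counts on sets of finite intensity.
  set D : Set (Set (Measure E)) := piiUnionInter (fun B => {s | MeasurableSet[m B] s}) Set.univ
    with hD
  have hCgen : MeasurableSpace.generateFrom C = ‹MeasurableSpace E› := by
    refine le_antisymm (MeasurableSpace.generateFrom_le fun B hB => hB.1) fun B hB => ?_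
    have : B = ⋃ n, B ∩ spanningSets Lam n := by
      rw [← Set.inter_iUnion, iUnion_spanningSets, Set.inter_univ]
    rw [this]
    refine MeasurableSet.iUnion fun n => MeasurableSpace.measurableSet_generateFrom ⟨?_, ?_⟩
    · exact hB.inter (measurableSet_spanningSets Lam n)
    · exact ((measure_mono Set.inter_subset_right).trans_lt
        (measure_spanningSets_lt_top Lam n)).ne
  have hCpi : IsPiSystem C := fun B hB B' hB' _ => ⟨hB.1.inter hB'.1,
    ((measure_mono Set.inter_subset_left).trans_lt hB.2.lt_top).ne⟩
  have hDgen : MeasurableSpace.generateFrom D = Measure.instMeasurableSpace := by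
    have hD' := generateFrom_piiUnionInter_measurableSet m Set.univ
    refine hD'.trans (le_antisymm
      (iSup₂_le fun B _ => (Measure.measurable_coe B.2.1).comap_le) ?_)
    refine iSup₂_le fun B hB => Measurable.comap_le ?_
    -- Continuity from below holds for every `η`, so counts on sets of finite intensity already
    -- generate all evaluations.
    have h1 : (fun η : Measure E => η B) = fun η => ⨆ n, η (B ∩ spanningSets Lam n) := by
      funext η
      rw [← Monotone.measure_iUnion, ← Set.inter_iUnion, iUnion_spanningSets, Set.inter_univ]
      exact fun n n' hn => Set.inter_subset_inter_right _ (monotone_spanningSets Lam hn)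
    rw [h1]
    refine Measurable.iSup fun n => ?_
    have h2 : MeasurableSet (B ∩ spanningSets Lam n) ∧ Lam (B ∩ spanningSets Lam n) ≠ ∞ :=
      ⟨hB.inter (measurableSet_spanningSets Lam n), ((measure_mono Set.inter_subset_right).trans_lt
        (measure_spanningSets_lt_top Lam n)).ne⟩
    exact Measurable.mono (comap_measurable _)
      (le_iSup₂_of_le (f := fun b (_ : b ∈ Set.univ) => m b) ⟨_, h2⟩ (Set.mem_univ _) le_rfl) le_rfl
  have hDpi : IsPiSystem D := isPiSystem_piiUnionInter _
    (fun B => @MeasurableSpace.isPiSystem_measurableSet _ (m B)) _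
  have hCspan : Lam.FiniteSpanningSetsIn C :=
    ⟨spanningSets Lam, fun n => ⟨measurableSet_spanningSets Lam n,
      (measure_spanningSets_lt_top Lam n).ne⟩, measure_spanningSets_lt_top Lam,
      iUnion_spanningSets Lam⟩
  have hDspan : (μ.map (config N X)).FiniteSpanningSetsIn D :=
    ⟨fun _ => Set.univ, fun _ => ⟨∅, by simp, fun _ => Set.univ, by simp, by simp⟩,
      fun _ => by simp, Set.iUnion_const _⟩
  have hprod : Lam.prod (μ.map (config N X)) = ν := by
    refine Measure.prod_eq_generateFrom hCgen hDgen hCpi hDpi hCspan hDspan ?_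
    rintro A hA _ ⟨t, -, F, hF, rfl⟩
    have hF' : ∀ b : ι, ∃ S : Set ℝ≥0∞, MeasurableSet S ∧ (b ∈ t → ∀ η, η ∈ F b ↔ η b.1 ∈ S) := by
      intro b
      by_cases hb : b ∈ t
      · obtain ⟨S, hS, hSF⟩ := hF b hb
        exact ⟨S, hS, fun _ η => by rw [← hSF]; rfl⟩
      · exact ⟨Set.univ, MeasurableSet.univ, fun hc => absurd hc hb⟩
    choose S' hS' hSF using hF'
    -- The family used in `mecke_cylinder` must contain `A`; if `t` puts no condition on `A`, the
    -- trivial condition `univ` is used.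
    set S : Set E → Set ℝ≥0∞ := fun B =>
      if hB : B ∈ C then (if (⟨B, hB⟩ : ι) ∈ t then S' ⟨B, hB⟩ else Set.univ) else Set.univ with hSdef
    set t' : Finset (Set E) := insert A (t.image Subtype.val) with ht'
    have hSm : ∀ B, MeasurableSet (S B) := by
      intro B
      simp only [hSdef]
      split_ifs
      · exact hS' _
      all_goals exact MeasurableSet.univ
    have hmem : ∀ η : Measure E, η ∈ (⋂ b ∈ t, F b) ↔ ∀ B ∈ t', η B ∈ S B := by
      intro η
      simp only [Set.mem_iInter]
      refine ⟨fun hη B _ => ?_, fun hη b hb => ?_⟩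
      · simp only [hSdef]
        split_ifs with h1 h2
        · exact (hSF _ h2 η).1 (hη _ h2)
        all_goals exact Set.mem_univ _
      · have := hη b.1 (Finset.mem_insert_of_mem (Finset.mem_image_of_mem _ hb))
        simp only [hSdef] at this
        rw [dif_pos (show b.1 ∈ C from b.2), if_pos hb] at this
        exact (hSF b hb η).2 this
    have hFm : MeasurableSet (⋂ b ∈ t, F b) :=
      Finset.measurableSet_biInter _ fun b hb => (Measure.measurable_coe b.2.1).comap_le _ (hF b hb)
    have key := h.mecke_cylinder t' (fun B hB => by
      rcases Finset.mem_insert.1 hB with rfl | hB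
      · exact hA
      · obtain ⟨b, -, rfl⟩ := Finset.mem_image.1 hB
        exact b.2) S (fun B _ => hSm B) (Finset.mem_insert_self A _)
    simp_rw [← hmem] at key
    rw [← lintegral_indicator_one (hA.1.prod hFm),
      hνf _ (measurable_one.indicator (hA.1.prod hFm))]
    have e1 : μ.map (config N X) (⋂ b ∈ t, F b) =
        ∫⁻ ω, (if config N X ω ∈ (⋂ b ∈ t, F b) then 1 else 0) ∂μ := by
      rw [← lintegral_indicator_one hFm, lintegral_map (measurable_one.indicator hFm)
        h.measurable_config]
      rfl
    rw [e1, ← key]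
    refine lintegral_congr fun ω => tsum_congr fun n => ?_
    split_ifs with hn hn2
    · rw [Measure.dirac_apply' _ hA.1]
      by_cases h1 : X n ω ∈ A
      · rw [Set.indicator_of_mem (show (X n ω, configErase N X n ω) ∈ A ×ˢ _ from ⟨h1, hn2⟩)]
        simp [h1]
      · simp [h1]
    · rw [Set.indicator_of_notMem]
      · simp
      · exact fun hc => hn2 hc.2
    · rfl
  rw [← hνf f hf, ← hprod, lintegral_prod _ hf.aemeasurable]
  refine lintegral_congr fun x => ?_
  exact lintegral_map (hf.comp measurable_prodMk_left) h.measurable_config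

open Classical in
/-- Mecke's formula for exponential functionals. -/
theorem mecke_expNeg [IsProbabilityMeasure μ] [SigmaFinite Lam] {F : E → ℝ≥0∞}
    (hF : Measurable F) {v : E → E → ℝ≥0∞} (hv : Measurable (Function.uncurry v)) :
    ∫⁻ ω, ∑' n : ℕ, (if (n : ℕ∞) < N ω then F (X n ω) * expNeg (∑' m : ℕ,
        if (m : ℕ∞) < N ω ∧ m ≠ n then v (X n ω) (X m ω) else 0) else 0) ∂μ =
      ∫⁻ x, F x * expNeg (∫⁻ y, (1 - expNeg (v x y)) ∂Lam) ∂Lam := by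
  have hvx : ∀ x, Measurable (v x) := fun x => hv.comp measurable_prodMk_left
  -- The kernel replaces `q.2` only to make `f` measurable; almost surely the configuration is
  -- finite on all spanning sets and the kernel leaves it unchanged.
  set f : E × Measure E → ℝ≥0∞ := fun q =>
    F q.1 * expNeg (∫⁻ y, v q.1 y ∂(locFiniteKernel Lam q.2)) with hfdef
  have hf : Measurable f := by
    refine (hF.comp measurable_fst).mul (measurable_expNeg.comp ?_)
    have := Measurable.lintegral_kernel_prod_right'
      (κ := Kernel.comap (locFiniteKernel Lam) (Prod.snd : E × Measure E → Measure E)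
        measurable_snd) (f := fun z : (E × Measure E) × E => v z.1.1 z.2)
      (hv.comp ((measurable_fst.comp measurable_fst).prodMk measurable_snd))
    exact this
  have h1 := h.mecke hf
  have h2 : ∀ᵐ ω ∂μ, ∑' n : ℕ, (if (n : ℕ∞) < N ω then F (X n ω) * expNeg (∑' m : ℕ,
        if (m : ℕ∞) < N ω ∧ m ≠ n then v (X n ω) (X m ω) else 0) else 0) =
      ∑' n : ℕ, (if (n : ℕ∞) < N ω then f (X n ω, configErase N X n ω) else 0) := by
    filter_upwards [h.ae_config_spanningSets_lt_top] with ω hω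
    refine tsum_congr fun n => ?_
    split_ifs with hn
    · simp only [hfdef]
      rw [locFiniteKernel_apply, lintegral_configErase (hvx _)]
      intro k
      refine lt_of_le_of_lt ?_ (hω k)
      rw [config_eq_configErase_add hn]
      exact le_self_add
    · rfl
  have h3 : ∀ x, ∫⁻ ω, f (x, config N X ω) ∂μ =
      F x * expNeg (∫⁻ y, (1 - expNeg (v x y)) ∂Lam) := by
    intro x
    rw [← h.lintegral_expNeg (hvx x), ← lintegral_const_mul]
    · refine lintegral_congr_ae ?_
      filter_upwards [h.ae_config_spanningSets_lt_top] with ω hω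
      simp only [hfdef]
      rw [locFiniteKernel_apply Lam hω]
    · exact measurable_expNeg.comp
        ((Measure.measurable_lintegral (hvx x)).comp h.measurable_config)
  rw [lintegral_congr_ae h2, h1]
  exact lintegral_congr h3

/-- Campbell's formula. -/
theorem lintegral_tsum_points [IsProbabilityMeasure μ] [SigmaFinite Lam] {F : E → ℝ≥0∞}
    (hF : Measurable F) :
    ∫⁻ ω, ∫⁻ x, F x ∂(config N X ω) ∂μ = ∫⁻ x, F x ∂Lam := by
  classical
  have := h.mecke_expNeg hF (v := fun _ _ => 0) measurable_const
  simpa [lintegral_config hF] using this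

end IsPoissonPointProcess

end Mecke

/-! ### Averaging over the marks. -/

theorem lintegral_comp_of_indepFun {Ω α β : Type*} [MeasurableSpace Ω] [MeasurableSpace α]
    [MeasurableSpace β] {μ : Measure Ω} [IsFiniteMeasure μ] {X : Ω → α} {Y : Ω → β}
    (hXY : IndepFun X Y μ) (hX : Measurable X) (hY : Measurable Y) {H : α → β → ℝ≥0∞}
    (hH : Measurable (Function.uncurry H)) :
    ∫⁻ ω, H (X ω) (Y ω) ∂μ = ∫⁻ ω, ∫⁻ ω', H (X ω) (Y ω') ∂μ ∂μ := by
  have h1 := (indepFun_iff_map_prod_eq_prod_map_map hX.aemeasurable hY.aemeasurable).1 hXY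
  have h2 : ∫⁻ ω, H (X ω) (Y ω) ∂μ =
      ∫⁻ q, Function.uncurry H q ∂(μ.map fun ω => (X ω, Y ω)) :=
    (lintegral_map hH (hX.prodMk hY)).symm
  rw [h2, h1, lintegral_prod _ hH.aemeasurable, lintegral_map hH.lintegral_prod_right' hX]
  refine lintegral_congr fun ω => ?_
  exact lintegral_map (hH.comp measurable_prodMk_left) hY

instance : Fintype Channel := ⟨⟨[Channel.L, Channel.N], by simp⟩, by rintro (_ | _) <;> simp⟩

instance : DiscreteMeasurableSpace Channel := ⟨fun _ => trivial⟩

variable {K : ℕ} (p : Params K)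

/-- Average over the marks of a transmitter: a uniform variable and a channel gain. -/
def markMean (co : Channel) (f : ℝ → ℝ → ℝ≥0∞) : ℝ≥0∞ :=
  ∫⁻ u in Set.Icc (0 : ℝ) 1, ∫⁻ g, f u g ∂(gammaMeasure (p.m co) (p.m co))

theorem isProbabilityMeasure_gain (co : Channel) :
    IsProbabilityMeasure (gammaMeasure (p.m co) (p.m co)) :=
  isProbabilityMeasure_gammaMeasure (by linarith [p.one_le_m co]) (by linarith [p.one_le_m co])

@[simp] theorem markMean_const (co : Channel) (c : ℝ≥0∞) : markMean p co (fun _ _ => c) = c := by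
  have := isProbabilityMeasure_gain p co
  simp [markMean]

theorem markMean_mono (co : Channel) {f g : ℝ → ℝ → ℝ≥0∞} (h : ∀ u x, f u x ≤ g u x) :
    markMean p co f ≤ markMean p co g :=
  lintegral_mono fun _ => lintegral_mono fun _ => h _ _

theorem markMean_le_one (co : Channel) {f : ℝ → ℝ → ℝ≥0∞} (h : ∀ u x, f u x ≤ 1) :
    markMean p co f ≤ 1 := by
  simpa using markMean_mono p co h

namespace Network

variable {p} {Ω : Type*} [MeasurableSpace Ω] {μ : Measure Ω} (net : Network p μ)
include net

/-- The uniforms and the gains are independent families, so the gains are averaged with the uniforms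
frozen, then the uniforms; each family factors over the transmitters. -/
theorem lintegral_prod_marks [IsProbabilityMeasure μ] (co : Channel)
    (T : Finset (Fin (K + 1) × ℕ)) (f : Fin (K + 1) × ℕ → ℝ → ℝ → ℝ≥0∞)
    (hf : ∀ w, Measurable (Function.uncurry (f w))) :
    ∫⁻ ω, ∏ w ∈ T, f w (net.unif w ω) (net.gain (co, w) ω) ∂μ = ∏ w ∈ T, markMean p co (f w) := by
  have := isProbabilityMeasure_gain p co
  have hH : Measurable (Function.uncurry fun (u : Fin (K + 1) × ℕ → ℝ)
      (g : Channel × (Fin (K + 1) × ℕ) → ℝ) => ∏ w ∈ T, f w (u w) (g (co, w))) := by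
    refine Finset.measurable_prod _ fun w _ => ?_
    have h0 : Measurable fun q : (Fin (K + 1) × ℕ → ℝ) × (Channel × (Fin (K + 1) × ℕ) → ℝ) =>
        (q.1 w, q.2 (co, w)) := by fun_prop
    exact (hf w).comp h0
  have h1 := lintegral_comp_of_indepFun net.indep_unif_gain
    (measurable_pi_lambda _ fun v => net.unif_measurable v)
    (measurable_pi_lambda _ fun w => net.gain_measurable w) hH
  refine h1.trans ?_
  have hgi : iIndepFun (fun w ω => net.gain (co, w) ω) μ :=
    net.indep_gain.precomp (g := fun w => (co, w)) fun a b hab => (Prod.ext_iff.1 hab).2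
  have h2 : ∀ u : Fin (K + 1) × ℕ → ℝ, ∫⁻ ω', ∏ w ∈ T, f w (u w) (net.gain (co, w) ω') ∂μ =
      ∏ w ∈ T, ∫⁻ g, f w (u w) g ∂(gammaMeasure (p.m co) (p.m co)) := by
    intro u
    have hm : ∀ w, Measurable (f w (u w)) := fun w => (hf w).comp measurable_prodMk_left
    rw [lintegral_prod_eq_prod_lintegral_of_indepFun T
      (fun w ω' => f w (u w) (net.gain (co, w) ω')) (hgi.comp (fun w => f w (u w)) hm)
      fun w => (hm w).comp (net.gain_measurable _)]
    refine Finset.prod_congr rfl fun w _ => ?_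
    rw [← lintegral_map (hm w) (net.gain_measurable _), net.gain_law]
  simp_rw [h2]
  have hm : ∀ w, Measurable fun u => ∫⁻ g, f w u g ∂(gammaMeasure (p.m co) (p.m co)) :=
    fun w => (hf w).lintegral_prod_right'
  rw [lintegral_prod_eq_prod_lintegral_of_indepFun T
    (fun w ω => ∫⁻ g, f w (net.unif w ω) g ∂(gammaMeasure (p.m co) (p.m co)))
    (net.indep_unif.comp _ hm) fun w => (hm w).comp (net.unif_measurable _)]
  refine Finset.prod_congr rfl fun w _ => ?_
  rw [← lintegral_map (hm w) (net.unif_measurable _), net.unif_law]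
  rfl

/-- The average over the marks of an exponential functional of all marks. -/
theorem lintegral_expNeg_marks [IsProbabilityMeasure μ] (co : Channel)
    (C : Fin (K + 1) × ℕ → ℝ → ℝ → ℝ≥0∞) (hC : ∀ w, Measurable (Function.uncurry (C w))) :
    ∫⁻ ω, expNeg (∑' w, C w (net.unif w ω) (net.gain (co, w) ω)) ∂μ =
      expNeg (∑' w, negLog (markMean p co fun u g => expNeg (C w u g))) := by
  have h1 : Tendsto (fun T : Finset (Fin (K + 1) × ℕ) =>
      ∫⁻ ω, expNeg (∑ w ∈ T, C w (net.unif w ω) (net.gain (co, w) ω)) ∂μ) atTop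
      (𝓝 (∫⁻ ω, expNeg (∑' w, C w (net.unif w ω) (net.gain (co, w) ω)) ∂μ)) := by
    refine tendsto_lintegral_filter_of_dominated_convergence (fun _ => 1)
      (Eventually.of_forall fun T => ?_)
      (Eventually.of_forall fun T => ae_of_all _ fun ω => expNeg_le_one _) (by simp)
      (ae_of_all _ fun ω => tendsto_expNeg_finsetSum _)
    refine measurable_expNeg.comp (Finset.measurable_sum _ fun w _ => ?_)
    exact (hC w).comp ((net.unif_measurable w).prodMk (net.gain_measurable _))
  refine tendsto_nhds_unique h1 ?_
  convert tendsto_expNeg_finsetSum _ using 2 with T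
  simp_rw [expNeg_finsetSum]
  rw [net.lintegral_prod_marks co T (fun w u g => expNeg (C w u g))
    fun w => measurable_expNeg.comp (hC w)]
  exact Finset.prod_congr rfl fun w _ =>
    (expNeg_negLog (markMean_le_one p co fun _ _ => expNeg_le_one _)).symm

end Network

/-! ### The charge of a transmitter as a function of position and marks. -/

section Cost

variable {K : ℕ} (p : Params K)

/-- Length of the link from a `k`-layer transmitter at `z` to an `i`-layer receiver. -/
def siteDist (i k : Fin (K + 1)) (z : Plane) : ℝ := Real.sqrt (‖z‖ ^ 2 + (p.h i - p.h k) ^ 2)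

open Classical in
/-- Environment of the link from a `k`-layer transmitter at `z` to an `i`-layer receiver, as a
function of the uniform mark. -/
def siteChannel (i k : Fin (K + 1)) (z : Plane) (u : ℝ) : Channel :=
  if u ≤ p.rho i k (siteDist p i k z) then Channel.L else Channel.N

/-- The association metric of a link. -/
def linkMetric (a : Criterion) (e : Fin (K + 1) × Channel × ℝ) : ℝ :=
  match a with
  | Criterion.nearest => p.B e.1 * e.2.2⁻¹
  | Criterion.strongest => p.B e.1 * e.2.2 ^ (-p.alpha e.2.1)

open Classical in
/-- Exponent contributed by a `k`-layer transmitter at `z` with marks `u`, `g`, when the main link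
has metric `t`: infinite if the transmitter would be preferred to the main link, `s` times its
interference otherwise. -/
def cost (a : Criterion) (i : Fin (K + 1)) (co : Channel) (s t : ℝ) (k : Fin (K + 1)) (z : Plane)
    (u g : ℝ) : ℝ≥0∞ :=
  if linkMetric p a (k, siteChannel p i k z u, siteDist p i k z) < t then
    (if k = i ∧ siteChannel p i k z u = co then
      ENNReal.ofReal (s * (p.P i * g * siteDist p i k z ^ (-p.alpha co))) else 0)
  else ∞

/-- The exponent equivalent to the mark average of `expNeg` of `cost`. -/
def avgCost (a : Criterion) (i : Fin (K + 1)) (co : Channel) (s t : ℝ) (k : Fin (K + 1))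
    (z : Plane) : ℝ≥0∞ :=
  negLog (markMean p co fun u g => expNeg (cost p a i co s t k z u g))

open Classical in
/-- Probability that a link has environment `c`. -/
def channelProb (i k : Fin (K + 1)) (c : Channel) (z : Plane) : ℝ≥0∞ :=
  ∫⁻ u in Set.Icc (0 : ℝ) 1, if siteChannel p i k z u = c then 1 else 0

theorem measurable_siteDist (i k : Fin (K + 1)) : Measurable (siteDist p i k) := by
  unfold siteDist
  fun_prop

theorem measurable_siteChannel (i k : Fin (K + 1)) :
    Measurable fun q : Plane × ℝ => siteChannel p i k q.1 q.2 := by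
  unfold siteChannel
  exact Measurable.ite (measurableSet_le measurable_snd
    ((p.rho_measurable i k).comp ((measurable_siteDist p i k).comp measurable_fst)))
    measurable_const measurable_const

theorem measurable_linkMetric (a : Criterion) : Measurable (linkMetric p a) := by
  have hB : Measurable fun e : Fin (K + 1) × Channel × ℝ => p.B e.1 :=
    (Measurable.of_discrete (f := p.B)).comp measurable_fst
  have hα : Measurable fun e : Fin (K + 1) × Channel × ℝ => p.alpha e.2.1 :=
    (Measurable.of_discrete (f := p.alpha)).comp (measurable_fst.comp measurable_snd)
  have hd : Measurable fun e : Fin (K + 1) × Channel × ℝ => e.2.2 :=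
    measurable_snd.comp measurable_snd
  cases a
  · exact hB.mul hd.inv
  · exact hB.mul (hd.pow hα.neg)

theorem measurable_cost (a : Criterion) (i : Fin (K + 1)) (co : Channel) (s : ℝ)
    (k : Fin (K + 1)) :
    Measurable fun q : ℝ × Plane × ℝ × ℝ => cost p a i co s q.1 k q.2.1 q.2.2.1 q.2.2.2 := by
  have hd : Measurable fun q : ℝ × Plane × ℝ × ℝ => siteDist p i k q.2.1 :=
    (measurable_siteDist p i k).comp (by fun_prop)
  have hc : Measurable fun q : ℝ × Plane × ℝ × ℝ => siteChannel p i k q.2.1 q.2.2.1 :=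
    (measurable_siteChannel p i k).comp
      (f := fun q : ℝ × Plane × ℝ × ℝ => (q.2.1, q.2.2.1)) (by fun_prop)
  unfold cost
  refine Measurable.ite (measurableSet_lt
    ((measurable_linkMetric p a).comp (measurable_const.prodMk (hc.prodMk hd))) measurable_fst)
    (Measurable.ite ((MeasurableSet.const _).inter (hc (MeasurableSet.of_discrete (s := {co}))))
      ?_ measurable_const) measurable_const
  fun_prop

theorem measurable_avgCost (a : Criterion) (i : Fin (K + 1)) (co : Channel) (s : ℝ)
    (k : Fin (K + 1)) : Measurable fun q : ℝ × Plane => avgCost p a i co s q.1 k q.2 := by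
  have := isProbabilityMeasure_gain p co
  unfold avgCost markMean
  refine measurable_negLog.comp ?_
  have h1 : Measurable fun q : ((ℝ × Plane) × ℝ) × ℝ =>
      expNeg (cost p a i co s q.1.1.1 k q.1.1.2 q.1.2 q.2) :=
    measurable_expNeg.comp ((measurable_cost p a i co s k).comp
      (f := fun q : ((ℝ × Plane) × ℝ) × ℝ => (q.1.1.1, q.1.1.2, q.1.2, q.2)) (by fun_prop))
  have h2 := h1.lintegral_prod_right' (ν := gammaMeasure (p.m co) (p.m co))
  exact h2.lintegral_prod_right' (ν := (volume : Measure ℝ).restrict (Set.Icc 0 1))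

theorem measurable_channelProb (i k : Fin (K + 1)) (c : Channel) :
    Measurable (channelProb p i k c) := by
  classical
  unfold channelProb
  have h1 : Measurable fun q : Plane × ℝ =>
      if siteChannel p i k q.1 q.2 = c then (1 : ℝ≥0∞) else 0 :=
    Measurable.ite (measurable_siteChannel p i k (MeasurableSet.of_discrete (s := {c})))
      measurable_const measurable_const
  exact h1.lintegral_prod_right' (ν := (volume : Measure ℝ).restrict (Set.Icc 0 1))

end Cost

/-! ### From candidates for the main link to integrals over the plane. -/

namespace Network

variable {K : ℕ} {p : Params K} {Ω : Type*} [MeasurableSpace Ω] {μ : Measure Ω}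
  (net : Network p μ)
include net

/-- Averages of functions of the positions and of the marks can be taken over the marks first. -/
theorem lintegral_loc_marks [IsProbabilityMeasure μ]
    {H : (Fin (K + 1) → ℕ∞ × (ℕ → Plane)) →
      (Fin (K + 1) × ℕ → ℝ) × (Channel × (Fin (K + 1) × ℕ) → ℝ) → ℝ≥0∞}
    (hH : Measurable (Function.uncurry H)) :
    ∫⁻ ω, H (fun k => (net.num k ω, fun n => net.loc k n ω))
        ((fun v => net.unif v ω), fun w => net.gain w ω) ∂μ =
      ∫⁻ ω, ∫⁻ ω', H (fun k => (net.num k ω, fun n => net.loc k n ω))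
        ((fun v => net.unif v ω'), fun w => net.gain w ω') ∂μ ∂μ := by
  refine lintegral_comp_of_indepFun net.indep_loc_marks ?_ ?_ hH
  · exact measurable_pi_lambda _ fun k => (net.poisson k).measurable_num.prodMk
      (measurable_pi_lambda _ fun n => (net.poisson k).measurable_point n)
  · exact (measurable_pi_lambda _ fun v => net.unif_measurable v).prodMk
      (measurable_pi_lambda _ fun w => net.gain_measurable w)

open Classical in
-- Here the positions are frozen. The charges of all transmitters depend on the candidate's mark,
-- but only through its environment; once that is fixed to `c`, the threshold is deterministic and
-- the marks average independently.
theorem lintegral_link_mul_expNeg_marks [IsProbabilityMeasure μ] (a : Criterion)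
    (i : Fin (K + 1)) (co : Channel) (s : ℝ) (ψ : Fin (K + 1) × Channel × ℝ → ℝ≥0∞)
    (v : Fin (K + 1) × ℕ) (act : Set (Fin (K + 1) × ℕ)) (x : Fin (K + 1) × ℕ → Plane) :
    ∫⁻ ω, ψ (v.1, siteChannel p i v.1 (x v) (net.unif v ω), siteDist p i v.1 (x v)) *
        expNeg (∑' w, if w ∈ act ∧ w ≠ v then
          cost p a i co s (linkMetric p a
            (v.1, siteChannel p i v.1 (x v) (net.unif v ω), siteDist p i v.1 (x v)))
            w.1 (x w) (net.unif w ω) (net.gain (co, w) ω) else 0) ∂μ =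
      ∑ c, channelProb p i v.1 c (x v) * (ψ (v.1, c, siteDist p i v.1 (x v)) *
        expNeg (∑' w, if w ∈ act ∧ w ≠ v then
          avgCost p a i co s (linkMetric p a (v.1, c, siteDist p i v.1 (x v))) w.1 (x w)
          else 0)) := by
  set d := siteDist p i v.1 (x v) with hd
  -- The candidate itself is charged `0` if its environment is `c` and `∞` otherwise. Its indicator
  -- thus becomes one more factor of the product over marks, with average `channelProb`.
  obtain ⟨C, hCdef⟩ : ∃ C : Channel → Fin (K + 1) × ℕ → ℝ → ℝ → ℝ≥0∞, C = fun c w u g =>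
      if w = v then (if siteChannel p i v.1 (x v) u = c then 0 else ∞) else
        if w ∈ act then cost p a i co s (linkMetric p a (v.1, c, d)) w.1 (x w) u g else 0 :=
    ⟨_, rfl⟩
  have hsc : ∀ k z, Measurable fun q : ℝ × ℝ => siteChannel p i k z q.1 := fun k z =>
    (measurable_siteChannel p i k).comp (f := fun q : ℝ × ℝ => (z, q.1)) (by fun_prop)
  have hC : ∀ c w, Measurable (Function.uncurry (C c w)) := by
    intro c w
    simp only [hCdef]
    by_cases h1 : w = v
    · simp only [h1, if_true]
      exact Measurable.ite (hsc _ _ (MeasurableSet.of_discrete (s := {c}))) measurable_const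
        measurable_const
    · simp only [h1, if_false]
      by_cases h2 : w ∈ act
      · simp only [h2, if_true]
        exact (measurable_cost p a i co s w.1).comp
          (f := fun q : ℝ × ℝ => (linkMetric p a (v.1, c, d), x w, q.1, q.2)) (by fun_prop)
      · simp only [h2, if_false]
        exact measurable_const
  have h1 : ∀ ω, ψ (v.1, siteChannel p i v.1 (x v) (net.unif v ω), d) *
        expNeg (∑' w, if w ∈ act ∧ w ≠ v then
          cost p a i co s (linkMetric p a
            (v.1, siteChannel p i v.1 (x v) (net.unif v ω), d))
            w.1 (x w) (net.unif w ω) (net.gain (co, w) ω) else 0) =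
      ∑ c, ψ (v.1, c, d) * expNeg (∑' w, C c w (net.unif w ω) (net.gain (co, w) ω)) := by
    intro ω
    rw [Finset.sum_eq_single (siteChannel p i v.1 (x v) (net.unif v ω))]
    · congr 2
      refine tsum_congr fun w => ?_
      by_cases hw : w = v <;> simp [hCdef, hw]
    · intro c _ hc
      rw [ENNReal.tsum_eq_top_of_eq_top ⟨v, by simp [hCdef, Ne.symm hc]⟩]
      simp
    · simp
  simp_rw [h1]
  have hm : ∀ c, Measurable fun ω =>
      expNeg (∑' w, C c w (net.unif w ω) (net.gain (co, w) ω)) := fun c =>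
    measurable_expNeg.comp (Measurable.tsum fun w =>
      Measurable.comp (g := Function.uncurry (C c w)) (hC c w)
        ((net.unif_measurable w).prodMk (net.gain_measurable (co, w))))
  rw [lintegral_finsetSum _ fun c _ => (hm c).const_mul _]
  refine Finset.sum_congr rfl fun c _ => ?_
  rw [lintegral_const_mul _ (hm c), net.lintegral_expNeg_marks co (C c) (hC c),
    ENNReal.tsum_eq_add_tsum_ite v, expNeg_add,
    expNeg_negLog (markMean_le_one p co fun _ _ => expNeg_le_one _)]
  have h2 : markMean p co (fun u g => expNeg (C c v u g)) = channelProb p i v.1 c (x v) := by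
    have := isProbabilityMeasure_gain p co
    unfold markMean channelProb
    refine lintegral_congr fun u => ?_
    by_cases hu : siteChannel p i v.1 (x v) u = c <;> simp [hCdef, hu]
  rw [h2, mul_left_comm]
  congr 3
  refine tsum_congr fun w => ?_
  by_cases hw : w = v
  · simp [hw]
  · by_cases hw2 : w ∈ act
    · simp [hw, hw2, hCdef, avgCost]
    · simp [hw, hw2, hCdef, negLog]

end Network

/-- The numbers and positions of the transmitters of all layers. -/
abbrev LocData (K : ℕ) : Type := Fin (K + 1) → ℕ∞ × (ℕ → Plane)

/-- The uniform variables and gains of all transmitters. -/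
abbrev MarkData (K : ℕ) : Type :=
  (Fin (K + 1) × ℕ → ℝ) × (Channel × (Fin (K + 1) × ℕ) → ℝ)

namespace Network

variable {K : ℕ} {p : Params K} {Ω : Type*} [MeasurableSpace Ω] {μ : Measure Ω}
  (net : Network p μ)
include net

/-- The intensity measure of the transmitters of a layer. -/
abbrev _root_.MAN.layerIntensity (p : Params K) (k : Fin (K + 1)) : Measure Plane :=
  ENNReal.ofReal (p.lam k) • (volume : Measure Plane)

instance _root_.MAN.sigmaFinite_layerIntensity (p : Params K) (k : Fin (K + 1)) :
    SigmaFinite (layerIntensity p k) :=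
  inferInstanceAs (SigmaFinite ((p.lam k).toNNReal • (volume : Measure Plane)))

open Classical in
-- Positions and marks are independent, so the identity for frozen positions holds conditionally on
-- the positions and can be averaged over them.
theorem lintegral_link_mul_expNeg [IsProbabilityMeasure μ] (a : Criterion) (i : Fin (K + 1))
    (co : Channel) (s : ℝ) {ψ : Fin (K + 1) × Channel × ℝ → ℝ≥0∞} (hψ : Measurable ψ)
    (v : Fin (K + 1) × ℕ) :
    ∫⁻ ω, (if net.Active v ω then ψ (v.1, net.channel i v ω, net.linkDist i v ω) *
        expNeg (∑' w, if net.Active w ω ∧ w ≠ v then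
          cost p a i co s (linkMetric p a (v.1, net.channel i v ω, net.linkDist i v ω))
            w.1 (net.loc w.1 w.2 ω) (net.unif w ω) (net.gain (co, w) ω) else 0) else 0) ∂μ =
      ∑ c, ∫⁻ ω, (if net.Active v ω then channelProb p i v.1 c (net.loc v.1 v.2 ω) *
        ψ (v.1, c, siteDist p i v.1 (net.loc v.1 v.2 ω)) *
        expNeg (∑' w, if net.Active w ω ∧ w ≠ v then
          avgCost p a i co s (linkMetric p a (v.1, c, siteDist p i v.1 (net.loc v.1 v.2 ω)))
            w.1 (net.loc w.1 w.2 ω) else 0) else 0) ∂μ := by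
  obtain ⟨H, hHdef⟩ : ∃ H : LocData K → MarkData K → ℝ≥0∞, H = fun q r =>
      if (v.2 : ℕ∞) < (q v.1).1 then
        ψ (v.1, siteChannel p i v.1 ((q v.1).2 v.2) (r.1 v), siteDist p i v.1 ((q v.1).2 v.2)) *
          expNeg (∑' w, if (w.2 : ℕ∞) < (q w.1).1 ∧ w ≠ v then
            cost p a i co s (linkMetric p a (v.1, siteChannel p i v.1 ((q v.1).2 v.2) (r.1 v),
              siteDist p i v.1 ((q v.1).2 v.2))) w.1 ((q w.1).2 w.2) (r.1 w) (r.2 (co, w)) else 0)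
      else 0 := ⟨_, rfl⟩
  have hnum : ∀ w : Fin (K + 1) × ℕ, MeasurableSet {x : LocData K × MarkData K | (w.2 : ℕ∞) < (x.1 w.1).1} := by
    intro w
    have : Measurable fun x : LocData K × MarkData K => (x.1 w.1).1 := by fun_prop
    exact this (MeasurableSet.of_discrete (s := Set.Ioi (w.2 : ℕ∞)))
  have hlink : Measurable fun x : LocData K × MarkData K => (v.1, siteChannel p i v.1 ((x.1 v.1).2 v.2) (x.2.1 v),
      siteDist p i v.1 ((x.1 v.1).2 v.2)) := by
    refine measurable_const.prodMk (Measurable.prodMk ?_ ?_)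
    · exact (measurable_siteChannel p i v.1).comp
        (f := fun x : LocData K × MarkData K => ((x.1 v.1).2 v.2, x.2.1 v)) (by fun_prop)
    · exact (measurable_siteDist p i v.1).comp
        (f := fun x : LocData K × MarkData K => ((x.1 v.1).2 v.2)) (by fun_prop)
  have hH : Measurable (Function.uncurry H) := by
    rw [hHdef]
    refine Measurable.ite (hnum v) ((hψ.comp hlink).mul (measurable_expNeg.comp
      (Measurable.tsum fun w => Measurable.ite ((hnum w).inter (MeasurableSet.const _)) ?_
        measurable_const))) measurable_const
    exact (measurable_cost p a i co s w.1).comp (f := fun x : LocData K × MarkData K =>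
      (linkMetric p a (v.1, siteChannel p i v.1 ((x.1 v.1).2 v.2) (x.2.1 v),
        siteDist p i v.1 ((x.1 v.1).2 v.2)), (x.1 w.1).2 w.2, x.2.1 w, x.2.2 (co, w)))
      (((measurable_linkMetric p a).comp hlink).prodMk (by fun_prop))
  have h1 := net.lintegral_loc_marks hH
  refine Eq.trans (lintegral_congr fun ω => ?_) (h1.trans ?_)
  · rw [hHdef]
    unfold Active channel linkDist siteChannel siteDist
    congr!
  rw [hHdef]
  have hm : ∀ c, Measurable fun ω => (if net.Active v ω then
      channelProb p i v.1 c (net.loc v.1 v.2 ω) *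
        ψ (v.1, c, siteDist p i v.1 (net.loc v.1 v.2 ω)) *
        expNeg (∑' w, if net.Active w ω ∧ w ≠ v then
          avgCost p a i co s (linkMetric p a (v.1, c, siteDist p i v.1 (net.loc v.1 v.2 ω)))
            w.1 (net.loc w.1 w.2 ω) else 0) else 0) := by
    intro c
    have hloc : ∀ w : Fin (K + 1) × ℕ, Measurable (net.loc w.1 w.2) := fun w =>
      (net.poisson w.1).measurable_point w.2
    have hl : Measurable fun ω => (v.1, c, siteDist p i v.1 (net.loc v.1 v.2 ω)) :=
      measurable_const.prodMk (measurable_const.prodMk ((measurable_siteDist p i v.1).comp (hloc v)))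
    refine Measurable.ite (net.measurableSet_active v)
      ((((measurable_channelProb p i v.1 c).comp (hloc v)).mul (hψ.comp hl)).mul
        (measurable_expNeg.comp (Measurable.tsum fun w =>
          Measurable.ite ((net.measurableSet_active w).inter (MeasurableSet.const _)) ?_
            measurable_const))) measurable_const
    exact (measurable_avgCost p a i co s w.1).comp (f := fun ω =>
      (linkMetric p a (v.1, c, siteDist p i v.1 (net.loc v.1 v.2 ω)), net.loc w.1 w.2 ω))
      (((measurable_linkMetric p a).comp hl).prodMk (hloc w))
  rw [← lintegral_finsetSum _ fun c _ => hm c]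
  refine lintegral_congr fun ω => ?_
  by_cases hv : net.Active v ω
  · have hv' : (v.2 : ℕ∞) < net.num v.1 ω := hv
    simp only [hv, hv', if_true]
    have h2 := net.lintegral_link_mul_expNeg_marks a i co s ψ v {w | net.Active w ω}
      fun w => net.loc w.1 w.2 ω
    refine Eq.trans (lintegral_congr fun ω' => ?_) (h2.trans (Finset.sum_congr rfl fun c _ => ?_))
    · congr!
    · rw [mul_assoc]
      rfl
  · have hv' : ¬ (v.2 : ℕ∞) < net.num v.1 ω := hv
    simp [hv, hv']

open Classical in
/-- Mecke's formula for exponential functionals of the transmitters of all layers. -/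
theorem mecke_layers [IsProbabilityMeasure μ] (j : Fin (K + 1)) {F : Plane → ℝ≥0∞}
    (hF : Measurable F) {U : Plane → Fin (K + 1) → Plane → ℝ≥0∞}
    (hU : ∀ k, Measurable fun q : Plane × Plane => U q.1 k q.2) :
    ∑' n : ℕ, ∫⁻ ω, (if net.Active (j, n) ω then F (net.loc j n ω) *
        expNeg (∑' w, if net.Active w ω ∧ w ≠ (j, n) then
          U (net.loc j n ω) w.1 (net.loc w.1 w.2 ω) else 0) else 0) ∂μ =
      ∫⁻ x, F x * expNeg (∑ k, ∫⁻ y, (1 - expNeg (U x k y)) ∂(layerIntensity p k))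
        ∂(layerIntensity p j) := by
  set T : Finset (Fin (K + 1)) := Finset.univ.erase j with hT
  have hnum : ∀ k, Measurable (net.num k) := fun k => (net.poisson k).measurable_num
  have hloc : ∀ k n, Measurable (net.loc k n) := fun k => (net.poisson k).measurable_point
  have hact : ∀ w, MeasurableSet {ω | net.Active w ω} := net.measurableSet_active
  -- `O` is the factor of the layers other than `j`, and `H` below sums over the candidates of layer
  -- `j`. By independence of the layers, layer `j` is averaged first with the others frozen, by
  -- Mecke's formula, and then the others by their Laplace functionals.
  obtain ⟨O, hO⟩ : ∃ O : Plane → (T → ℕ∞ × (ℕ → Plane)) → ℝ≥0∞, O = fun x q =>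
      expNeg (∑ k : T, ∑' m : ℕ, if (m : ℕ∞) < (q k).1 then U x k ((q k).2 m) else 0) := ⟨_, rfl⟩
  obtain ⟨H, hH⟩ : ∃ H : (T → ℕ∞ × (ℕ → Plane)) → ℕ∞ × (ℕ → Plane) → ℝ≥0∞, H = fun q r =>
      ∑' n : ℕ, if (n : ℕ∞) < r.1 then F (r.2 n) * O (r.2 n) q *
        expNeg (∑' m : ℕ, if (m : ℕ∞) < r.1 ∧ m ≠ n then U (r.2 n) j (r.2 m) else 0) else 0 :=
    ⟨_, rfl⟩
  have hOm : Measurable (Function.uncurry O) := by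
    rw [hO]
    refine measurable_expNeg.comp (Finset.measurable_sum _ fun k _ => Measurable.tsum fun m =>
      Measurable.ite ?_ ?_ measurable_const)
    · have : Measurable fun x : Plane × (T → ℕ∞ × (ℕ → Plane)) => (x.2 k).1 := by fun_prop
      exact this (MeasurableSet.of_discrete (s := Set.Ioi (m : ℕ∞)))
    · exact (hU k).comp (f := fun x : Plane × (T → ℕ∞ × (ℕ → Plane)) => (x.1, (x.2 k).2 m))
        (by fun_prop)
  have hHm : Measurable (Function.uncurry H) := by
    rw [hH]
    have hlt : ∀ n : ℕ, MeasurableSet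
        {x : (T → ℕ∞ × (ℕ → Plane)) × (ℕ∞ × (ℕ → Plane)) | (n : ℕ∞) < x.2.1} := by
      intro n
      have : Measurable fun x : (T → ℕ∞ × (ℕ → Plane)) × (ℕ∞ × (ℕ → Plane)) => x.2.1 := by fun_prop
      exact this (MeasurableSet.of_discrete (s := Set.Ioi (n : ℕ∞)))
    refine Measurable.tsum fun n => Measurable.ite (hlt n) (Measurable.mul (Measurable.mul ?_ ?_)
      (measurable_expNeg.comp (Measurable.tsum fun m => Measurable.ite
        ((hlt m).inter (MeasurableSet.const _)) ?_ measurable_const))) measurable_const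
    · exact hF.comp (by fun_prop)
    · exact hOm.comp (f := fun x : (T → ℕ∞ × (ℕ → Plane)) × (ℕ∞ × (ℕ → Plane)) => (x.2.2 n, x.1))
        (by fun_prop)
    · exact (hU j).comp (f := fun x : (T → ℕ∞ × (ℕ → Plane)) × (ℕ∞ × (ℕ → Plane)) =>
        (x.2.2 n, x.2.2 m)) (by fun_prop)
  set layer : Fin (K + 1) → Ω → ℕ∞ × (ℕ → Plane) := fun k ω => (net.num k ω, fun n => net.loc k n ω)
    with hlayer
  have hlm : ∀ k, Measurable (layer k) := fun k =>
    (hnum k).prodMk (measurable_pi_lambda _ fun n => hloc k n)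
  have hindep : IndepFun (fun ω (k : T) => layer k ω) (layer j) μ := by
    have h1 := net.indep_layers.indepFun_finset T {j} (by simp [hT]) hlm
    have hpi : Measurable fun q : ({j} : Finset (Fin (K + 1))) → ℕ∞ × (ℕ → Plane) =>
        q ⟨j, Finset.mem_singleton_self j⟩ := measurable_pi_apply _
    exact h1.comp (φ := id) (ψ := fun q => q ⟨j, Finset.mem_singleton_self j⟩) measurable_id
      hpi
  have hind := lintegral_comp_of_indepFun hindep (measurable_pi_lambda _ fun k => hlm k) (hlm j) hHm
  have e1 : ∑' n : ℕ, ∫⁻ ω, (if net.Active (j, n) ω then F (net.loc j n ω) *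
        expNeg (∑' w, if net.Active w ω ∧ w ≠ (j, n) then
          U (net.loc j n ω) w.1 (net.loc w.1 w.2 ω) else 0) else 0) ∂μ =
      ∫⁻ ω, H (fun k : T => layer k ω) (layer j ω) ∂μ := by
    rw [← lintegral_tsum]
    · refine lintegral_congr fun ω => ?_
      rw [hH, hO]
      refine tsum_congr fun n => ?_
      by_cases hn : (n : ℕ∞) < net.num j ω
      · have hn' : net.Active (j, n) ω := hn
        simp only [hn', hlayer, hn, if_true]
        rw [mul_assoc, ← expNeg_add, ENNReal.tsum_prod', tsum_fintype,
          ← Finset.add_sum_erase _ _ (Finset.mem_univ j), add_comm]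
        congr 3
        · rw [← Finset.sum_coe_sort]
          refine Finset.sum_congr rfl fun k _ => tsum_congr fun m => ?_
          have hk : (k : Fin (K + 1)) ≠ j := Finset.ne_of_mem_erase k.2
          simp [Active, hk]
        · refine tsum_congr fun m => ?_
          simp [Active]
      · have hn' : ¬ net.Active (j, n) ω := hn
        simp [hn', hlayer, hn]
    · intro n
      refine (Measurable.ite (hact (j, n)) ((hF.comp (hloc j n)).mul (measurable_expNeg.comp
        (Measurable.tsum fun w => Measurable.ite ((hact w).inter (MeasurableSet.const _)) ?_
          measurable_const))) measurable_const).aemeasurable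
      exact (hU w.1).comp (f := fun ω => (net.loc j n ω, net.loc w.1 w.2 ω))
        ((hloc j n).prodMk (hloc w.1 w.2))
  have e2 : ∀ q, ∫⁻ ω, H q (layer j ω) ∂μ = ∫⁻ x, F x * O x q *
      expNeg (∫⁻ y, (1 - expNeg (U x j y)) ∂(layerIntensity p j)) ∂(layerIntensity p j) := by
    intro q
    rw [← (net.poisson j).mecke_expNeg
      (F := fun x => F x * O x q) (hF.mul (hOm.comp measurable_prodMk_right))
      (v := fun x y => U x j y) (hU j), hH]
  have e3 : ∀ x, ∫⁻ ω, O x (fun k : T => layer k ω) ∂μ =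
      expNeg (∑ k ∈ T, ∫⁻ y, (1 - expNeg (U x k y)) ∂(layerIntensity p k)) := by
    intro x
    have hUx : ∀ k, Measurable (U x k) := fun k => (hU k).comp measurable_prodMk_left
    rw [hO, ← Finset.sum_coe_sort]
    simp_rw [expNeg_finsetSum]
    have hfac : ∀ k : Fin (K + 1), Measurable fun r : ℕ∞ × (ℕ → Plane) =>
        expNeg (∑' m : ℕ, if (m : ℕ∞) < r.1 then U x k (r.2 m) else 0) := by
      intro k
      refine measurable_expNeg.comp (Measurable.tsum fun m =>
        Measurable.ite ?_ ((hUx k).comp (by fun_prop)) measurable_const)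
      exact measurable_fst (MeasurableSet.of_discrete (s := Set.Ioi (m : ℕ∞)))
    have hi : iIndepFun (fun (k : T) ω => expNeg (∑' m : ℕ,
        if (m : ℕ∞) < (layer k ω).1 then U x k ((layer k ω).2 m) else 0)) μ :=
      (net.indep_layers.precomp (g := ((↑) : T → Fin (K + 1))) Subtype.val_injective).comp
        (fun (k : T) r => expNeg (∑' m : ℕ, if (m : ℕ∞) < r.1 then U x k (r.2 m) else 0))
        fun k => hfac k
    rw [lintegral_prod_eq_prod_lintegral_of_indepFun Finset.univ _ hi
      fun k => (hfac k).comp (hlm k)]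
    refine Finset.prod_congr rfl fun k _ => ?_
    rw [← (net.poisson k).lintegral_expNeg (hUx k)]
    refine lintegral_congr fun ω => ?_
    rw [lintegral_config (hUx k)]
  rw [e1]
  refine hind.trans ?_
  simp_rw [e2]
  rw [lintegral_lintegral_swap]
  · refine lintegral_congr fun x => ?_
    have hOx : Measurable fun ω => O x (fun k : T => layer k ω) :=
      (hOm.comp measurable_prodMk_left).comp (measurable_pi_lambda _ fun k => hlm k)
    rw [lintegral_mul_const _ (hOx.const_mul _), lintegral_const_mul _ hOx, e3, mul_assoc,
      ← expNeg_add, add_comm, hT,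
      Finset.add_sum_erase Finset.univ
        (fun k => ∫⁻ y, (1 - expNeg (U x k y)) ∂(layerIntensity p k)) (Finset.mem_univ j)]
  · have hI : Measurable fun x => ∫⁻ y, (1 - expNeg (U x j y)) ∂(layerIntensity p j) :=
      (measurable_const.sub (measurable_expNeg.comp (hU j))).lintegral_prod_right'
    have hO2 : Measurable fun q : Ω × Plane => O q.2 (fun k : T => layer k q.1) :=
      hOm.comp (f := fun q : Ω × Plane => (q.2, fun k : T => layer k q.1))
        (measurable_snd.prodMk (measurable_pi_lambda _ fun k => (hlm k).comp measurable_fst))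
    exact (((hF.comp measurable_snd).mul hO2).mul
      (measurable_expNeg.comp (hI.comp measurable_snd))).aemeasurable

end Network

/-! ### Dependence of the averaged charge on `s`. -/

section Gap

variable {K : ℕ} (p : Params K)

/-- Laplace transform of the exponential distribution of mean `1`. -/
theorem lintegral_expNeg_gammaMeasure {w : ℝ} (hw : 0 ≤ w) :
    ∫⁻ g, expNeg (ENNReal.ofReal (w * g)) ∂(gammaMeasure 1 1) = ENNReal.ofReal (1 / (1 + w)) := by
  -- Exponential tilting changes the rate `1` into `1 + w`, up to the normalizing constant.
  have h1 : ∀ g : ℝ, gammaPDF 1 1 g * expNeg (ENNReal.ofReal (w * g)) =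
      ENNReal.ofReal (1 / (1 + w)) * gammaPDF 1 (1 + w) g := by
    intro g
    by_cases hg : 0 ≤ g
    · rw [gammaPDF_of_nonneg hg, gammaPDF_of_nonneg hg, expNeg_ofReal (mul_nonneg hw hg),
        ← ENNReal.ofReal_mul (by simp; positivity), ← ENNReal.ofReal_mul (by positivity)]
      congr 1
      have : Real.exp (-((1 + w) * g)) = Real.exp (-g) * Real.exp (-(w * g)) := by
        rw [← Real.exp_add]
        ring_nf
      simp [this]
      field_simp
    · rw [gammaPDF_of_neg (not_le.1 hg), gammaPDF_of_neg (not_le.1 hg)]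
      simp
  have hm : Measurable (gammaPDF 1 1) := (measurable_gammaPDFReal 1 1).ennreal_ofReal
  have hm' : Measurable (gammaPDF 1 (1 + w)) := (measurable_gammaPDFReal 1 (1 + w)).ennreal_ofReal
  rw [gammaMeasure, lintegral_withDensity_eq_lintegral_mul _ hm (by fun_prop)]
  simp only [Pi.mul_apply, h1]
  rw [lintegral_const_mul _ hm', lintegral_gammaPDF_eq_one one_pos (by positivity), mul_one]

open Classical in
/-- The loss of a same-layer transmitter at `z` in the environment `co`, averaged over the marks:
zero if such a transmitter would be preferred to a main link of metric `t`. -/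
def avgLoss (a : Criterion) (i : Fin (K + 1)) (co : Channel) (s t : ℝ) (z : Plane) : ℝ≥0∞ :=
  if linkMetric p a (i, co, siteDist p i i z) < t then
    channelProb p i i co z *
      ENNReal.ofReal (1 - 1 / (1 + s * (p.P i * siteDist p i i z ^ (-p.alpha co))))
  else 0

theorem measurable_avgLoss (a : Criterion) (i : Fin (K + 1)) (co : Channel) (s : ℝ) :
    Measurable fun q : ℝ × Plane => avgLoss p a i co s q.1 q.2 := by
  have hd : Measurable fun q : ℝ × Plane => siteDist p i i q.2 :=
    (measurable_siteDist p i i).comp measurable_snd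
  unfold avgLoss
  refine Measurable.ite (measurableSet_lt ((measurable_linkMetric p a).comp
    (measurable_const.prodMk (measurable_const.prodMk hd))) measurable_fst) ?_ measurable_const
  refine ((measurable_channelProb p i i co).comp measurable_snd).mul ?_
  fun_prop

theorem expNeg_avgCost (a : Criterion) (i : Fin (K + 1)) (co : Channel) (s t : ℝ)
    (k : Fin (K + 1)) (z : Plane) : expNeg (avgCost p a i co s t k z) =
      markMean p co fun u g => expNeg (cost p a i co s t k z u g) :=
  expNeg_negLog (markMean_le_one p co fun _ _ => expNeg_le_one _)

/-- Other layers are charged only for being preferred to the main link, never for interference. -/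
theorem avgCost_of_ne (a : Criterion) {i k : Fin (K + 1)} (co : Channel) (s t : ℝ) (hk : k ≠ i)
    (z : Plane) : avgCost p a i co s t k z = avgCost p a i co 0 t k z := by
  simp [avgCost, cost, hk]

/-- A transmitter whose metric is not below `t` contributes its full loss for every `s`. For the
others, passing from `0` to `s` lowers the gain average from `1` to `1 / (1 + w)` exactly when the
environment is `co`. Since the two effects are additive, the exclusion event factors out of the
Laplace transform. -/
theorem one_sub_expNeg_avgCost_self (a : Criterion) (i : Fin (K + 1)) {co : Channel}
    (hm : p.m co = 1) {s : ℝ} (hs : 0 ≤ s) (t : ℝ) (z : Plane) :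
    1 - expNeg (avgCost p a i co s t i z) =
      (1 - expNeg (avgCost p a i co 0 t i z)) + avgLoss p a i co s t z := by
  classical
  set w : ℝ := s * (p.P i * siteDist p i i z ^ (-p.alpha co)) with hw
  have hw0 : 0 ≤ w := mul_nonneg hs (mul_nonneg (p.P_pos i).le
    (Real.rpow_nonneg (Real.sqrt_nonneg _) _))
  have hLadd : ENNReal.ofReal (1 / (1 + w)) + ENNReal.ofReal (1 - 1 / (1 + w)) = 1 := by
    have h1 : 1 / (1 + w) ≤ 1 := by
      rw [div_le_one (by positivity)]
      linarith
    rw [← ENNReal.ofReal_add (by positivity) (by linarith)]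
    simp
  have hgain : ∀ u, ∫⁻ g, expNeg (cost p a i co s t i z u g) ∂(gammaMeasure (p.m co) (p.m co)) =
      if linkMetric p a (i, siteChannel p i i z u, siteDist p i i z) < t then
        (if siteChannel p i i z u = co then ENNReal.ofReal (1 / (1 + w)) else 1) else 0 := by
    intro u
    have := isProbabilityMeasure_gain p co
    unfold cost
    by_cases h1 : linkMetric p a (i, siteChannel p i i z u, siteDist p i i z) < t
    · by_cases h2 : siteChannel p i i z u = co
      · rw [h2] at h1
        simp only [h1, h2, if_true, and_self]
        rw [hm, ← lintegral_expNeg_gammaMeasure hw0]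
        refine lintegral_congr fun g => ?_
        rw [hw]
        ring_nf
      · simp [h1, h2]
    · simp [h1]
  have hgain0 : ∀ u, ∫⁻ g, expNeg (cost p a i co 0 t i z u g) ∂(gammaMeasure (p.m co) (p.m co)) =
      if linkMetric p a (i, siteChannel p i i z u, siteDist p i i z) < t then 1 else 0 := by
    intro u
    have := isProbabilityMeasure_gain p co
    unfold cost
    by_cases h1 : linkMetric p a (i, siteChannel p i i z u, siteDist p i i z) < t <;> simp [h1]
  have hsum : expNeg (avgCost p a i co s t i z) + avgLoss p a i co s t z =
      expNeg (avgCost p a i co 0 t i z) := by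
    rw [expNeg_avgCost, expNeg_avgCost]
    unfold markMean
    simp_rw [hgain, hgain0]
    have hch : Measurable fun u => siteChannel p i i z u :=
      (measurable_siteChannel p i i).comp (f := fun u : ℝ => (z, u)) (by fun_prop)
    have hl : avgLoss p a i co s t z = ∫⁻ u in Set.Icc (0 : ℝ) 1,
        if linkMetric p a (i, co, siteDist p i i z) < t ∧ siteChannel p i i z u = co then
          ENNReal.ofReal (1 - 1 / (1 + w)) else 0 := by
      unfold avgLoss channelProb
      split_ifs with h1
      · have hm1 : Measurable fun u => if siteChannel p i i z u = co then (1 : ℝ≥0∞) else 0 :=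
          Measurable.ite (hch (MeasurableSet.of_discrete (s := {co})))
            measurable_const measurable_const
        rw [← lintegral_mul_const _ hm1]
        refine lintegral_congr fun u => ?_
        by_cases h2 : siteChannel p i i z u = co <;> simp [h1, h2, hw]
      · simp [h1]
    rw [hl, ← lintegral_add_right]
    · refine lintegral_congr fun u => ?_
      by_cases h2 : siteChannel p i i z u = co
      · simp only [h2, if_true, and_true]
        split_ifs
        · exact hLadd
        · simp
      · simp [h2]
    · exact Measurable.ite ((MeasurableSet.const _).inter
        (hch (MeasurableSet.of_discrete (s := {co})))) measurable_const measurable_const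
  symm
  refine ENNReal.eq_sub_of_add_eq (expNeg_ne_top _) ?_
  rw [add_assoc, add_comm (avgLoss _ _ _ _ _ _ _), hsum]
  exact tsub_add_cancel_of_le (expNeg_le_one _)

theorem sum_lintegral_one_sub_expNeg_avgCost (a : Criterion) (i : Fin (K + 1)) {co : Channel}
    (hm : p.m co = 1) {s : ℝ} (hs : 0 ≤ s) (t : ℝ) :
    ∑ k, ∫⁻ y, (1 - expNeg (avgCost p a i co s t k y)) ∂(layerIntensity p k) =
      ∑ k, ∫⁻ y, (1 - expNeg (avgCost p a i co 0 t k y)) ∂(layerIntensity p k) +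
        ∫⁻ y, avgLoss p a i co s t y ∂(layerIntensity p i) := by
  rw [← Finset.add_sum_erase Finset.univ (fun k => ∫⁻ y, (1 - expNeg (avgCost p a i co s t k y))
      ∂(layerIntensity p k)) (Finset.mem_univ i),
    ← Finset.add_sum_erase Finset.univ (fun k => ∫⁻ y, (1 - expNeg (avgCost p a i co 0 t k y))
      ∂(layerIntensity p k)) (Finset.mem_univ i)]
  have h1 : ∀ k ∈ Finset.univ.erase i, ∫⁻ y, (1 - expNeg (avgCost p a i co s t k y))
      ∂(layerIntensity p k) = ∫⁻ y, (1 - expNeg (avgCost p a i co 0 t k y))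
      ∂(layerIntensity p k) := by
    intro k hk
    simp_rw [avgCost_of_ne p a co s t (Finset.ne_of_mem_erase hk)]
  have hml : Measurable (avgLoss p a i co s t) :=
    (measurable_avgLoss p a i co s).comp (f := fun y : Plane => (t, y)) (by fun_prop)
  rw [Finset.sum_congr rfl h1]
  simp_rw [one_sub_expNeg_avgCost_self p a i hm hs t]
  rw [lintegral_add_right _ hml]
  ring

end Gap

/-! ### The joint law of the main link and the interference. -/

namespace Network

variable {K : ℕ} {p : Params K} {Ω : Type*} [MeasurableSpace Ω] {μ : Measure Ω}
  (net : Network p μ)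
include net

theorem metric_eq (a : Criterion) (i : Fin (K + 1)) (v : Fin (K + 1) × ℕ) (ω : Ω) :
    net.metric a i v ω = linkMetric p a (v.1, net.channel i v ω, net.linkDist i v ω) := by
  cases a <;> rfl

theorem cost_eq (a : Criterion) (i : Fin (K + 1)) (co : Channel) (s t : ℝ)
    (w : Fin (K + 1) × ℕ) (ω : Ω) [Decidable (net.metric a i w ω < t)]
    [Decidable (w.1 = i ∧ net.channel i w ω = co)] :
    cost p a i co s t w.1 (net.loc w.1 w.2 ω) (net.unif w ω) (net.gain (co, w) ω) =
      if net.metric a i w ω < t then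
        (if w.1 = i ∧ net.channel i w ω = co then
          ENNReal.ofReal (s * (p.P i * net.gain (co, w) ω * net.linkDist i w ω ^ (-p.alpha co)))
        else 0) else ∞ := by
  have e1 : siteChannel p i w.1 (net.loc w.1 w.2 ω) (net.unif w ω) = net.channel i w ω := rfl
  have e2 : siteDist p i w.1 (net.loc w.1 w.2 ω) = net.linkDist i w ω := rfl
  unfold cost
  rw [e1, e2, ← metric_eq]
  by_cases h1 : net.metric a i w ω < t <;>
    by_cases h2 : w.1 = i ∧ net.channel i w ω = co <;> simp only [h1, h2, if_true, if_false]

open Classical in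
/-- A function of the main link and of the interference, as a sum over the candidates for the
associated transmitter. -/
theorem mainLink_mul_expNeg_eq_tsum (a : Criterion) (i : Fin (K + 1)) (co : Channel) (s : ℝ)
    {ψ : Fin (K + 1) × Channel × ℝ → ℝ≥0∞} (hψ0 : ∀ e, e.2.2 ≤ 0 → ψ e = 0) (ω : Ω) :
    ψ (net.mainLink a i ω) *
        expNeg (∑' v, ENNReal.ofReal (s * net.interferenceTerm a i i co ω v)) =
      ∑' v, (if net.Active v ω then ψ (v.1, net.channel i v ω, net.linkDist i v ω) *
        expNeg (∑' w, if net.Active w ω ∧ w ≠ v then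
          cost p a i co s (linkMetric p a (v.1, net.channel i v ω, net.linkDist i v ω))
            w.1 (net.loc w.1 w.2 ω) (net.unif w ω) (net.gain (co, w) ω) else 0) else 0) := by
  simp_rw [← metric_eq, cost_eq]
  -- An active candidate that is not associated has a competitor of at least equal metric, whose
  -- charge `∞` annihilates the term; ties count as well.
  have hzero : ∀ v, ¬ net.IsAssociated a i v ω → (if net.Active v ω then
      ψ (v.1, net.channel i v ω, net.linkDist i v ω) *
        expNeg (∑' w, if net.Active w ω ∧ w ≠ v then
          (if net.metric a i w ω < net.metric a i v ω then
            (if w.1 = i ∧ net.channel i w ω = co then ENNReal.ofReal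
              (s * (p.P i * net.gain (co, w) ω * net.linkDist i w ω ^ (-p.alpha co)))
            else 0) else ∞) else 0) else 0) = 0 := by
    intro v hv
    split_ifs with hact
    · have : ∃ w, net.Active w ω ∧ w ≠ v ∧ ¬ net.metric a i w ω < net.metric a i v ω := by
        by_contra hc
        push Not at hc
        exact hv ⟨hact, hc⟩
      obtain ⟨w, hw1, hw2, hw3⟩ := this
      rw [ENNReal.tsum_eq_top_of_eq_top ⟨w, by simp [hw1, hw2, hw3]⟩]
      simp
    · rfl
  by_cases hex : ∃ v, net.IsAssociated a i v ω
  · have hml : net.mainLink a i ω = (hex.choose.1, net.channel i hex.choose ω,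
        net.linkDist i hex.choose ω) := dif_pos hex
    have hch := hex.choose_spec
    generalize hex.choose = v at hml hch
    rw [tsum_eq_single v fun w hw => hzero w fun hc => hw (hc.unique hch), if_pos hch.1, hml]
    congr 2
    refine tsum_congr fun w => ?_
    unfold interferenceTerm
    by_cases hw : w = v
    · subst hw
      simp [hch]
    · have hna : ¬ net.IsAssociated a i w ω := fun hc => hw (hc.unique hch)
      by_cases hact : net.Active w ω
      · have := hch.2 w hact hw
        by_cases h3 : w.1 = i ∧ net.channel i w ω = co
        · simp [hact, hw, this, hna, h3.1, h3.2]
        · have h4 : ¬ (w.1 = i ∧ net.channel i w ω = co ∧ ¬ net.IsAssociated a i w ω) :=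
            fun hc => h3 ⟨hc.1, hc.2.1⟩
          simp only [hact, this, h3, h4]
          simp
      · simp [hact]
  -- Without an associated transmitter the main link takes its default value of length `0`, where
  -- `ψ` vanishes.
  · have hml : net.mainLink a i ω = (i, Channel.N, 0) := dif_neg hex
    rw [hml, hψ0 _ le_rfl, zero_mul]
    symm
    rw [ENNReal.tsum_eq_zero]
    exact fun v => hzero v fun hc => hex ⟨v, hc⟩

/-- After averaging over the marks, the sum over the candidates of each layer has the form evaluated
by `mecke_layers`. All dependence on `s` ends up in the last exponential. -/
theorem lintegral_mainLink_mul_expNeg [IsProbabilityMeasure μ] (a : Criterion) (i : Fin (K + 1))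
    (co : Channel) (s : ℝ) {ψ : Fin (K + 1) × Channel × ℝ → ℝ≥0∞} (hψ : Measurable ψ)
    (hψ0 : ∀ e, e.2.2 ≤ 0 → ψ e = 0) :
    ∫⁻ ω, ψ (net.mainLink a i ω) *
        expNeg (∑' v, ENNReal.ofReal (s * net.interferenceTerm a i i co ω v)) ∂μ =
      ∑ j, ∑ c, ∫⁻ x, channelProb p i j c x * ψ (j, c, siteDist p i j x) *
        expNeg (∑ k, ∫⁻ y, (1 - expNeg (avgCost p a i co s
          (linkMetric p a (j, c, siteDist p i j x)) k y)) ∂(layerIntensity p k))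
        ∂(layerIntensity p j) := by
  classical
  simp_rw [net.mainLink_mul_expNeg_eq_tsum a i co s hψ0]
  have hact := net.measurableSet_active
  have hloc : ∀ w : Fin (K + 1) × ℕ, Measurable (net.loc w.1 w.2) := fun w =>
    (net.poisson w.1).measurable_point w.2
  rw [lintegral_tsum]
  · simp_rw [net.lintegral_link_mul_expNeg a i co s hψ]
    rw [ENNReal.tsum_prod', tsum_fintype]
    refine Finset.sum_congr rfl fun j _ => ?_
    rw [Summable.tsum_finsetSum fun _ _ => ENNReal.summable]
    refine Finset.sum_congr rfl fun c _ => ?_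
    have hl : Measurable fun x : Plane => (j, c, siteDist p i j x) :=
      measurable_const.prodMk (measurable_const.prodMk (measurable_siteDist p i j))
    refine net.mecke_layers j
      (F := fun x => channelProb p i j c x * ψ (j, c, siteDist p i j x))
      ((measurable_channelProb p i j c).mul (hψ.comp hl))
      (U := fun x k y => avgCost p a i co s (linkMetric p a (j, c, siteDist p i j x)) k y)
      fun k => ?_
    exact (measurable_avgCost p a i co s k).comp (f := fun q : Plane × Plane =>
      (linkMetric p a (j, c, siteDist p i j q.1), q.2))
      (((measurable_linkMetric p a).comp (hl.comp measurable_fst)).prodMk measurable_snd)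
  · intro v
    have hl : Measurable fun ω => (v.1, net.channel i v ω, net.linkDist i v ω) :=
      measurable_const.prodMk ((net.measurable_channel i v).prodMk (net.measurable_linkDist i v))
    refine (Measurable.ite (hact v) ((hψ.comp hl).mul (measurable_expNeg.comp
      (Measurable.tsum fun w => Measurable.ite ((hact w).inter (MeasurableSet.const _)) ?_
        measurable_const))) measurable_const).aemeasurable
    exact (measurable_cost p a i co s w.1).comp (f := fun ω =>
      (linkMetric p a (v.1, net.channel i v ω, net.linkDist i v ω), net.loc w.1 w.2 ω,
        net.unif w ω, net.gain (co, w) ω))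
      (((measurable_linkMetric p a).comp hl).prodMk ((hloc w).prodMk
        ((net.unif_measurable w).prodMk (net.gain_measurable _))))

/-- Given the main link, the interference has the Laplace transform of the interference from a
Poisson process outside the exclusion region. -/
theorem lintegral_mainLink_mul_expNeg_eq [IsProbabilityMeasure μ] (a : Criterion)
    (i : Fin (K + 1)) {co : Channel} (hm : p.m co = 1) {s : ℝ} (hs : 0 ≤ s)
    {ψ : Fin (K + 1) × Channel × ℝ → ℝ≥0∞} (hψ : Measurable ψ)
    (hψ0 : ∀ e, e.2.2 ≤ 0 → ψ e = 0) :
    ∫⁻ ω, ψ (net.mainLink a i ω) *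
        expNeg (∑' v, ENNReal.ofReal (s * net.interferenceTerm a i i co ω v)) ∂μ =
      ∫⁻ ω, ψ (net.mainLink a i ω) * expNeg (∫⁻ y, avgLoss p a i co s
        (linkMetric p a (net.mainLink a i ω)) y ∂(layerIntensity p i)) ∂μ := by
  have hD : Measurable fun e => expNeg (∫⁻ y, avgLoss p a i co s (linkMetric p a e) y
      ∂(layerIntensity p i)) :=
    measurable_expNeg.comp (((measurable_avgLoss p a i co s).lintegral_prod_right'
      (ν := layerIntensity p i)).comp (measurable_linkMetric p a))
  -- The same formula at `s = 0`, where no interference is left, for the test function `ψ e^(-D)`.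
  -- Its right side is the one at `s` for `ψ`.
  have h0 := net.lintegral_mainLink_mul_expNeg a i co 0 (hψ.mul hD)
    (fun e he => by simp [hψ0 e he])
  simp only [zero_mul, ENNReal.ofReal_zero, tsum_zero, expNeg_zero, mul_one, Pi.mul_apply] at h0
  rw [h0, net.lintegral_mainLink_mul_expNeg a i co s hψ hψ0]
  refine Finset.sum_congr rfl fun j _ => Finset.sum_congr rfl fun c _ => lintegral_congr fun x => ?_
  rw [sum_lintegral_one_sub_expNeg_avgCost p a i hm hs, expNeg_add]
  ring

end Network

/-! ### Series expansion of the radial integral. -/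

section Series

/-- The radial integrand of the exponent of the Laplace transform (`w = s P`), when links of length
`r` are in the given environment with probability `q r`. -/
def radialLoss (w α : ℝ) (q : ℝ → ℝ) (r : ℝ) : ℝ := r * (q r * (1 - 1 / (1 + w * r ^ (-α))))

variable {α χ w : ℝ} {q : ℝ → ℝ}

theorem one_sub_one_div_mem {x : ℝ} (hx : 0 ≤ x) :
    0 ≤ 1 - 1 / (1 + x) ∧ 1 - 1 / (1 + x) ≤ x := by
  have h1 : 1 - 1 / (1 + x) = x / (1 + x) := by
    field_simp
    ring
  rw [h1]
  exact ⟨by positivity, div_le_self hx (by linarith)⟩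

theorem radialLoss_nonneg {r : ℝ} (hr : 0 ≤ r) (hw : 0 ≤ w) (hq : 0 ≤ q r) :
    0 ≤ radialLoss w α q r :=
  mul_nonneg hr (mul_nonneg hq (one_sub_one_div_mem (mul_nonneg hw (Real.rpow_nonneg hr _))).1)

theorem radialLoss_le {r : ℝ} (hr : 0 < r) (hw : 0 ≤ w) (hq : 0 ≤ q r) :
    radialLoss w α q r ≤ w * (r ^ (1 - α) * q r) := by
  have h1 := (one_sub_one_div_mem (mul_nonneg hw (Real.rpow_nonneg hr.le (-α)))).2
  have h2 : r ^ (1 - α) = r * r ^ (-α) := by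
    rw [sub_eq_add_neg, Real.rpow_add hr, Real.rpow_one]
  calc radialLoss w α q r ≤ r * (q r * (w * r ^ (-α))) := by
        unfold radialLoss
        gcongr
    _ = _ := by rw [h2]; ring

theorem measurable_radialLoss (hq : Measurable q) : Measurable (radialLoss w α q) := by
  unfold radialLoss
  fun_prop

theorem integrableOn_radialLoss (hχ : 0 < χ) (hw : 0 ≤ w) (hq : Measurable q)
    (hq0 : ∀ r, 0 ≤ r → 0 ≤ q r) (hint : IntegrableOn (fun r => r ^ (1 - α) * q r) (Set.Ioi χ)) :
    IntegrableOn (radialLoss w α q) (Set.Ioi χ) := by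
  refine Integrable.mono' (hint.const_mul w) (measurable_radialLoss hq).aestronglyMeasurable ?_
  refine (ae_restrict_iff' measurableSet_Ioi).2 (ae_of_all _ fun r hr => ?_)
  have hr0 : 0 < r := hχ.trans hr
  rw [Real.norm_of_nonneg (radialLoss_nonneg hr0.le hw (hq0 r hr0.le))]
  exact radialLoss_le hr0 hw (hq0 r hr0.le)

theorem rpow_one_sub_succ_mul {r : ℝ} (hr : 0 < r) (n : ℕ) :
    r ^ (1 - ((n + 1 : ℕ) : ℝ) * α) = r ^ (1 - α) * (r ^ (-α)) ^ n := by
  rw [← Real.rpow_natCast (r ^ (-α)), ← Real.rpow_mul hr.le, ← Real.rpow_add hr]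
  congr 1
  push_cast
  ring

/-- On `(χ, ∞)` each further factor `r^(-α)` is at most `χ^(-α)`, so the moments are dominated by a
geometric sequence. -/
theorem integrableOn_moment (hχ : 0 < χ) (hα : 0 ≤ α) (hq : Measurable q)
    (hq0 : ∀ r, 0 ≤ r → 0 ≤ q r) (hint : IntegrableOn (fun r => r ^ (1 - α) * q r) (Set.Ioi χ))
    (n : ℕ) : IntegrableOn (fun r => r ^ (1 - ((n + 1 : ℕ) : ℝ) * α) * q r) (Set.Ioi χ) ∧
      ∫ r in Set.Ioi χ, r ^ (1 - ((n + 1 : ℕ) : ℝ) * α) * q r ≤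
        (χ ^ (-α)) ^ n * ∫ r in Set.Ioi χ, r ^ (1 - α) * q r := by
  have hle : ∀ r ∈ Set.Ioi χ, 0 ≤ r ^ (1 - ((n + 1 : ℕ) : ℝ) * α) * q r ∧
      r ^ (1 - ((n + 1 : ℕ) : ℝ) * α) * q r ≤ (χ ^ (-α)) ^ n * (r ^ (1 - α) * q r) := by
    intro r hr
    have hr0 : 0 < r := hχ.trans hr
    have hqr := hq0 r hr0.le
    refine ⟨by positivity, ?_⟩
    rw [rpow_one_sub_succ_mul hr0]
    have h1 : r ^ (-α) ≤ χ ^ (-α) :=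
      Real.rpow_le_rpow_of_nonpos hχ (le_of_lt hr) (by linarith)
    have h2 : (r ^ (-α)) ^ n ≤ (χ ^ (-α)) ^ n := by gcongr
    calc r ^ (1 - α) * (r ^ (-α)) ^ n * q r = (r ^ (-α)) ^ n * (r ^ (1 - α) * q r) := by ring
      _ ≤ _ := by gcongr
  have hI : IntegrableOn (fun r => r ^ (1 - ((n + 1 : ℕ) : ℝ) * α) * q r) (Set.Ioi χ) := by
    refine Integrable.mono' (hint.const_mul ((χ ^ (-α)) ^ n))
      (Measurable.aestronglyMeasurable (by fun_prop)) ?_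
    refine (ae_restrict_iff' measurableSet_Ioi).2 (ae_of_all _ fun r hr => ?_)
    rw [Real.norm_of_nonneg (hle r hr).1]
    exact (hle r hr).2
  refine ⟨hI, ?_⟩
  rw [← integral_const_mul]
  exact setIntegral_mono_on hI (hint.const_mul _) measurableSet_Ioi fun r hr => (hle r hr).2

/-- Expansion of the exponent of the Laplace transform in powers of `w`. -/
theorem hasSum_moments (hχ : 0 < χ) (hα : 0 ≤ α) (hw : 0 ≤ w) (hwχ : w * χ ^ (-α) < 1)
    (hq : Measurable q) (hq0 : ∀ r, 0 ≤ r → 0 ≤ q r)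
    (hint : IntegrableOn (fun r => r ^ (1 - α) * q r) (Set.Ioi χ)) :
    HasSum (fun n : ℕ => (-w) ^ (n + 1) *
        ∫ r in Set.Ioi χ, r ^ (1 - ((n + 1 : ℕ) : ℝ) * α) * q r)
      (-∫ r in Set.Ioi χ, radialLoss w α q r) := by
  have hmom := fun n => integrableOn_moment hχ hα hq hq0 hint n
  have hχα : 0 ≤ χ ^ (-α) := Real.rpow_nonneg hχ.le _
  have h1 := hasSum_integral_of_summable_integral_norm
    (F := fun (n : ℕ) r => (-w) ^ (n + 1) * (r ^ (1 - ((n + 1 : ℕ) : ℝ) * α) * q r))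
    (fun n => (hmom n).1.const_mul ((-w) ^ (n + 1))) ?_
  · simp_rw [integral_const_mul] at h1
    have e0 : ∫ r in Set.Ioi χ, ∑' n : ℕ,
        (-w) ^ (n + 1) * (r ^ (1 - ((n + 1 : ℕ) : ℝ) * α) * q r) =
        -∫ r in Set.Ioi χ, radialLoss w α q r := ?_
    · rwa [e0] at h1
    rw [← integral_neg]
    refine setIntegral_congr_fun measurableSet_Ioi fun r hr => ?_
    have hr0 : 0 < r := hχ.trans hr
    have hx0 : 0 ≤ w * r ^ (-α) := mul_nonneg hw (Real.rpow_nonneg hr0.le _)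
    have hx1 : w * r ^ (-α) < 1 := by
      refine lt_of_le_of_lt ?_ hwχ
      gcongr ?_ * ?_
      exact Real.rpow_le_rpow_of_nonpos hχ (le_of_lt hr) (by linarith)
    -- With `x = w r^(-α) < 1`, `-(1 - 1/(1 + x)) = ∑ (-x)^(n + 1)` over `n ≥ 0`: the constant term
    -- cancels, which is why the series is indexed by `n + 1`.
    have hg := (hasSum_geometric_of_abs_lt_one (r := -(w * r ^ (-α)))
      (by rw [abs_neg, abs_of_nonneg hx0]; exact hx1)).mul_left (-(w * (r ^ (1 - α) * q r)))
    have hterm : (fun n : ℕ => (-w) ^ (n + 1) * (r ^ (1 - ((n + 1 : ℕ) : ℝ) * α) * q r)) =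
        fun n => -(w * (r ^ (1 - α) * q r)) * (-(w * r ^ (-α))) ^ n := by
      funext n
      rw [rpow_one_sub_succ_mul hr0, ← neg_mul w (r ^ (-α)), mul_pow, pow_succ]
      ring
    simp only [hterm]
    rw [hg.tsum_eq]
    have h2 : r ^ (1 - α) = r * r ^ (-α) := by
      rw [sub_eq_add_neg, Real.rpow_add hr0, Real.rpow_one]
    have h3 : 1 + w * r ^ (-α) ≠ 0 := by positivity
    unfold radialLoss
    rw [h2, sub_neg_eq_add]
    field_simp
    ring
  · have hnorm : ∀ n : ℕ, ∫ r in Set.Ioi χ,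
        ‖(-w) ^ (n + 1) * (r ^ (1 - ((n + 1 : ℕ) : ℝ) * α) * q r)‖ ≤
        (w * ∫ r in Set.Ioi χ, r ^ (1 - α) * q r) * (w * χ ^ (-α)) ^ n := by
      intro n
      have : ∫ r in Set.Ioi χ, ‖(-w) ^ (n + 1) * (r ^ (1 - ((n + 1 : ℕ) : ℝ) * α) * q r)‖ =
          w ^ (n + 1) * ∫ r in Set.Ioi χ, r ^ (1 - ((n + 1 : ℕ) : ℝ) * α) * q r := by
        rw [← integral_const_mul]
        refine setIntegral_congr_fun measurableSet_Ioi fun r hr => ?_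
        have hr0 : 0 < r := hχ.trans hr
        have hqr := hq0 r hr0.le
        simp only [norm_mul, norm_pow, norm_neg, Real.norm_of_nonneg hw]
        rw [Real.norm_of_nonneg (Real.rpow_nonneg hr0.le _), Real.norm_of_nonneg hqr]
      rw [this]
      calc _ ≤ w ^ (n + 1) * ((χ ^ (-α)) ^ n * ∫ r in Set.Ioi χ, r ^ (1 - α) * q r) :=
            mul_le_mul_of_nonneg_left (hmom n).2 (by positivity)
        _ = _ := by rw [mul_pow]; ring
    exact Summable.of_nonneg_of_le (fun n => integral_nonneg fun r => norm_nonneg _) hnorm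
      ((summable_geometric_of_lt_one (by positivity) hwχ).mul_left _)

/-- The exponential supplies the decay and the power is merely bounded by its value at `χ`; hence
line of sight does not require `α > 2`. -/
theorem integrableOn_rpow_mul_exp (hχ : 0 < χ) (hα : 1 ≤ α) {η : ℝ} (hη : 0 < η) :
    IntegrableOn (fun r => r ^ (1 - α) * Real.exp (-(η * r))) (Set.Ioi χ) := by
  have h1 : IntegrableOn (fun r : ℝ => Real.exp (-(η * r))) (Set.Ioi χ) := by
    simpa using exp_neg_integrableOn_Ioi χ hη
  refine Integrable.mono' (h1.const_mul (χ ^ (1 - α)))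
    (Measurable.aestronglyMeasurable (by fun_prop)) ?_
  refine (ae_restrict_iff' measurableSet_Ioi).2 (ae_of_all _ fun r hr => ?_)
  have hr0 : 0 < r := hχ.trans hr
  rw [Real.norm_of_nonneg (by positivity)]
  gcongr ?_ * _
  exact Real.rpow_le_rpow_of_nonpos hχ (le_of_lt hr) (by linarith)

/-- Moments of the exponential line-of-sight probability. -/
theorem integral_rpow_mul_exp (hχ : 0 < χ) {η : ℝ} (hη : 0 < η) (b : ℝ) :
    ∫ r in Set.Ioi χ, r ^ (1 - b) * Real.exp (-(η * r)) =
      η ^ (b - 2) * upperGamma (2 - b) (η * χ) := by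
  have h1 := integral_comp_mul_left_Ioi (fun t : ℝ => t ^ (2 - b - 1) * Real.exp (-t)) χ hη
  unfold upperGamma
  rw [smul_eq_mul] at h1
  have h2 : ∫ t in Set.Ioi (η * χ), t ^ (2 - b - 1) * Real.exp (-t) =
      η * ∫ r in Set.Ioi χ, (η * r) ^ (2 - b - 1) * Real.exp (-(η * r)) := by
    rw [h1]
    field_simp
  rw [h2, ← integral_const_mul, ← integral_const_mul]
  refine setIntegral_congr_fun measurableSet_Ioi fun r hr => ?_
  have hr0 : 0 < r := hχ.trans hr
  -- The powers of `η` produced by the substitution `t = η r` cancel: `(b - 2) + 1 + (1 - b) = 0`.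
  have h3 : η ^ (b - 2) * (η * η ^ (2 - b - 1)) = 1 := by
    nth_rewrite 2 [← Real.rpow_one η]
    rw [← Real.rpow_add hη, ← Real.rpow_add hη]
    ring_nf
    simp
  rw [Real.mul_rpow hη.le hr0.le]
  calc r ^ (1 - b) * Real.exp (-(η * r)) =
        (η ^ (b - 2) * (η * η ^ (2 - b - 1))) * (r ^ (1 - b) * Real.exp (-(η * r))) := by
        rw [h3, one_mul]
    _ = _ := by
        have : 2 - b - 1 = 1 - b := by ring
        rw [this]
        ring

theorem hasSum_losTerm (hχ : 0 < χ) (hα : 2 ≤ α) {η : ℝ} (hη : 0 < η) (hw : 0 ≤ w)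
    (hwχ : w * χ ^ (-α) < 1) :
    HasSum (fun n : ℕ => losTerm w α η χ (n + 1))
      (-∫ r in Set.Ioi χ, radialLoss w α (fun r => Real.exp (-(η * r))) r) := by
  have h1 := hasSum_moments hχ (by linarith) hw hwχ (q := fun r => Real.exp (-(η * r)))
    (by fun_prop) (fun r _ => (Real.exp_pos _).le)
    (integrableOn_rpow_mul_exp hχ (by linarith) hη)
  simp_rw [integral_rpow_mul_exp hχ hη] at h1
  exact h1

theorem one_sub_exp_nonneg {η r : ℝ} (hη : 0 < η) (hr : 0 ≤ r) : 0 ≤ 1 - Real.exp (-(η * r)) := by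
  have : Real.exp (-(η * r)) ≤ 1 := Real.exp_le_one_iff.2 (by nlinarith)
  linarith

/-- The factor `1 - e^(-ηr)` tends to `1`, so `r^(1 - α)` itself must be integrable at infinity;
this is where `α > 2` enters. -/
theorem integrableOn_rpow_mul_one_sub_exp (hχ : 0 < χ) (hα : 2 < α) {η : ℝ} (hη : 0 < η) :
    IntegrableOn (fun r => r ^ (1 - α) * (1 - Real.exp (-(η * r)))) (Set.Ioi χ) := by
  have h0 : IntegrableOn (fun r : ℝ => r ^ (1 - α)) (Set.Ioi χ) :=
    integrableOn_Ioi_rpow_of_lt (by linarith) hχ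
  have h1 := h0.sub (integrableOn_rpow_mul_exp (α := α) hχ (by linarith) hη)
  refine h1.congr (ae_of_all _ fun r => ?_)
  simp only [Pi.sub_apply]
  ring

/-- Since `(n + 1) α > 2`, each moment splits into two convergent integrals: that of a pure power,
`χ^(2 - b) / (b - 2)` with `b = (n + 1) α`, minus the line-of-sight moment. -/
theorem hasSum_nlosTerm (hχ : 0 < χ) (hα : 2 < α) {η : ℝ} (hη : 0 < η) (hw : 0 ≤ w)
    (hwχ : w * χ ^ (-α) < 1) :
    HasSum (fun n : ℕ => nlosTerm w α η χ (n + 1))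
      (-∫ r in Set.Ioi χ, radialLoss w α (fun r => 1 - Real.exp (-(η * r))) r) := by
  have h1 := hasSum_moments hχ (by linarith) hw hwχ (q := fun r => 1 - Real.exp (-(η * r)))
    (by fun_prop) (fun r hr => one_sub_exp_nonneg hη hr)
    (integrableOn_rpow_mul_one_sub_exp hχ hα hη)
  convert h1 using 2 with n
  unfold nlosTerm
  congr 1
  set b : ℝ := ((n + 1 : ℕ) : ℝ) * α with hb
  have hb2 : 2 < b := by
    have : (1 : ℝ) ≤ ((n + 1 : ℕ) : ℝ) := by
      push_cast
      linarith [(Nat.cast_nonneg n : (0 : ℝ) ≤ n)]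
    rw [hb]
    nlinarith
  have e1 : ∫ r in Set.Ioi χ, r ^ (1 - b) * (1 - Real.exp (-(η * r))) =
      (∫ r in Set.Ioi χ, r ^ (1 - b)) - ∫ r in Set.Ioi χ, r ^ (1 - b) * Real.exp (-(η * r)) := by
    rw [← integral_sub (integrableOn_Ioi_rpow_of_lt (by linarith) hχ)
      (integrableOn_rpow_mul_exp (α := b) hχ (by linarith) hη)]
    refine integral_congr_ae (ae_of_all _ fun r => ?_)
    simp only
    ring
  rw [e1, integral_rpow_mul_exp hχ hη, integral_Ioi_rpow_of_lt (by linarith) hχ]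
  congr 1
  have e2 : 1 - b + 1 = -(b - 2) := by ring
  have e3 : 2 - b = -(b - 2) := by ring
  rw [e2, e3, div_neg, neg_div, neg_neg]

/-- The exponent of the Laplace transform is continuous in the transform variable. -/
theorem continuous_integral_radialLoss (hχ : 0 < χ) {P : ℝ} (hP : 0 ≤ P) (hq : Measurable q)
    (hq0 : ∀ r, 0 ≤ r → 0 ≤ q r) (hint : IntegrableOn (fun r => r ^ (1 - α) * q r) (Set.Ioi χ)) :
    Continuous fun s : ℝ => ∫ r in Set.Ioi χ, radialLoss (|s| * P) α q r := by
  refine continuous_iff_continuousAt.2 fun s₀ => ?_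
  refine continuousAt_of_dominated
    (bound := fun r => ((|s₀| + 1) * P) * (r ^ (1 - α) * q r))
    (Eventually.of_forall fun s => (measurable_radialLoss hq).aestronglyMeasurable) ?_
    (hint.const_mul _) ?_
  · have : ∀ᶠ s in 𝓝 s₀, |s| < |s₀| + 1 :=
      continuous_abs.continuousAt.eventually_lt continuousAt_const (by linarith)
    filter_upwards [this] with s hs
    refine (ae_restrict_iff' measurableSet_Ioi).2 (ae_of_all _ fun r hr => ?_)
    have hr0 : 0 < r := hχ.trans hr
    have hqr := hq0 r hr0.le
    rw [Real.norm_of_nonneg (radialLoss_nonneg hr0.le (by positivity) hqr)]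
    refine (radialLoss_le hr0 (by positivity) hqr).trans ?_
    gcongr
  · refine (ae_restrict_iff' measurableSet_Ioi).2 (ae_of_all _ fun r hr => ?_)
    have hr0 : 0 < r := hχ.trans hr
    unfold radialLoss
    have h3 : 1 + |s₀| * P * r ^ (-α) ≠ 0 := by positivity
    fun_prop (disch := exact h3)

end Series

/-! ### The exclusion distance and polar coordinates. -/

section Radial

variable {K : ℕ} (p : Params K)

theorem siteDist_self (i : Fin (K + 1)) (z : Plane) : siteDist p i i z = ‖z‖ := by
  simp [siteDist]

/-- The metric decreases in the length of the link, and the exclusion distance is the length at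
which it equals that of the main link. Lengths must be positive because `0⁻¹ = 0` would give a link
of length `0` the smallest metric. -/
theorem linkMetric_lt_iff (a : Criterion) (i : Fin (K + 1)) (co : Channel)
    (e : Fin (K + 1) × Channel × ℝ) (he : 0 < e.2.2) {r : ℝ} (hr : 0 < r) :
    linkMetric p a (i, co, r) < linkMetric p a e ↔ exclusionDist p a i co e < r := by
  obtain ⟨j, c, y⟩ := e
  have hBi := p.B_pos i
  have hBj := p.B_pos j
  have hα : 0 < p.alpha co := by linarith [p.two_le_alpha co]
  change 0 < y at he
  cases a
  · change p.B i * r⁻¹ < p.B j * y⁻¹ ↔ y * p.B i / p.B j < r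
    rw [← div_eq_mul_inv, ← div_eq_mul_inv, div_lt_div_iff₀ hr he, div_lt_iff₀ hBj]
    constructor <;> intro h <;> linarith
  · change p.B i * r ^ (-p.alpha co) < p.B j * y ^ (-p.alpha c) ↔
      (y ^ p.alpha c * p.B i / p.B j) ^ (1 / p.alpha co) < r
    have hy := Real.rpow_pos_of_pos he (p.alpha c)
    have hrα := Real.rpow_pos_of_pos hr (p.alpha co)
    have h1 : (y ^ p.alpha c * p.B i / p.B j) ^ (1 / p.alpha co) < r ↔
        y ^ p.alpha c * p.B i / p.B j < r ^ p.alpha co := by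
      rw [one_div, Real.rpow_inv_lt_iff_of_pos (by positivity) hr.le hα]
    rw [h1, Real.rpow_neg hr.le, Real.rpow_neg he.le, ← div_eq_mul_inv, ← div_eq_mul_inv,
      div_lt_div_iff₀ hrα hy, div_lt_iff₀ hBj]
    constructor <;> intro h <;> linarith

theorem exclusionDist_pos (a : Criterion) (i : Fin (K + 1)) (co : Channel)
    (e : Fin (K + 1) × Channel × ℝ) (he : 0 < e.2.2) : 0 < exclusionDist p a i co e := by
  have hBi := p.B_pos i
  have hBj := p.B_pos e.1
  cases a <;> unfold exclusionDist <;> positivity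

/-- Polar coordinates in the plane, for a function supported outside a disc. -/
theorem lintegral_ofReal_norm {χ : ℝ} (hχ : 0 ≤ χ) {g : ℝ → ℝ} (hg0 : ∀ r ∈ Set.Ioi χ, 0 ≤ g r)
    (hint : IntegrableOn (fun r => r * g r) (Set.Ioi χ)) :
    ∫⁻ z : Plane, ENNReal.ofReal ((Set.Ioi χ).indicator g ‖z‖) =
      ENNReal.ofReal (2 * Real.pi * ∫ r in Set.Ioi χ, r * g r) := by
  have hfun : (fun r : ℝ => r ^ (Module.finrank ℝ Plane - 1) • (Set.Ioi χ).indicator g r) =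
      (Set.Ioi χ).indicator fun r => r * g r := by
    funext r
    by_cases hr : r ∈ Set.Ioi χ <;> simp [hr]
  have hI : Integrable (fun z : Plane => (Set.Ioi χ).indicator g ‖z‖) := by
    rw [integrable_fun_norm_addHaar, hfun]
    exact ((integrable_indicator_iff measurableSet_Ioi).2 hint).integrableOn
  rw [← ofReal_integral_eq_lintegral_ofReal hI
    (ae_of_all _ fun z => Set.indicator_nonneg hg0 _), integral_fun_norm_addHaar, hfun,
    setIntegral_indicator measurableSet_Ioi, Set.inter_eq_self_of_subset_right
      (Set.Ioi_subset_Ioi hχ)]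
  congr 1
  -- The constant `2π` is the dimension `2` times the area `π` of the unit disc.
  simp [measureReal_def, mul_assoc]
  exact Or.inl Real.pi_pos.le

/-- Within one layer there is no altitude difference, so the link length is `‖y‖` and the loss is a
radial function supported outside the disc of radius `χ`. -/
theorem lintegral_avgLoss (a : Criterion) (i : Fin (K + 1)) (co : Channel) {q : ℝ → ℝ}
    (hq : Measurable q) (hq0 : ∀ r, 0 ≤ r → 0 ≤ q r)
    (hprob : ∀ z, channelProb p i i co z = ENNReal.ofReal (q ‖z‖))
    (hint : ∀ χ, 0 < χ → IntegrableOn (fun r => r ^ (1 - p.alpha co) * q r) (Set.Ioi χ))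
    (e : Fin (K + 1) × Channel × ℝ) (he : 0 < e.2.2) {s : ℝ} (hs : 0 ≤ s) :
    ∫⁻ y, avgLoss p a i co s (linkMetric p a e) y ∂(layerIntensity p i) =
      ENNReal.ofReal (2 * Real.pi * p.lam i *
        ∫ r in Set.Ioi (exclusionDist p a i co e), radialLoss (s * p.P i) (p.alpha co) q r) := by
  set χ := exclusionDist p a i co e with hχ
  have hχ0 : 0 < χ := exclusionDist_pos p a i co e he
  have hsP : 0 ≤ s * p.P i := mul_nonneg hs (p.P_pos i).le
  have h1 : ∀ᵐ y : Plane, avgLoss p a i co s (linkMetric p a e) y =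
      ENNReal.ofReal ((Set.Ioi χ).indicator
        (fun r => q r * (1 - 1 / (1 + s * p.P i * r ^ (-p.alpha co)))) ‖y‖) := by
    -- At the origin the comparison of metrics with `χ` fails, but a single point has measure zero.
    have hne : ∀ᵐ y : Plane, y ≠ 0 := by
      rw [ae_iff]
      simp
    filter_upwards [hne] with y hy
    have hy0 : 0 < ‖y‖ := norm_pos_iff.2 hy
    unfold avgLoss
    rw [siteDist_self]
    by_cases h : χ < ‖y‖
    · rw [if_pos ((linkMetric_lt_iff p a i co e he hy0).2 h),
        Set.indicator_of_mem (show ‖y‖ ∈ Set.Ioi χ from h), hprob,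
        ← ENNReal.ofReal_mul (hq0 _ hy0.le), mul_assoc s]
    · rw [if_neg fun hc => h ((linkMetric_lt_iff p a i co e he hy0).1 hc),
        Set.indicator_of_notMem (show ‖y‖ ∉ Set.Ioi χ from h)]
      simp
  rw [lintegral_smul_measure, lintegral_congr_ae h1, lintegral_ofReal_norm hχ0.le,
    smul_eq_mul, ← ENNReal.ofReal_mul (p.lam_nonneg i)]
  · congr 1
    unfold radialLoss
    ring
  · intro r hr
    have hr0 : 0 < r := hχ0.trans hr
    exact mul_nonneg (hq0 r hr0.le)
      (one_sub_one_div_mem (mul_nonneg hsP (Real.rpow_nonneg hr0.le _))).1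
  · exact integrableOn_radialLoss hχ0 hsP hq hq0 (hint χ hχ0)

/-- Multiplying the density of the exponential distribution by `g` gives the Gamma density of shape
`2`, as `Γ(2) = 1`. -/
theorem lintegral_ofReal_gammaMeasure :
    ∫⁻ g, ENNReal.ofReal g ∂(gammaMeasure 1 1) = 1 := by
  have h1 : ∀ g : ℝ, gammaPDF 1 1 g * ENNReal.ofReal g = gammaPDF 2 1 g := by
    intro g
    by_cases hg : 0 ≤ g
    · rw [gammaPDF_of_nonneg hg, gammaPDF_of_nonneg hg,
        ← ENNReal.ofReal_mul (by simp; positivity)]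
      congr 1
      have h2 : (2 : ℝ) - 1 = 1 := by norm_num
      simp [h2, mul_comm]
    · rw [gammaPDF_of_neg (not_le.1 hg), gammaPDF_of_neg (not_le.1 hg)]
      simp
  have hm : Measurable (gammaPDF 1 1) := (measurable_gammaPDFReal 1 1).ennreal_ofReal
  rw [gammaMeasure, lintegral_withDensity_eq_lintegral_mul _ hm (by fun_prop)]
  simp only [Pi.mul_apply, h1]
  exact lintegral_gammaPDF_eq_one two_pos one_pos

end Radial

/-! ### Almost sure convergence of the interference. -/

namespace Network

variable {K : ℕ} {p : Params K} {Ω : Type*} [MeasurableSpace Ω] {μ : Measure Ω}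
  (net : Network p μ)
include net

theorem ae_gain_nonneg : ∀ᵐ ω ∂μ, ∀ w, 0 ≤ net.gain w ω := by
  refine ae_all_iff.2 fun w => ?_
  have h1 : ∀ᵐ g ∂(μ.map (net.gain w)), 0 ≤ g := by
    rw [net.gain_law, ae_iff]
    simp only [not_le]
    change gammaMeasure _ _ (Set.Iio 0) = 0
    rw [gammaMeasure, withDensity_apply _ measurableSet_Iio]
    exact lintegral_gammaPDF_of_nonpos le_rfl
  exact ae_of_ae_map (net.gain_measurable w).aemeasurable h1

theorem interferenceTerm_nonneg (a : Criterion) (i k : Fin (K + 1)) (co : Channel) {ω : Ω}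
    (hω : ∀ w, 0 ≤ net.gain w ω) (v : Fin (K + 1) × ℕ) :
    0 ≤ net.interferenceTerm a i k co ω v := by
  unfold interferenceTerm
  split_ifs
  · exact mul_nonneg (mul_nonneg (p.P_pos k).le (hω _))
      (Real.rpow_nonneg (Real.sqrt_nonneg _) _)
  · exact le_rfl

open Classical in
/-- Campbell's formula for the distant part of the same-layer interference. -/
theorem lintegral_distant_interference [IsProbabilityMeasure μ] (i : Fin (K + 1)) {co : Channel}
    (hm : p.m co = 1) :
    ∫⁻ ω, ∑' n : ℕ, (if net.Active (i, n) ω ∧ 1 < ‖net.loc i n ω‖ ∧ net.channel i (i, n) ω = co then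
        ENNReal.ofReal (p.P i * net.gain (co, (i, n)) ω * net.linkDist i (i, n) ω ^ (-p.alpha co))
        else 0) ∂μ =
      ∫⁻ z, (if 1 < ‖z‖ then channelProb p i i co z *
        ENNReal.ofReal (p.P i * ‖z‖ ^ (-p.alpha co)) else 0) ∂(layerIntensity p i) := by
  have hchm := measurable_siteChannel p i i
  obtain ⟨f, hf⟩ : ∃ f : Plane → ℝ → ℝ → ℝ≥0∞, f = fun z u g =>
      if 1 < ‖z‖ ∧ siteChannel p i i z u = co then
        ENNReal.ofReal (p.P i * g * siteDist p i i z ^ (-p.alpha co)) else 0 := ⟨_, rfl⟩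
  have hfm : Measurable fun q : Plane × ℝ × ℝ => f q.1 q.2.1 q.2.2 := by
    have hd : Measurable fun q : Plane × ℝ × ℝ => siteDist p i i q.1 :=
      (measurable_siteDist p i i).comp measurable_fst
    have hc : Measurable fun q : Plane × ℝ × ℝ => siteChannel p i i q.1 q.2.1 :=
      hchm.comp (f := fun q : Plane × ℝ × ℝ => (q.1, q.2.1)) (by fun_prop)
    have hn : Measurable fun q : Plane × ℝ × ℝ => ‖q.1‖ := by fun_prop
    rw [hf]
    refine Measurable.ite ((measurableSet_lt measurable_const hn).inter
      (hc (MeasurableSet.of_discrete (s := {co})))) (by fun_prop) measurable_const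
  set F : Plane → ℝ≥0∞ := fun z => if 1 < ‖z‖ then channelProb p i i co z *
        ENNReal.ofReal (p.P i * ‖z‖ ^ (-p.alpha co)) else 0 with hF
  have hFm : Measurable F := by
    refine Measurable.ite (measurableSet_lt measurable_const measurable_norm)
      ((measurable_channelProb p i i co).mul (by fun_prop)) measurable_const
  have hmean : ∀ z, markMean p co (f z) = F z := by
    intro z
    unfold markMean
    simp only [hf, hF, channelProb, hm]
    have hint : ∀ u, ∫⁻ g, (if 1 < ‖z‖ ∧ siteChannel p i i z u = co then
        ENNReal.ofReal (p.P i * g * siteDist p i i z ^ (-p.alpha co)) else 0) ∂(gammaMeasure 1 1) =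
        if 1 < ‖z‖ then (if siteChannel p i i z u = co then 1 else 0) *
          ENNReal.ofReal (p.P i * ‖z‖ ^ (-p.alpha co)) else 0 := by
      intro u
      by_cases h1 : 1 < ‖z‖ <;> by_cases h2 : siteChannel p i i z u = co <;> simp [h1, h2]
      rw [siteDist_self]
      have hc : 0 ≤ p.P i * ‖z‖ ^ (-p.alpha co) :=
        mul_nonneg (p.P_pos i).le (Real.rpow_nonneg (norm_nonneg _) _)
      have h3 : ∀ g : ℝ, ENNReal.ofReal (p.P i * g * ‖z‖ ^ (-p.alpha co)) =
          ENNReal.ofReal (p.P i * ‖z‖ ^ (-p.alpha co)) * ENNReal.ofReal g := by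
        intro g
        rw [← ENNReal.ofReal_mul hc]
        ring_nf
      simp_rw [h3]
      rw [lintegral_const_mul _ (by fun_prop), lintegral_ofReal_gammaMeasure, mul_one]
    simp_rw [hint]
    by_cases h1 : 1 < ‖z‖
    · simp only [h1, if_true]
      rw [lintegral_mul_const]
      exact Measurable.ite ((hchm.comp (f := fun u : ℝ => (z, u)) (by fun_prop))
        (MeasurableSet.of_discrete (s := {co}))) measurable_const measurable_const
    · simp [h1]
  have hterm : ∀ n : ℕ, ∫⁻ ω, (if net.Active (i, n) ω ∧ 1 < ‖net.loc i n ω‖ ∧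
        net.channel i (i, n) ω = co then
        ENNReal.ofReal (p.P i * net.gain (co, (i, n)) ω * net.linkDist i (i, n) ω ^ (-p.alpha co))
        else 0) ∂μ = ∫⁻ ω, (if (n : ℕ∞) < net.num i ω then F (net.loc i n ω) else 0) ∂μ := by
    intro n
    obtain ⟨H, hH⟩ : ∃ H : LocData K → MarkData K → ℝ≥0∞, H = fun q r =>
      if (n : ℕ∞) < (q i).1 then f ((q i).2 n) (r.1 (i, n)) (r.2 (co, (i, n))) else 0 := ⟨_, rfl⟩
    have hHm : Measurable (Function.uncurry H) := by
      rw [hH]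
      have h1 : Measurable fun x : LocData K × MarkData K => (x.1 i).1 := by fun_prop
      refine Measurable.ite (h1 (MeasurableSet.of_discrete (s := Set.Ioi (n : ℕ∞)))) ?_
        measurable_const
      exact hfm.comp (f := fun x : LocData K × MarkData K =>
        ((x.1 i).2 n, x.2.1 (i, n), x.2.2 (co, (i, n)))) (by fun_prop)
    have h1 := net.lintegral_loc_marks hHm
    refine Eq.trans (lintegral_congr fun ω => ?_) (h1.trans (lintegral_congr fun ω => ?_))
    · rw [hH, hf]
      have e1 : siteChannel p i i (net.loc i n ω) (net.unif (i, n) ω) = net.channel i (i, n) ω :=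
        rfl
      have e2 : siteDist p i i (net.loc i n ω) = net.linkDist i (i, n) ω := rfl
      simp only [e1, e2]
      by_cases h2 : net.Active (i, n) ω
      · have h2' : (n : ℕ∞) < net.num i ω := h2
        simp [h2, h2']
      · have h2' : ¬ (n : ℕ∞) < net.num i ω := h2
        simp [h2, h2']
    · rw [hH]
      by_cases h2 : (n : ℕ∞) < net.num i ω
      · simp only [h2, if_true]
        have h3 := net.lintegral_prod_marks co {(i, n)} (fun _ => f (net.loc i n ω))
          fun _ => hfm.comp (f := fun x : ℝ × ℝ => (net.loc i n ω, x.1, x.2)) (by fun_prop)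
        simp only [Finset.prod_singleton] at h3
        rw [h3, hmean]
      · simp [h2]
  rw [← (net.poisson i).lintegral_tsum_points hFm]
  simp_rw [lintegral_config hFm]
  have hnum : ∀ n : ℕ, MeasurableSet {ω | (n : ℕ∞) < net.num i ω} :=
    fun n => net.measurableSet_active (i, n)
  have hlocm : ∀ n, Measurable (net.loc i n) := (net.poisson i).measurable_point
  rw [lintegral_tsum, lintegral_tsum]
  · simp_rw [hterm]
  · intro n
    exact (Measurable.ite (hnum n) (hFm.comp (hlocm n)) measurable_const).aemeasurable
  · intro n
    have h1 := net.measurable_linkDist i (i, n)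
    have h2 := net.gain_measurable (co, (i, n))
    exact (Measurable.ite ((hnum n).inter ((measurableSet_lt measurable_const
      (hlocm n).norm).inter (net.measurable_channel i (i, n)
        (MeasurableSet.of_discrete (s := {co}))))) (by fun_prop) measurable_const).aemeasurable

end Network

namespace Network

variable {K : ℕ} {p : Params K} {Ω : Type*} [MeasurableSpace Ω] {μ : Measure Ω}
  (net : Network p μ)
include net

theorem ae_finite_near (i : Fin (K + 1)) :
    ∀ᵐ ω ∂μ, {v : Fin (K + 1) × ℕ | v.1 = i ∧ net.Active v ω ∧ ‖net.loc v.1 v.2 ω‖ ≤ 1}.Finite := by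
  have hA : MeasurableSet (Metric.closedBall (0 : Plane) 1) := measurableSet_closedBall
  have hfin : (ENNReal.ofReal (p.lam i) • (volume : Measure Plane)) (Metric.closedBall 0 1) ≠ ∞ := by
    rw [Measure.smul_apply, smul_eq_mul]
    exact ENNReal.mul_ne_top ENNReal.ofReal_ne_top measure_closedBall_lt_top.ne
  filter_upwards [(net.poisson i).ae_config_ne_top hA hfin] with ω hω
  obtain ⟨n, hn⟩ := hω
  rw [config_apply hA] at hn
  have h1 : pointCount (net.num i) (net.loc i) (Metric.closedBall 0 1) ω ≠ ⊤ := by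
    intro h
    rw [h] at hn
    simp at hn
  have h2 : {n : ℕ | (n : ℕ∞) < net.num i ω ∧ net.loc i n ω ∈ Metric.closedBall 0 1}.Finite :=
    Set.encard_ne_top_iff.1 h1
  refine (h2.image fun n => (i, n)).subset ?_
  rintro ⟨k, n⟩ ⟨rfl, h3, h4⟩
  exact ⟨n, ⟨h3, by simpa using h4⟩, rfl⟩

/-- Almost surely only finitely many transmitters lie in the unit disc. The others have finite mean
interference by Campbell's formula, a multiple of `∫_1^∞ r^(1 - α) q(r) dr`. The near part is split
off because this integrand need not be integrable at `0`. -/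
theorem ae_summable_interferenceTerm [IsProbabilityMeasure μ] (a : Criterion) (i : Fin (K + 1))
    {co : Channel} (hm : p.m co = 1) {q : ℝ → ℝ} (hq0 : ∀ r, 0 ≤ r → 0 ≤ q r)
    (hprob : ∀ z, channelProb p i i co z = ENNReal.ofReal (q ‖z‖))
    (hint : ∀ χ, 0 < χ → IntegrableOn (fun r => r ^ (1 - p.alpha co) * q r) (Set.Ioi χ)) :
    ∀ᵐ ω ∂μ, Summable (net.interferenceTerm a i i co ω) := by
  classical
  have hP := (p.P_pos i).le
  have hfar := net.lintegral_distant_interference i hm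
  have hF : ∀ z : Plane, (if 1 < ‖z‖ then channelProb p i i co z *
        ENNReal.ofReal (p.P i * ‖z‖ ^ (-p.alpha co)) else 0) =
      ENNReal.ofReal ((Set.Ioi 1).indicator (fun r => q r * (p.P i * r ^ (-p.alpha co))) ‖z‖) := by
    intro z
    by_cases hz : 1 < ‖z‖
    · rw [if_pos hz, Set.indicator_of_mem (show ‖z‖ ∈ Set.Ioi 1 from hz), hprob,
        ← ENNReal.ofReal_mul (hq0 _ (norm_nonneg _))]
    · rw [if_neg hz, Set.indicator_of_notMem (show ‖z‖ ∉ Set.Ioi 1 from hz)]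
      simp
  have hI : IntegrableOn (fun r => r * (q r * (p.P i * r ^ (-p.alpha co)))) (Set.Ioi 1) := by
    refine IntegrableOn.congr_fun ((hint 1 one_pos).const_mul (p.P i)) (fun r hr => ?_)
      measurableSet_Ioi
    have hr0 : (0 : ℝ) < r := one_pos.trans hr
    have h1 : r ^ (1 - p.alpha co) = r * r ^ (-p.alpha co) := by
      rw [sub_eq_add_neg, Real.rpow_add hr0, Real.rpow_one]
    simp only [h1]
    ring
  simp_rw [hF] at hfar
  rw [layerIntensity, lintegral_smul_measure, lintegral_ofReal_norm zero_le_one (fun r hr =>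
    mul_nonneg (hq0 r (zero_le_one.trans (le_of_lt hr)))
      (mul_nonneg hP (Real.rpow_nonneg (zero_le_one.trans (le_of_lt hr)) _))) hI] at hfar
  have hfin := hfar.trans_ne (ENNReal.mul_ne_top ENNReal.ofReal_ne_top ENNReal.ofReal_ne_top)
  have hmeas : AEMeasurable (fun ω => ∑' n : ℕ, (if net.Active (i, n) ω ∧ 1 < ‖net.loc i n ω‖ ∧
      net.channel i (i, n) ω = co then
        ENNReal.ofReal (p.P i * net.gain (co, (i, n)) ω * net.linkDist i (i, n) ω ^ (-p.alpha co))
        else 0)) μ := by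
    refine AEMeasurable.tsum fun n => ?_
    have h1 := net.measurable_linkDist i (i, n)
    have h2 := net.gain_measurable (co, (i, n))
    exact (Measurable.ite ((net.measurableSet_active (i, n)).inter ((measurableSet_lt
      measurable_const ((net.poisson i).measurable_point n).norm).inter
      (net.measurable_channel i (i, n) (MeasurableSet.of_discrete (s := {co}))))) (by fun_prop)
      measurable_const).aemeasurable
  filter_upwards [net.ae_gain_nonneg, net.ae_finite_near i, ae_lt_top' hmeas hfin]
    with ω hg hnear hω
  set S := {v : Fin (K + 1) × ℕ | v.1 = i ∧ net.Active v ω ∧ ‖net.loc v.1 v.2 ω‖ ≤ 1}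
  have hsum := ENNReal.summable_toReal hω.ne
  set f : ℕ → ℝ := fun n => (if net.Active (i, n) ω ∧ 1 < ‖net.loc i n ω‖ ∧
      net.channel i (i, n) ω = co then
        ENNReal.ofReal (p.P i * net.gain (co, (i, n)) ω * net.linkDist i (i, n) ω ^ (-p.alpha co))
        else 0).toReal with hf
  have h1 : Summable (S.indicator (net.interferenceTerm a i i co ω)) :=
    summable_of_hasFiniteSupport (hnear.subset Set.support_indicator_subset)
  have h2 : Summable fun v : Fin (K + 1) × ℕ => if v.1 = i then f v.2 else 0 := by
    refine ((Prod.mk_right_injective i).summable_iff ?_).1 ?_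
    · rintro ⟨k, n⟩ hk
      refine if_neg fun h => hk ⟨n, ?_⟩
      rw [← h]
    · simpa [Function.comp_def] using hsum
  have hT := net.interferenceTerm_nonneg a i i co hg
  refine Summable.of_nonneg_of_le hT (fun v => ?_) (h1.add h2)
  obtain ⟨k, n⟩ := v
  have hi1 : 0 ≤ S.indicator (net.interferenceTerm a i i co ω) (k, n) :=
    Set.indicator_nonneg (fun v _ => hT v) _
  have hi2 : 0 ≤ if k = i then f n else 0 := by
    split_ifs
    · exact ENNReal.toReal_nonneg
    · exact le_rfl
  by_cases hk : net.Active (k, n) ω ∧ k = i ∧ net.channel i (k, n) ω = co ∧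
      ¬ net.IsAssociated a i (k, n) ω
  · obtain ⟨hk1, rfl, hk2, hk3⟩ := hk
    by_cases hl : ‖net.loc k n ω‖ ≤ 1
    · have : (k, n) ∈ S := ⟨rfl, hk1, hl⟩
      rw [Set.indicator_of_mem this]
      simpa using hi2
    · have h3 : f n = net.interferenceTerm a k k co ω (k, n) := by
        rw [hf]
        simp only
        rw [if_pos ⟨hk1, not_le.1 hl, hk2⟩, ENNReal.toReal_ofReal, interferenceTerm,
          if_pos ⟨hk1, rfl, hk2, hk3⟩]
        exact mul_nonneg (mul_nonneg hP (hg _)) (Real.rpow_nonneg (Real.sqrt_nonneg _) _)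
      simp only [if_true, h3]
      linarith
  · have h3 : net.interferenceTerm a i i co ω (k, n) = 0 := if_neg hk
    rw [h3]
    exact add_nonneg hi1 hi2

/-! ### The conditional Laplace transform. -/

theorem lintegral_condDistrib_eq [IsProbabilityMeasure μ] (a : Criterion) (i : Fin (K + 1))
    {co : Channel} (hm : p.m co = 1)
    (hsum : ∀ᵐ ω ∂μ, Summable (net.interferenceTerm a i i co ω)) {s : ℝ} (hs : 0 ≤ s) :
    ∀ᵐ e ∂(μ.map (net.mainLink a i)), 0 < e.2.2 →
      ∫⁻ x, ENNReal.ofReal (Real.exp (-(s * x)))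
        ∂(condDistrib (net.interference a i i co) (net.mainLink a i) μ e) =
      expNeg (∫⁻ y, avgLoss p a i co s (linkMetric p a e) y ∂(layerIntensity p i)) := by
  have hML := net.measurable_mainLink a i
  have hIm := net.measurable_interference a i i co
  have : IsProbabilityMeasure (μ.map (net.mainLink a i)) :=
    Measure.isProbabilityMeasure_map hML.aemeasurable
  have hpos : MeasurableSet {e : Fin (K + 1) × Channel × ℝ | 0 < e.2.2} :=
    measurableSet_lt measurable_const (by fun_prop)
  have hexp : Measurable fun x : ℝ => ENNReal.ofReal (Real.exp (-(s * x))) := by fun_prop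
  set Φ : Fin (K + 1) × Channel × ℝ → ℝ≥0∞ := fun e =>
    ∫⁻ x, ENNReal.ofReal (Real.exp (-(s * x)))
      ∂(condDistrib (net.interference a i i co) (net.mainLink a i) μ e) with hΦ
  have hΦm : Measurable Φ := hexp.lintegral_kernel
  set Ψ : Fin (K + 1) × Channel × ℝ → ℝ≥0∞ := fun e =>
    expNeg (∫⁻ y, avgLoss p a i co s (linkMetric p a e) y ∂(layerIntensity p i)) with hΨ
  have hΨm : Measurable Ψ := by
    refine measurable_expNeg.comp ?_
    have h1 : Measurable fun q : (Fin (K + 1) × Channel × ℝ) × Plane =>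
        avgLoss p a i co s (linkMetric p a q.1) q.2 :=
      (measurable_avgLoss p a i co s).comp
        (f := fun q : (Fin (K + 1) × Channel × ℝ) × Plane => (linkMetric p a q.1, q.2))
        (((measurable_linkMetric p a).comp measurable_fst).prodMk measurable_snd)
    exact h1.lintegral_prod_right'
  -- Both functions have the same integral over every measurable set of main links of positive
  -- length: the indicator of that set is the test function, and `condDistrib` disintegrates the
  -- joint law.
  have key : ∀ᵐ e ∂((μ.map (net.mainLink a i)).restrict {e | 0 < e.2.2}), Φ e = Ψ e := by
    refine ae_eq_of_forall_setLIntegral_eq_of_sigmaFinite hΦm hΨm fun S hS _ => ?_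
    rw [Measure.restrict_restrict hS]
    set T := S ∩ {e : Fin (K + 1) × Channel × ℝ | 0 < e.2.2} with hT
    have hTm : MeasurableSet T := hS.inter hpos
    have h1 := net.lintegral_mainLink_mul_expNeg_eq a i hm hs (ψ := T.indicator 1)
      (measurable_one.indicator hTm) fun e he =>
        Set.indicator_of_notMem (fun h => absurd h.2 (not_lt.2 he)) _
    rw [← lintegral_indicator hTm, ← lintegral_indicator hTm]
    have h2 : ∫⁻ e, T.indicator Ψ e ∂(μ.map (net.mainLink a i)) =
        ∫⁻ ω, T.indicator 1 (net.mainLink a i ω) * Ψ (net.mainLink a i ω) ∂μ := by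
      rw [lintegral_map (hΨm.indicator hTm) hML]
      refine lintegral_congr fun ω => ?_
      by_cases h : net.mainLink a i ω ∈ T <;> simp [h]
    have h3 : ∫⁻ e, T.indicator Φ e ∂(μ.map (net.mainLink a i)) =
        ∫⁻ ω, T.indicator 1 (net.mainLink a i ω) *
          ENNReal.ofReal (Real.exp (-(s * net.interference a i i co ω))) ∂μ := by
      have hG : Measurable fun q : (Fin (K + 1) × Channel × ℝ) × ℝ =>
          T.indicator (1 : Fin (K + 1) × Channel × ℝ → ℝ≥0∞) q.1 * ENNReal.ofReal (Real.exp (-(s * q.2))) :=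
        ((measurable_one.indicator hTm).comp measurable_fst).mul (hexp.comp measurable_snd)
      have h4 := lintegral_map (μ := μ) hG (hML.prodMk hIm)
      rw [← compProd_map_condDistrib hIm.aemeasurable, Measure.lintegral_compProd hG] at h4
      rw [← h4]
      refine lintegral_congr fun e => ?_
      simp only
      rw [lintegral_const_mul _ hexp]
      by_cases h : e ∈ T <;> simp [h, hΦ]
    rw [h2, h3, ← h1]
    refine lintegral_congr_ae ?_
    -- A divergent real series has the value `0`, a divergent one in `[0, ∞]` the value `∞`;
    -- summability makes the two sums agree.
    filter_upwards [hsum, net.ae_gain_nonneg] with ω hω hg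
    have hT0 := net.interferenceTerm_nonneg a i i co hg
    rw [← ENNReal.ofReal_tsum_of_nonneg (fun v => mul_nonneg hs (hT0 v)) (hω.mul_left s),
      tsum_mul_left, expNeg_ofReal (mul_nonneg hs (tsum_nonneg hT0))]
    rfl
  exact (ae_restrict_iff' hpos).1 key

/-- This provides the bound `e^(-|t| x) ≤ 1` under the conditional law, needed for continuity of the
Laplace transform. -/
theorem ae_condDistrib_nonneg [IsProbabilityMeasure μ] (a : Criterion) (i : Fin (K + 1))
    (co : Channel) :
    ∀ᵐ e ∂(μ.map (net.mainLink a i)),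
      ∀ᵐ x ∂(condDistrib (net.interference a i i co) (net.mainLink a i) μ e), 0 ≤ x := by
  have hML := net.measurable_mainLink a i
  have hIm := net.measurable_interference a i i co
  have : IsProbabilityMeasure (μ.map (net.mainLink a i)) :=
    Measure.isProbabilityMeasure_map hML.aemeasurable
  refine Measure.ae_ae_of_ae_compProd (p := fun q : (Fin (K + 1) × Channel × ℝ) × ℝ => 0 ≤ q.2) ?_
  rw [compProd_map_condDistrib hIm.aemeasurable,
    ae_map_iff (hML.prodMk hIm).aemeasurable (measurableSet_le measurable_const measurable_snd)]
  filter_upwards [net.ae_gain_nonneg] with ω hg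
  exact tsum_nonneg (net.interferenceTerm_nonneg a i i co hg)

/-- The exceptional null set of main links depends on `s`. It is discarded for the values `|t|` with
`t` rational only, and continuity of both sides extends the identity. Writing `|t|` makes both sides
continuous on all of `ℝ`, where `ℚ` is dense. -/
theorem ae_condLaplace_eq [IsProbabilityMeasure μ] (a : Criterion) (i : Fin (K + 1))
    {co : Channel} (hm : p.m co = 1) {q : ℝ → ℝ} (hq : Measurable q)
    (hq0 : ∀ r, 0 ≤ r → 0 ≤ q r)
    (hprob : ∀ z, channelProb p i i co z = ENNReal.ofReal (q ‖z‖))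
    (hint : ∀ χ, 0 < χ → IntegrableOn (fun r => r ^ (1 - p.alpha co) * q r) (Set.Ioi χ)) :
    ∀ᵐ e ∂(μ.map (net.mainLink a i)), 0 < e.2.2 → ∀ s : ℝ, 0 ≤ s →
      net.condLaplace a i i co e s = Real.exp (-(2 * Real.pi * p.lam i *
        ∫ r in Set.Ioi (exclusionDist p a i co e),
          radialLoss (s * p.P i) (p.alpha co) q r)) := by
  have hsum := net.ae_summable_interferenceTerm a i hm hq0 hprob hint
  have h1 := ae_all_iff.2 fun t : ℚ =>
    net.lintegral_condDistrib_eq a i hm hsum (abs_nonneg (t : ℝ))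
  filter_upwards [h1, net.ae_condDistrib_nonneg a i co] with e he hnn hy s hs
  set χ := exclusionDist p a i co e
  have hχ : 0 < χ := exclusionDist_pos p a i co e hy
  set Q := condDistrib (net.interference a i i co) (net.mainLink a i) μ e with hQ
  have hrat : ∀ t : ℚ, ∫ x, Real.exp (-(|(t : ℝ)| * x)) ∂Q = Real.exp (-(2 * Real.pi * p.lam i *
      ∫ r in Set.Ioi χ, radialLoss (|(t : ℝ)| * p.P i) (p.alpha co) q r)) := by
    intro t
    have h2 := he t hy
    have hnn0 : 0 ≤ 2 * Real.pi * p.lam i *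
        ∫ r in Set.Ioi χ, radialLoss (|(t : ℝ)| * p.P i) (p.alpha co) q r := by
      refine mul_nonneg (mul_nonneg Real.two_pi_pos.le (p.lam_nonneg i))
        (setIntegral_nonneg measurableSet_Ioi fun r hr => ?_)
      have hr0 : 0 ≤ r := (hχ.trans hr).le
      exact radialLoss_nonneg hr0 (mul_nonneg (abs_nonneg _) (p.P_pos i).le) (hq0 r hr0)
    rw [lintegral_avgLoss p a i co hq hq0 hprob hint e hy (abs_nonneg _),
      expNeg_ofReal hnn0] at h2
    rw [integral_eq_lintegral_of_nonneg_ae (ae_of_all _ fun x => (Real.exp_pos _).le)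
      (Measurable.aestronglyMeasurable (by fun_prop)), h2,
      ENNReal.toReal_ofReal (Real.exp_pos _).le]
  have hc1 : Continuous fun t : ℝ => ∫ x, Real.exp (-(|t| * x)) ∂Q := by
    refine continuous_of_dominated (bound := fun _ => 1)
      (fun t => Measurable.aestronglyMeasurable (by fun_prop)) (fun t => ?_)
      (integrable_const 1) (ae_of_all _ fun x => by fun_prop)
    filter_upwards [hnn] with x hx
    rw [Real.norm_of_nonneg (Real.exp_pos _).le, Real.exp_le_one_iff]
    exact neg_nonpos.2 (mul_nonneg (abs_nonneg _) hx)
  have hc2 := continuous_integral_radialLoss hχ (p.P_pos i).le hq hq0 (hint χ hχ)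
  have h3 := congrFun (Rat.denseRange_cast.equalizer hc1
    (Real.continuous_exp.comp (hc2.const_mul (2 * Real.pi * p.lam i)).neg) (funext hrat)) s
  simp only [Function.comp_apply, Pi.neg_apply, abs_of_nonneg hs] at h3
  exact h3

end Network

/-! ### The environment probabilities and the decay rate `η`. -/

section LineOfSight

variable {K : ℕ} (p : Params K)

theorem channelProb_lineOfSight (i k : Fin (K + 1)) (z : Plane) :
    channelProb p i k Channel.L z = ENNReal.ofReal (p.rho i k (siteDist p i k z)) := by
  classical
  set r := p.rho i k (siteDist p i k z) with hr
  have hmem := p.rho_mem i k (siteDist p i k z)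
  have h1 : ∀ u : ℝ, (if siteChannel p i k z u = Channel.L then (1 : ℝ≥0∞) else 0) =
      (Set.Iic r).indicator 1 u := by
    intro u
    by_cases hu : u ≤ r
    · have h2 : siteChannel p i k z u = Channel.L := if_pos hu
      simp [h2, hu]
    · have h2 : siteChannel p i k z u = Channel.N := if_neg hu
      simp [h2, hu]
  unfold channelProb
  simp only [h1]
  rw [lintegral_indicator_one measurableSet_Iic, Measure.restrict_apply measurableSet_Iic]
  have h3 : Set.Iic r ∩ Set.Icc 0 1 = Set.Icc 0 r := by
    ext u
    simp only [Set.mem_inter_iff, Set.mem_Iic, Set.mem_Icc]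
    have := hmem.2
    constructor
    · rintro ⟨h4, h5, -⟩
      exact ⟨h5, h4⟩
    · rintro ⟨h4, h5⟩
      exact ⟨h5, h4, h5.trans this⟩
  rw [h3, Real.volume_Icc, sub_zero]

theorem channelProb_nonLineOfSight (i k : Fin (K + 1)) (z : Plane) :
    channelProb p i k Channel.N z = ENNReal.ofReal (1 - p.rho i k (siteDist p i k z)) := by
  classical
  set r := p.rho i k (siteDist p i k z) with hr
  have hmem := p.rho_mem i k (siteDist p i k z)
  have h1 : ∀ u : ℝ, (if siteChannel p i k z u = Channel.N then (1 : ℝ≥0∞) else 0) =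
      (Set.Ioi r).indicator 1 u := by
    intro u
    by_cases hu : u ≤ r
    · have h2 : siteChannel p i k z u = Channel.L := if_pos hu
      simp [h2, hu]
    · have h2 : siteChannel p i k z u = Channel.N := if_neg hu
      simp [h2, not_le.1 hu]
  unfold channelProb
  simp only [h1]
  rw [lintegral_indicator_one measurableSet_Ioi, Measure.restrict_apply measurableSet_Ioi]
  have h3 : Set.Ioi r ∩ Set.Icc 0 1 = Set.Ioc r 1 := by
    ext u
    simp only [Set.mem_inter_iff, Set.mem_Ioi, Set.mem_Icc, Set.mem_Ioc]
    have := hmem.1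
    constructor
    · rintro ⟨h4, -, h5⟩
      exact ⟨h4, h5⟩
    · rintro ⟨h4, h5⟩
      exact ⟨h4, this.trans h4.le, h5⟩
  rw [h3, Real.volume_Ioc]

theorem one_sub_exp_mem_Ioo {h xi : ℝ} (hh : 0 < h) (hxi : 0 < xi) :
    1 - Real.exp (-(h ^ 2 / (2 * xi ^ 2))) ∈ Set.Ioo (0 : ℝ) 1 := by
  have h1 : Real.exp (-(h ^ 2 / (2 * xi ^ 2))) < 1 := by
    rw [Real.exp_lt_one_iff]
    exact neg_neg_of_pos (by positivity)
  constructor <;> linarith [Real.exp_pos (-(h ^ 2 / (2 * xi ^ 2)))]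

/-- Positive altitude puts the base `1 - e^(-h²/(2ξ²))` strictly between `0` and `1`, so its
logarithm is negative. -/
theorem eta_pos {mu nu xi h : ℝ} (hmu : 0 < mu) (hnu : 0 < nu) (hxi : 0 < xi) (hh : 0 < h) :
    0 < eta mu nu xi h := by
  have hb := one_sub_exp_mem_Ioo hh hxi
  exact mul_pos_of_neg_of_neg (neg_neg_of_pos (Real.sqrt_pos.2 (mul_pos hmu hnu)))
    (Real.log_neg hb.1 hb.2)

theorem rpow_eq_exp_eta {h xi : ℝ} (mu nu x : ℝ) (hh : 0 < h) (hxi : 0 < xi) :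
    (1 - Real.exp (-(h ^ 2 / (2 * xi ^ 2)))) ^ (x * Real.sqrt (nu * mu)) =
      Real.exp (-(eta mu nu xi h * x)) := by
  rw [Real.rpow_def_of_pos (one_sub_exp_mem_Ioo hh hxi).1, eta, mul_comm nu mu]
  congr 1
  ring

end LineOfSight

end MAN

end

/-! ### The theorem: `q(r) = e^(-ηr)` for line of sight and `q(r) = 1 - e^(-ηr)` otherwise. -/

theorem corollary1 {K : ℕ} (p : MAN.Params K) (i : Fin (K + 1)) (hi : 0 < p.h i)
    (mu nu xi : ℝ) (hmu : 0 < mu) (hnu : 0 < nu) (hxi : 0 < xi)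
    (hrho : ∀ x : ℝ, 0 ≤ x → p.rho i i x =
      (1 - Real.exp (-(p.h i ^ 2 / (2 * xi ^ 2)))) ^ (x * Real.sqrt (nu * mu)))
    (hmL : p.m MAN.Channel.L = 1) (hmN : p.m MAN.Channel.N = 1)
    {Ω : Type*} [MeasurableSpace Ω] (μ : MeasureTheory.Measure Ω)
    [MeasureTheory.IsProbabilityMeasure μ]
    (net : MAN.Network p μ) (a : MAN.Criterion) :
    ((∀ᵐ ω ∂μ, Summable (net.interferenceTerm a i i MAN.Channel.L ω)) ∧
      ∀ᵐ e ∂(μ.map (net.mainLink a i)), 0 < e.2.2 → ∀ s : ℝ, 0 ≤ s →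
        s * p.P i * MAN.exclusionDist p a i MAN.Channel.L e ^ (-p.alpha MAN.Channel.L) < 1 →
        Summable (fun n : ℕ => MAN.losTerm (s * p.P i) (p.alpha MAN.Channel.L)
          (MAN.eta mu nu xi (p.h i)) (MAN.exclusionDist p a i MAN.Channel.L e) (n + 1)) ∧
        net.condLaplace a i i MAN.Channel.L e s =
          Real.exp (2 * Real.pi * p.lam i *
            ∑' n : ℕ, MAN.losTerm (s * p.P i) (p.alpha MAN.Channel.L)
              (MAN.eta mu nu xi (p.h i)) (MAN.exclusionDist p a i MAN.Channel.L e) (n + 1))) ∧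
    (2 < p.alpha MAN.Channel.N →
      (∀ᵐ ω ∂μ, Summable (net.interferenceTerm a i i MAN.Channel.N ω)) ∧
      ∀ᵐ e ∂(μ.map (net.mainLink a i)), 0 < e.2.2 → ∀ s : ℝ, 0 ≤ s →
        s * p.P i * MAN.exclusionDist p a i MAN.Channel.N e ^ (-p.alpha MAN.Channel.N) < 1 →
        Summable (fun n : ℕ => MAN.nlosTerm (s * p.P i) (p.alpha MAN.Channel.N)
          (MAN.eta mu nu xi (p.h i)) (MAN.exclusionDist p a i MAN.Channel.N e) (n + 1)) ∧
        net.condLaplace a i i MAN.Channel.N e s =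
          Real.exp (2 * Real.pi * p.lam i *
            ∑' n : ℕ, MAN.nlosTerm (s * p.P i) (p.alpha MAN.Channel.N)
              (MAN.eta mu nu xi (p.h i)) (MAN.exclusionDist p a i MAN.Channel.N e) (n + 1))) := by
  have hη := MAN.eta_pos hmu hnu hxi hi
  have hrate : ∀ z : MAN.Plane, p.rho i i (MAN.siteDist p i i z) =
      Real.exp (-(MAN.eta mu nu xi (p.h i) * ‖z‖)) := fun z => by
    rw [MAN.siteDist_self, hrho _ (norm_nonneg z), MAN.rpow_eq_exp_eta mu nu _ hi hxi]
  refine ⟨?_, fun hα => ?_⟩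
  · have hα := p.two_le_alpha MAN.Channel.L
    have hprob : ∀ z : MAN.Plane, MAN.channelProb p i i MAN.Channel.L z =
        ENNReal.ofReal ((fun r => Real.exp (-(MAN.eta mu nu xi (p.h i) * r))) ‖z‖) := fun z => by
      rw [MAN.channelProb_lineOfSight, hrate]
    have hint := fun (χ : ℝ) (hχ : 0 < χ) =>
      MAN.integrableOn_rpow_mul_exp (α := p.alpha MAN.Channel.L) hχ (by linarith) hη
    refine ⟨net.ae_summable_interferenceTerm a i hmL (fun r _ => (Real.exp_pos _).le) hprob hint,
      ?_⟩
    filter_upwards [net.ae_condLaplace_eq a i hmL (by fun_prop) (fun r _ => (Real.exp_pos _).le)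
      hprob hint] with e he hy s hs hsχ
    have h := MAN.hasSum_losTerm (MAN.exclusionDist_pos p a i MAN.Channel.L e hy) hα hη
      (mul_nonneg hs (p.P_pos i).le) hsχ
    exact ⟨h.summable, by rw [he hy s hs, h.tsum_eq, mul_neg]⟩
  · have hprob : ∀ z : MAN.Plane, MAN.channelProb p i i MAN.Channel.N z =
        ENNReal.ofReal ((fun r => 1 - Real.exp (-(MAN.eta mu nu xi (p.h i) * r))) ‖z‖) :=
      fun z => by rw [MAN.channelProb_nonLineOfSight, hrate]
    have hint := fun (χ : ℝ) (hχ : 0 < χ) => MAN.integrableOn_rpow_mul_one_sub_exp hχ hα hη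
    have hq0 := fun (r : ℝ) (hr : 0 ≤ r) => MAN.one_sub_exp_nonneg hη hr
    refine ⟨net.ae_summable_interferenceTerm a i hmN hq0 hprob hint, ?_⟩
    filter_upwards [net.ae_condLaplace_eq a i hmN (by fun_prop) hq0 hprob hint]
      with e he hy s hs hsχ
    have h := MAN.hasSum_nlosTerm (MAN.exclusionDist_pos p a i MAN.Channel.N e hy) hα hη
      (mul_nonneg hs (p.P_pos i).le) hsχ
    exact ⟨h.summable, by rw [he hy s hs, h.tsum_eq, mul_neg]⟩
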